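/- Let $n\ge 0$ and let $a<b$ be integers. Let $\check M=\{[t_0:\dots:t_n]\in\mathbb{C}P^n : t_0\cdots t_n\neq 0\}$ with coordinates $w_j=t_j/t_0=e^{z_j}$, $z_j=x_j+\mathbf{i}y_j$, and let $x^j=\dfrac{2e^{2x_j}}{1+e^{2x_1}+\cdots+e^{2x_n}}$ be the dual coordinates, which take values in the interior of $P=\{(x^1,\dots,x^n) : x^j\ge 0,\ x^1+\cdots+x^n\le 2\}$. **The complex $\mathcal V'(\mathcal O(a),\mathcal O(b))$.** For $c\in\mathbb Z$ put $\Psi_c=(1+e^{2x_1}+\cdots+e^{2x_n})^{c/2}$ and $s_c^j=\frac c2x^j$. In degree $r$, $\mathcal V'(\mathcal O(a),\mathcal O(b))$ is the space of the $(0,r)$-forms $\psi=\Psi_b^{-1}\tilde\psi\,\Psi_a$ on $\check M$, where $\tilde\psi$ is a smooth $(0,r)$-form on all of $\mathbb{C}P^n$ with values in $\mathrm{Hom}(\mathcal O(a),\mathcal O(b))$, written on $\{t_0\ne0\}$ in the frames $t_0^a,t_0^b$. Its differential is $d_{ab}\psi=2\bar\partial\psi-\sum_j(s_a-s_b)^j\,d\bar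 z_j\wedge\psi$. **The complex $\mathit{Mo}(P)(L_a,L_b)$.** Let $L_c$ be the graph over $P$ of $y^j=s^j_c$, with the fibre coordinates $y^j$ taken modulo $\mathbb Z$, and let $\pi$ be the projection to $P$. A point of $\pi(L_a\cap L_b)$ has label $I\in\mathbb Z^n$ if $s_a=s_b-I$ there. For such a point $v$ let $S_v\subset\mathbb R^n$ be its stable manifold for the vector field $-\sum_j(s_a-s_b+I)^j\,\partial/\partial x^j$, which is $-\mathrm{grad}$ of the difference of the potentials of the two lifts $s_a$ and $s_b-I$. The graded vector space $\mathit{Mo}(P)(L_a,L_b)$ is spanned over $\mathbb C$ by the connected components $V$ of $\pi(L_a\cap L_b)$ that contain a point $v$ which is interior to $S_v\cap P$ in $S_v$. The degree of $V$ is $\dim S_v$, $v\in V$. The differential is zero. **The sections.** For $I=(i_1,\dots,i_n)\in\mathbb Z_{\ge0}^n$ with $|I|=i_1+\cdots+i_n\le b-a$ put $$\mathbf e_{ab;I}=c_{ab;I}\left(\sqrt{\tfrac{2-x^1-\cdots-x^n}{2}}\right)^{b-a-|I|}\prod_{j=1}^n\left(\sqrt{\tfrac{x^j}{2}}\,e^{\mathbf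 i y_j}\right)^{i_j},$$ with the constant $c_{ab;I}>0$ chosen so that $\max_{P}|\mathbf e_{ab;I}|=1$; the absolute value does not depend on $(y_j)$. **Claim.** 1. Each $\mathbf e_{ab;I}$ lies in $\mathcal V'^{\,0}(\mathcal O(a),\mathcal O(b))$ and $d_{ab}\mathbf e_{ab;I}=0$, and the set $\{x\in P : |\mathbf e_{ab;I}(x)|=1\}$ consists of the single point $v_{ab;I}=\left(\frac{2i_1}{b-a},\dots,\frac{2i_n}{b-a}\right)$. 2. The set of points of $\pi(L_a\cap L_b)$ with label $I$ is $\{v_{ab;I}\}$, and $V_{ab;I}=\{v_{ab;I}\}$ is a connected component of $\pi(L_a\cap L_b)$. It is a generator of $\mathit{Mo}(P)(L_a,L_b)$ of degree $0$. Every generator of $\mathit{Mo}(P)(L_a,L_b)$, of whatever degree and label, is one of these $V_{ab;I}$, with label $I$. 3. There is a morphism of cochain complexes $\iota:\mathit{Mo}(P)(L_a,L_b)\to\mathcal V'(\mathcal O(a),\mathcal O(b))$ with $\iota(V_{ab;I})=\mathbf e_{ab;I}$ for all $I$, and it is a quasi-isomorphism. -/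

import Mathlib

namespace CPnMirror

noncomputable section

open scoped ContDiff Topology ENNReal
open ContinuousAlternatingMap

/-- Complex-valued differential `r`-forms on `ℂⁿ` (no smoothness, no type condition). -/
abbrev Form (n r : ℕ) : Type := (Fin n → ℂ) → (Fin n → ℂ) [⋀^Fin r]→L[ℝ] ℂ

/-- An alternating real-multilinear form is of type `(0, r)`: conjugate-linear in every slot. -/
def IsAntilinear {n r : ℕ} (α : (Fin n → ℂ) [⋀^Fin r]→L[ℝ] ℂ) : Prop :=
  ∀ (v : Fin r → Fin n → ℂ) (i : Fin r) (c : ℂ),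
    α (Function.update v i (c • v i)) = (starRingEnd ℂ) c * α v

/-- Smooth differential forms of type `(0, r)` on `ℂⁿ`. -/
def smoothForms (n r : ℕ) : Submodule ℂ (Form n r) where
  carrier := {ψ | ContDiff ℝ ∞ ψ ∧ ∀ p, IsAntilinear (ψ p)}
  zero_mem' := ⟨contDiff_const, fun p v i c => by simp⟩
  add_mem' := fun {ψ η} hψ hη => ⟨hψ.1.add hη.1, fun p v i c => by
    simp [hψ.2 p v i c, hη.2 p v i c, mul_add]⟩
  smul_mem' := fun a ψ hψ => ⟨contDiff_const.smul hψ.1, fun p v i c => by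
    simp [hψ.2 p v i c, mul_left_comm]⟩

/-- The conjugate-linear part `v ↦ (A v + i A (i v)) / 2` of a real-linear map. -/
def antilinearPart {n : ℕ} {F : Type*} [NormedAddCommGroup F] [NormedSpace ℂ F]
    (A : (Fin n → ℂ) →L[ℝ] F) : (Fin n → ℂ) →L[ℝ] F :=
  (1 / 2 : ℂ) • (A + Complex.I • A.comp (Complex.I • ContinuousLinearMap.id ℝ (Fin n → ℂ)))

/-- The Dolbeault operator on forms of type `(0, r)`:
`∂̄ψ (v₀, …, v_r) = ∑ (-1)^i (∂̄_{v_i} ψ)(v₀, …, v̂_i, …, v_r)`, that is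
`∑ dz̄_j ∧ ∂ψ/∂z̄_j`. For forms of type `(0, r)` this is the `(0, r + 1)` part of `dψ`. -/
def dbar {n r : ℕ} (ψ : Form n r) : Form n (r + 1) := fun p =>
  alternatizeUncurryFin (antilinearPart (fderiv ℝ ψ p))

/-- The pullback `G^* ψ` of a differential form. -/
def pullForm {n r : ℕ} (G : (Fin n → ℂ) → (Fin n → ℂ)) (ψ : Form n r) : Form n r := fun p =>
  (ψ (G p)).compContinuousLinearMap (fderiv ℝ G p)

section lemmas
variable {n r : ℕ}

theorem antilinearPart_apply {F : Type*} [NormedAddCommGroup F] [NormedSpace ℂ F]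
    (A : (Fin n → ℂ) →L[ℝ] F) (v : Fin n → ℂ) :
    antilinearPart A v = (1 / 2 : ℂ) • (A v + Complex.I • A (Complex.I • v)) := by
  simp [antilinearPart]

theorem antilinearPart_smul {F : Type*} [NormedAddCommGroup F] [NormedSpace ℂ F]
    (A : (Fin n → ℂ) →L[ℝ] F) (c : ℂ) (v : Fin n → ℂ) :
    antilinearPart A (c • v) = (starRingEnd ℂ) c • antilinearPart A v := by
  have hI : antilinearPart A (Complex.I • v) = -Complex.I • antilinearPart A v := by
    rw [antilinearPart_apply, antilinearPart_apply, smul_smul Complex.I, Complex.I_mul_I,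
      neg_one_smul, map_neg]
    match_scalars
    · linear_combination (1 / 2 : ℂ) * Complex.I_mul_I
    · ring
  have h : c • v = c.re • v + c.im • (Complex.I • v) := by
    ext j
    simp only [Pi.smul_apply, Pi.add_apply, smul_eq_mul, Complex.real_smul]
    nth_rewrite 1 [← Complex.re_add_im c]
    ring
  rw [h, map_add, map_smul, map_smul, hI]
  nth_rewrite 3 [← Complex.re_add_im c]
  simp only [map_add, map_mul, Complex.conj_ofReal, Complex.conj_I, add_smul,
    ← Complex.coe_smul, smul_smul]

/-- `antilinearPart` as a continuous linear map. -/
def antilinearPartL (n : ℕ) (F : Type*) [NormedAddCommGroup F] [NormedSpace ℂ F] :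
    ((Fin n → ℂ) →L[ℝ] F) →L[ℝ] ((Fin n → ℂ) →L[ℝ] F) :=
  (1 / 2 : ℂ) • (ContinuousLinearMap.id ℝ _ + Complex.I •
    ((ContinuousLinearMap.compL ℝ (Fin n → ℂ) (Fin n → ℂ) F).flip
      (Complex.I • ContinuousLinearMap.id ℝ (Fin n → ℂ))))

theorem antilinearPartL_apply {F : Type*} [NormedAddCommGroup F] [NormedSpace ℂ F]
    (A : (Fin n → ℂ) →L[ℝ] F) : antilinearPartL n F A = antilinearPart A := by
  ext v
  simp [antilinearPartL, antilinearPart]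

theorem IsAntilinear.zero : IsAntilinear (0 : (Fin n → ℂ) [⋀^Fin r]→L[ℝ] ℂ) :=
  fun v i c => by simp

theorem IsAntilinear.add {α β : (Fin n → ℂ) [⋀^Fin r]→L[ℝ] ℂ} (hα : IsAntilinear α)
    (hβ : IsAntilinear β) : IsAntilinear (α + β) := fun v i c => by
  simp [hα v i c, hβ v i c, mul_add]

theorem IsAntilinear.smul {α : (Fin n → ℂ) [⋀^Fin r]→L[ℝ] ℂ} (hα : IsAntilinear α) (a : ℂ) :
    IsAntilinear (a • α) := fun v i c => by
  simp [hα v i c, mul_left_comm]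

/-- Alternatization of a conjugate-linear map into forms of type `(0, r)`. -/
theorem IsAntilinear.alternatize {A : (Fin n → ℂ) →L[ℝ] (Fin n → ℂ) [⋀^Fin r]→L[ℝ] ℂ}
    (hA : ∀ (c : ℂ) v, A (c • v) = (starRingEnd ℂ) c • A v) (hA' : ∀ v, IsAntilinear (A v)) :
    IsAntilinear (alternatizeUncurryFin A) := by
  intro v i c
  rw [alternatizeUncurryFin_apply, alternatizeUncurryFin_apply, Finset.mul_sum]
  refine Finset.sum_congr rfl fun j _ => ?_
  rw [mul_smul_comm]
  congr 1
  rcases Fin.eq_self_or_eq_succAbove j i with rfl | ⟨k, rfl⟩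
  · simp [hA]
  · rw [Fin.removeNth_update_succAbove, Function.update_of_ne (Fin.succAbove_ne j k).symm]
    exact hA' _ _ k c

theorem isAntilinear_fderiv {ψ : Form n r} (hψ : Differentiable ℝ ψ)
    (h : ∀ p, IsAntilinear (ψ p)) (p u : Fin n → ℂ) : IsAntilinear (fderiv ℝ ψ p u) := by
  intro v i c
  have key : ∀ w, fderiv ℝ ψ p u w = fderiv ℝ (fun q => ψ q w) p u := fun w =>
    (fderiv_continuousAlternatingMap_apply_const_apply (hψ p) w u).symm
  rw [key, key]
  simp only [fun q => h q v i c]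
  rw [fderiv_const_mul ((hψ p).continuousAlternatingMap_apply_const v)]
  simp

theorem dbar_mem {ψ : Form n r} (hψ : ψ ∈ smoothForms n r) : dbar ψ ∈ smoothForms n (r + 1) := by
  have hd : Differentiable ℝ ψ := hψ.1.differentiable (by simp)
  refine ⟨?_, fun p => IsAntilinear.alternatize (fun c v => antilinearPart_smul _ c v) fun v => ?_⟩
  · have h1 : ContDiff ℝ ∞ (fderiv ℝ ψ) := hψ.1.fderiv_right (by simp)
    have h2 : dbar ψ = fun p => alternatizeUncurryFinCLM ℝ _ _ (antilinearPartL n _ (fderiv ℝ ψ p)) := by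
      ext1 p
      rw [antilinearPartL_apply]; rfl
    rw [h2]
    exact (alternatizeUncurryFinCLM ℝ (Fin n → ℂ) ℂ).contDiff.comp
      ((antilinearPartL n ((Fin n → ℂ) [⋀^Fin r]→L[ℝ] ℂ)).contDiff.comp h1)
  · rw [antilinearPart_apply]
    exact ((isAntilinear_fderiv hd hψ.2 p v).add
      ((isAntilinear_fderiv hd hψ.2 p _).smul _)).smul _

theorem dbar_dbar {ψ : Form n r} (hψ : ContDiff ℝ ∞ ψ) : dbar (dbar ψ) = 0 := by
  ext1 p
  have h1 : ContDiff ℝ ∞ (fderiv ℝ ψ) := hψ.fderiv_right (by simp)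
  set D := fderiv ℝ (fderiv ℝ ψ) p with hD
  have hsym : ∀ x y, D x y = D y x := fun x y =>
    (hψ.contDiffAt.isSymmSndFDerivAt (x := p) (by simp; exact WithTop.coe_le_coe.2 le_top)).eq x y
  have h2 : dbar ψ = fun p => ((alternatizeUncurryFinCLM ℝ _ _).comp (antilinearPartL n _))
      (fderiv ℝ ψ p) := by
    ext1 p
    simp [antilinearPartL_apply]; rfl
  have h3 : fderiv ℝ (dbar ψ) p =
      ((alternatizeUncurryFinCLM ℝ _ _).comp (antilinearPartL n _)).comp D := by
    rw [h2]
    exact ((ContinuousLinearMap.hasFDerivAt _).comp p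
      (h1.differentiable (by simp) p).hasFDerivAt).fderiv
  have h4 : antilinearPart (fderiv ℝ (dbar ψ) p) =
      (alternatizeUncurryFinCLM ℝ _ _).comp (antilinearPart ((antilinearPartL n _).comp D)) := by
    rw [h3]
    ext1 v
    simp only [antilinearPart_apply, ContinuousLinearMap.comp_apply, alternatizeUncurryFinCLM_apply,
      alternatizeUncurryFin_smul, alternatizeUncurryFin_add]
  show alternatizeUncurryFin (antilinearPart (fderiv ℝ (dbar ψ) p)) = 0
  rw [h4]
  refine alternatizeUncurryFin_alternatizeUncurryFinCLM_comp_of_symmetric fun x y => ?_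
  simp only [antilinearPart_apply, ContinuousLinearMap.comp_apply, antilinearPartL_apply,
    _root_.add_apply, _root_.smul_apply]
  rw [hsym x y, hsym (Complex.I • x) y, hsym x (Complex.I • y), hsym (Complex.I • x) (Complex.I • y)]
  module

theorem isAntilinear_comp {α : (Fin n → ℂ) [⋀^Fin r]→L[ℝ] ℂ} (hα : IsAntilinear α)
    (A : (Fin n → ℂ) →L[ℂ] (Fin n → ℂ)) :
    IsAntilinear (α.compContinuousLinearMap (A.restrictScalars ℝ)) := by
  intro v i c
  have : (fun j => A (Function.update v i (c • v i) j)) =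
      Function.update (fun j => A (v j)) i (c • A (v i)) := by
    ext1 j
    rcases eq_or_ne j i with rfl | h <;> simp [*]
  have h := hα (fun j => A (v j)) i c
  rw [← this] at h
  exact h

theorem dbar_smul_pullForm {ψ : Form n r} (hψ : ψ ∈ smoothForms n r)
    {G : (Fin n → ℂ) → (Fin n → ℂ)} {g : (Fin n → ℂ) → ℂ} {p : Fin n → ℂ}
    (hG : ContDiffAt ℂ 2 G p) (hg : DifferentiableAt ℂ g p) :
    dbar (fun q => g q • pullForm G ψ q) p = g p • pullForm G (dbar ψ) p := by
  have hd : Differentiable ℝ ψ := hψ.1.differentiable (by simp)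
  set L := ContinuousLinearMap.restrictScalarsL ℂ (Fin n → ℂ) (Fin n → ℂ) ℝ ℝ with hL
  have hGe : ∀ᶠ q in 𝓝 p, DifferentiableAt ℂ G q := by
    filter_upwards [hG.eventually (by simp)] with q hq using hq.differentiableAt (by simp)
  have hG1 : fderiv ℝ G =ᶠ[𝓝 p] fun q => L (fderiv ℂ G q) := by
    filter_upwards [hGe] with q hq using hq.fderiv_restrictScalars ℝ
  have hG2 : DifferentiableAt ℂ (fderiv ℂ G) p :=
    (hG.fderiv_right (m := 1) (by norm_num)).differentiableAt (by simp)
  set H : (Fin n → ℂ) →L[ℝ] (Fin n → ℂ) →L[ℝ] (Fin n → ℂ) :=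
    L.comp ((fderiv ℂ (fderiv ℂ G) p).restrictScalars ℝ) with hH
  have hG3 : HasFDerivAt (fderiv ℝ G) H p :=
    (L.hasFDerivAt.comp p (hG2.hasFDerivAt.restrictScalars ℝ)).congr_of_eventuallyEq hG1
  have hHI : ∀ u w, H (Complex.I • u) w = Complex.I • H u w := fun u w => by simp [hH, hL]
  have hsym : ∀ x y, H x y = H y x := fun x y => by
    have := (hG.restrict_scalars ℝ).isSymmSndFDerivAt (by simp)
    rw [IsSymmSndFDerivAt, hG3.fderiv] at this
    exact this x y
  have hGp : DifferentiableAt ℂ G p := hG.differentiableAt (by simp)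
  set A := fderiv ℂ G p with hA
  have hA' : fderiv ℝ G p = L A := hG1.self_of_nhds
  have hφ := (((hd (G p)).hasFDerivAt.comp p
    (hGp.hasFDerivAt.restrictScalars ℝ)).continuousAlternatingMapCompContinuousLinearMap hG3)
  have hprod := ((hg.hasFDerivAt.restrictScalars ℝ).smul hφ).fderiv
  have hfd : fderiv ℝ (fun q => g q • pullForm G ψ q) p = _ := hprod
  set D := fderiv ℝ ψ (G p) with hD
  have hanti : antilinearPart (fderiv ℝ (fun q => g q • pullForm G ψ q) p) =
      g p • ((compContinuousLinearMapCLM (L A)).comp ((antilinearPart D).comp (L A)) +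
        ((ψ (G p)).fderivCompContinuousLinearMap (L A)).comp H) := by
    rw [hfd]
    have hT : ∀ u, ((ψ (G p)).fderivCompContinuousLinearMap (L A)) (H (Complex.I • u)) =
        (-Complex.I) • ((ψ (G p)).fderivCompContinuousLinearMap (L A)) (H u) := by
      intro u
      ext v
      simp only [fderivCompContinuousLinearMap_apply, Finset.smul_sum,
        ContinuousAlternatingMap.smul_apply]
      refine Finset.sum_congr rfl fun i _ => ?_
      have e1 : ∀ w, (fun j => (Function.update (fun _ => L A) i (H w) : Fin r → _) j (v j)) =
          Function.update (fun j => A (v j)) i (H w (v i)) := by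
        intro w; ext1 j
        rcases eq_or_ne j i with rfl | h <;> simp [*]
      rw [e1, e1, hHI]
      have := hψ.2 (G p) (Function.update (fun j => A (v j)) i (H u (v i))) i Complex.I
      simpa using this
    ext1 u
    simp only [antilinearPart_apply, _root_.add_apply, _root_.smul_apply,
      ContinuousLinearMap.comp_apply, ContinuousLinearMap.smulRight_apply,
      ContinuousLinearMap.coe_restrictScalars', hA', map_smul, hT, Function.comp_apply]
    have hLA : (L A) u = (fderiv ℂ G p) u := rfl
    rw [hLA]
    ext v
    simp only [ContinuousAlternatingMap.add_apply, ContinuousAlternatingMap.smul_apply,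
      compContinuousLinearMapCLM_apply, compContinuousLinearMap_apply, smul_eq_mul]
    generalize ((ψ (G p)).fderivCompContinuousLinearMap (L A)) (H u) v = T
    generalize (ψ (G p)) (⇑(L A) ∘ v) = φ
    linear_combination (1 / 2 * (fderiv ℂ g p) u * φ - 1 / 2 * g p * T) * Complex.I_mul_I
  show alternatizeUncurryFin (antilinearPart (fderiv ℝ (fun q => g q • pullForm G ψ q) p)) = _
  rw [hanti, alternatizeUncurryFin_smul, alternatizeUncurryFin_add,
    alternatizeUncurryFin_fderivCompContinuousLinearMap_eq_zero _ _ hsym, add_zero]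
  congr 1
  ext v
  simp only [pullForm, dbar, hA', compContinuousLinearMap_apply, alternatizeUncurryFin_apply,
    ContinuousLinearMap.comp_apply]
  rfl

end lemmas

/-- Affine chart `l` of `ℂPⁿ`: the homogeneous coordinates `[t₀ : … : tₙ]`, normalized by
`t_l = 1`, of the point with affine coordinates `w = (t_j / t_l)_{j ≠ l}` (in increasing order). -/
def homogCoord {n : ℕ} (l : Fin (n + 1)) (w : Fin n → ℂ) : Fin (n + 1) → ℂ :=
  l.insertNth (α := fun _ => ℂ) 1 w

/-- The change of coordinates of `ℂPⁿ` from chart `l` to chart `m` (meaningful where `t_m ≠ 0`). -/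
def chartChange {n : ℕ} (l m : Fin (n + 1)) (w : Fin n → ℂ) : Fin n → ℂ := fun j =>
  homogCoord l w (m.succAbove j) / homogCoord l w m

/-- The space `DG^r(ℂPⁿ)(O(a), O(b)) = Γ(O(a), O(b)) ⊗ Ω^{0,r}(ℂPⁿ)`: smooth `(0, r)`-forms on
`ℂPⁿ` with values in `Hom(O(a), O(b)) = O(b - a)`. Such a form is given by its expressions `η l` in
the `n + 1` affine charts, with respect to the frames `t_l^a` and `t_l^b` of `O(a)` and `O(b)`; on
the overlap of charts `l` and `m` the frames of `O(b - a)` differ by `(t_m / t_l)^(b - a)`. -/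
def DG (n : ℕ) (a b : ℤ) (r : ℕ) : Submodule ℂ (Fin (n + 1) → Form n r) where
  carrier := {η | (∀ l, η l ∈ smoothForms n r) ∧ ∀ l m w, homogCoord l w m ≠ 0 →
    η l w = homogCoord l w m ^ (b - a) • pullForm (chartChange l m) (η m) w}
  zero_mem' := ⟨fun _ => Submodule.zero_mem _, fun l m w _ => by ext; simp [pullForm]⟩
  add_mem' := fun {η θ} hη hθ => ⟨fun l => Submodule.add_mem _ (hη.1 l) (hθ.1 l),
    fun l m w h => by
      ext
      simp [hη.2 l m w h, hθ.2 l m w h, pullForm, mul_add]⟩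
  smul_mem' := fun c η hη => ⟨fun l => Submodule.smul_mem _ c (hη.1 l),
    fun l m w h => by
      ext
      simp [hη.2 l m w h, pullForm, mul_left_comm]⟩

/-- The coordinates `w_j = exp z_j`, `z_j = x_j + i y_j`, of the complement `M̌` of the toric divisors
of `ℂPⁿ`. Objects on `M̌` are written in the logarithmic coordinates `z`. -/
def expMap {n : ℕ} (z : Fin n → ℂ) : Fin n → ℂ := fun j => Complex.exp (z j)

/-- The twist `Ψ_a = (1 + e^{2 x₁} + ⋯ + e^{2 xₙ})^{a/2}`. -/
def Psi {n : ℕ} (a : ℤ) (z : Fin n → ℂ) : ℝ :=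
  (1 + ∑ i, Real.exp (2 * (z i).re)) ^ ((a : ℝ) / 2)

/-- The functor `I` on morphisms: restrict `ψ̃` to `M̌` (using chart `0`) and send it to
`ψ = Ψ_b⁻¹ ∘ ψ̃ ∘ Ψ_a`. -/
def toTorus (n : ℕ) (a b : ℤ) (r : ℕ) : (Fin (n + 1) → Form n r) →ₗ[ℂ] Form n r where
  toFun η := fun z => (((Psi b z)⁻¹ * Psi a z : ℝ) : ℂ) • pullForm expMap (η 0) z
  map_add' η θ := by
    ext z v
    simp [pullForm, mul_add]
  map_smul' c η := by
    ext z v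
    simp [pullForm, mul_left_comm]

/-- `V'^r(O(a), O(b))`, the image of `DG^r(ℂPⁿ)(O(a), O(b))` under `I`. It is a subspace of the
space `V` of smooth `(0, r)`-forms on `M̌`, see `VPrime_le_V`. -/
def VPrime (n : ℕ) (a b : ℤ) (r : ℕ) : Submodule ℂ (Form n r) := (DG n a b r).map (toTorus n a b r)

/-- The dual coordinates `x^i = 2 e^{2 x_i} / (1 + e^{2 x₁} + ⋯ + e^{2 xₙ})` on `B`. -/
def dualCoord {n : ℕ} (x : Fin n → ℝ) : Fin n → ℝ := fun i =>
  2 * Real.exp (2 * x i) / (1 + ∑ j, Real.exp (2 * x j))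

/-- The section `s_a`, `y^i = (a / 2) x^i`, in the dual coordinates `x^i`; it is affine and is
extended by the same formula beyond the polytope. -/
def lagSection {n : ℕ} (a : ℤ) (x : Fin n → ℝ) : Fin n → ℝ := fun i => (a : ℝ) / 2 * x i

/-- The `(0, 1)`-form `∑ (s_a - s_b)^i dz̄_i` on `M̌`. -/
def sDiffForm {n : ℕ} (a b : ℤ) (z : Fin n → ℂ) : (Fin n → ℂ) →L[ℝ] ℂ :=
  ∑ i, (lagSection a (dualCoord fun j => (z j).re) i -
      lagSection b (dualCoord fun j => (z j).re) i) •
    (Complex.conjCLE : ℂ →L[ℝ] ℂ).comp (ContinuousLinearMap.proj i)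

/-- The differential `d_ab ψ = 2 ∂̄ψ - ∑ (s_a - s_b)^i dz̄_i ∧ ψ` of `V(O(a), O(b))`. -/
def dV {n r : ℕ} (a b : ℤ) (ψ : Form n r) : Form n (r + 1) := fun z =>
  (2 : ℂ) • dbar ψ z - alternatizeUncurryFin ((sDiffForm a b z).smulRight (ψ z))

section lemmas
variable {n r : ℕ}

theorem dbar_congr {ψ φ : Form n r} {p : Fin n → ℂ} (h : ψ =ᶠ[𝓝 p] φ) :
    dbar ψ p = dbar φ p := by
  simp only [dbar, h.fderiv_eq]

theorem homogCoord_differentiable (l m : Fin (n + 1)) :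
    ContDiff ℂ 2 fun w : Fin n → ℂ => homogCoord l w m := by
  rcases Fin.eq_self_or_eq_succAbove l m with rfl | ⟨k, rfl⟩
  · simpa [homogCoord] using contDiff_const
  · simpa [homogCoord] using contDiff_apply ℂ ℂ k

theorem dbar_mem_DG {a b : ℤ} {η : Fin (n + 1) → Form n r} (hη : η ∈ DG n a b r) :
    (fun l => dbar (η l)) ∈ DG n a b (r + 1) := by
  refine ⟨fun l => dbar_mem (hη.1 l), fun l m w hw => ?_⟩
  have hc : ∀ᶠ q in 𝓝 w, homogCoord l q m ≠ 0 :=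
    (homogCoord_differentiable l m).continuous.continuousAt.eventually_ne hw
  have he : η l =ᶠ[𝓝 w]
      fun q => homogCoord l q m ^ (b - a) • pullForm (chartChange l m) (η m) q := by
    filter_upwards [hc] with q hq using hη.2 l m q hq
  dsimp only
  rw [dbar_congr he]
  refine dbar_smul_pullForm (hη.1 m) ?_ ?_
  · refine contDiffAt_pi.2 fun j => ?_
    exact (homogCoord_differentiable l _).contDiffAt.div
      (homogCoord_differentiable l m).contDiffAt hw
  · exact (((homogCoord_differentiable l m).differentiable (by simp)) w).zpow (Or.inl hw)

theorem expMap_contDiff : ContDiff ℂ 2 (expMap : (Fin n → ℂ) → _) :=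
  contDiff_pi.2 fun j => (contDiff_apply ℂ ℂ j).cexp

theorem pullForm_differentiable {ψ : Form n r} (hψ : ψ ∈ smoothForms n r) :
    Differentiable ℝ (pullForm expMap ψ) := by
  intro p
  have hd : Differentiable ℝ ψ := hψ.1.differentiable (by simp)
  have hE : ContDiff ℝ 2 (expMap : (Fin n → ℂ) → _) := expMap_contDiff.restrict_scalars ℝ
  refine DifferentiableAt.continuousAlternatingMapCompContinuousLinearMap
    ((hd _).comp p (hE.differentiable (by simp) p)) ?_
  exact (hE.fderiv_right (m := 1) (by norm_num)).differentiable (by simp) p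

theorem hasFDerivAt_twist (a b : ℤ) (z : Fin n → ℂ) :
    HasFDerivAt (fun z : Fin n → ℂ => (((Psi b z)⁻¹ * Psi a z : ℝ) : ℂ))
      (Complex.ofRealCLM.comp (((Psi b z)⁻¹ * Psi a z) • ∑ i,
        (lagSection a (dualCoord fun j => (z j).re) i -
          lagSection b (dualCoord fun j => (z j).re) i) •
        Complex.reCLM.comp (ContinuousLinearMap.proj (R := ℝ) (φ := fun _ : Fin n => ℂ) i))) z := by
  have hpos : ∀ z : Fin n → ℂ, 0 < 1 + ∑ i, Real.exp (2 * (z i).re) := fun z => by positivity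
  have heq : ∀ z : Fin n → ℂ, (Psi b z)⁻¹ * Psi a z =
      (1 + ∑ i, Real.exp (2 * (z i).re)) ^ (((a : ℝ) - b) / 2) := fun z => by
    rw [Psi, Psi, ← Real.rpow_neg (hpos z).le, ← Real.rpow_add (hpos z)]
    congr 1; ring
  simp only [heq]
  refine Complex.ofRealCLM.hasFDerivAt.comp z ?_
  have h1 : HasFDerivAt (fun z : Fin n → ℂ => 1 + ∑ i, Real.exp (2 * (z i).re))
      (∑ i, Real.exp (2 * (z i).re) • (2 : ℝ) • Complex.reCLM.comp
        (ContinuousLinearMap.proj (R := ℝ) (φ := fun _ : Fin n => ℂ) i)) z := by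
    refine (HasFDerivAt.fun_sum fun i _ => ?_).const_add 1
    refine HasFDerivAt.exp ?_
    exact (Complex.reCLM.comp
        (ContinuousLinearMap.proj (R := ℝ) (φ := fun _ : Fin n => ℂ) i)).hasFDerivAt.const_mul 2
  refine (h1.rpow_const (p := ((a : ℝ) - b) / 2) (Or.inl (hpos z).ne')).congr_fderiv ?_
  rw [Finset.smul_sum, Finset.smul_sum]
  refine Finset.sum_congr rfl fun i _ => ?_
  simp only [smul_smul]
  congr 1
  rw [Real.rpow_sub (hpos z), Real.rpow_one]
  simp only [lagSection, dualCoord]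
  field_simp

theorem dV_toTorus {a b : ℤ} {η : Fin (n + 1) → Form n r} (hη : η ∈ DG n a b r) :
    dV a b (toTorus n a b r η) = toTorus n a b (r + 1) ((2 : ℂ) • fun l => dbar (η l)) := by
  ext1 z
  have h1 := hasFDerivAt_twist a b z
  have h2 := (pullForm_differentiable (hη.1 0) z).hasFDerivAt
  have h3 : fderiv ℝ (toTorus n a b r η) z = _ := (h1.smul h2).fderiv
  have h4 : dbar (pullForm expMap (η 0)) z = pullForm expMap (dbar (η 0)) z := by
    have := dbar_smul_pullForm (hη.1 0) (g := fun _ => 1) (expMap_contDiff.contDiffAt (x := z))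
      (differentiableAt_const _)
    simpa using this
  have h5 : antilinearPart (fderiv ℝ (toTorus n a b r η) z) =
      (((Psi b z)⁻¹ * Psi a z : ℝ) : ℂ) • antilinearPart (fderiv ℝ (pullForm expMap (η 0)) z) +
      (1 / 2 : ℂ) • (sDiffForm a b z).smulRight (toTorus n a b r η z) := by
    rw [h3]
    have key : ∀ (c : ℝ) (k : Fin n → ℝ) (u : Fin n → ℂ),
        ((c * ∑ i, k i * (u i).re : ℝ) : ℂ) +
          Complex.I * ((c * ∑ i, k i * (Complex.I * u i).re : ℝ) : ℂ) =
        c * ∑ i, (k i : ℂ) * (starRingEnd ℂ) (u i) := fun c k u => by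
      push_cast
      rw [mul_left_comm, ← mul_add, Finset.mul_sum, ← Finset.sum_add_distrib]
      congr 1
      refine Finset.sum_congr rfl fun i _ => ?_
      apply Complex.ext <;> simp
    ext u v
    have hk := key ((Psi b z)⁻¹ * Psi a z) (fun i =>
        (lagSection a (dualCoord fun j => (z j).re) i -
          lagSection b (dualCoord fun j => (z j).re) i)) u
    simp only [antilinearPart_apply, sDiffForm, toTorus, _root_.add_apply, _root_.smul_apply,
      ContinuousLinearMap.smulRight_apply, ContinuousLinearMap.comp_apply,
      ContinuousAlternatingMap.add_apply, ContinuousAlternatingMap.smul_apply, smul_eq_mul,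
      _root_.sum_apply, Complex.ofRealCLM_apply, Complex.reCLM_apply,
      ContinuousLinearMap.proj_apply, Pi.smul_apply, LinearMap.coe_mk, AddHom.coe_mk,
      Complex.real_smul]
    simp only [show ∀ w : ℂ, (Complex.conjCLE : ℂ →L[ℝ] ℂ) w = (starRingEnd ℂ) w from fun _ => rfl]
    linear_combination (1 / 2 * pullForm expMap (η 0) z v) * hk
  simp only [dV, dbar]
  rw [h5, alternatizeUncurryFin_add, alternatizeUncurryFin_smul, alternatizeUncurryFin_smul]
  have h6 : alternatizeUncurryFin (antilinearPart (fderiv ℝ (pullForm expMap (η 0)) z)) = _ := h4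
  rw [h6, smul_add, smul_smul (2 : ℂ) (1 / 2 : ℂ)]
  rw [show (2 : ℂ) * (1 / 2) = 1 by norm_num, one_smul, add_sub_cancel_right, map_smul]
  rfl

/-- Smooth `(0, r)`-forms on `M̌`, as forms in `z` that are `2πi`-periodic in every variable. This
is `V^r(O(a), O(b))` for all `a`, `b`, since the bundles are trivialized over `M̌`. -/
def V (n r : ℕ) : Submodule ℂ (Form n r) where
  carrier := {ψ | ψ ∈ smoothForms n r ∧
    ∀ z (k : Fin n → ℤ), ψ (fun j => z j + 2 * Real.pi * k j * Complex.I) = ψ z}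
  zero_mem' := ⟨Submodule.zero_mem _, fun _ _ => rfl⟩
  add_mem' := fun hψ hφ => ⟨Submodule.add_mem _ hψ.1 hφ.1, fun z k => by
    simp [hψ.2 z k, hφ.2 z k]⟩
  smul_mem' := fun c ψ hψ => ⟨Submodule.smul_mem _ c hψ.1, fun z k => by simp [hψ.2 z k]⟩

/-- continuous alternatization. -/
def altCLM (n r : ℕ) : ContinuousMultilinearMap ℝ (fun _ : Fin r => Fin n → ℂ) ℂ →L[ℝ]
    (Fin n → ℂ) [⋀^Fin r]→L[ℝ] ℂ :=
  liftCLM (∑ σ : Equiv.Perm (Fin r), (Equiv.Perm.sign σ : ℤ) •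
      ((ContinuousMultilinearMap.domDomCongrₗᵢ ℝ (Fin n → ℂ) ℂ σ).toContinuousLinearEquiv :
        ContinuousMultilinearMap ℝ (fun _ : Fin r => Fin n → ℂ) ℂ →L[ℝ]
          ContinuousMultilinearMap ℝ (fun _ : Fin r => Fin n → ℂ) ℂ)) (by
    intro f v i j hv hne
    have := (ContinuousMultilinearMap.alternatization f).map_eq_zero_of_eq v hv hne
    rw [ContinuousMultilinearMap.alternatization_apply_apply] at this
    rw [← this]
    simp only [_root_.sum_apply, _root_.smul_apply, Units.smul_def]
    rfl)

theorem contDiff_of_multilinear {f : Form n r}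
    (h : ContDiff ℝ ∞ fun x => (f x).toContinuousMultilinearMap) : ContDiff ℝ ∞ f := by
  have h1 : f = fun x => ((r.factorial : ℂ)⁻¹) • altCLM n r (f x).toContinuousMultilinearMap := by
    ext x v
    have : ∀ σ : Equiv.Perm (Fin r), f x (v ∘ σ) = Equiv.Perm.sign σ • f x v := fun σ =>
      (f x).toAlternatingMap.map_perm v σ
    have h2 : altCLM n r (f x).toContinuousMultilinearMap v =
        ∑ σ : Equiv.Perm (Fin r), (Equiv.Perm.sign σ : ℤ) • f x (v ∘ σ) := by
      simp only [altCLM, liftCLM_apply, _root_.sum_apply, _root_.smul_apply]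
      rfl
    have h3 : ∀ σ : Equiv.Perm (Fin r), (Equiv.Perm.sign σ : ℤ) • f x (v ∘ σ) = f x v :=
      fun σ => by
        rw [this, Units.smul_def, smul_smul, Int.units_coe_mul_self, one_smul]
    rw [ContinuousAlternatingMap.smul_apply, h2, Finset.sum_congr rfl fun σ _ => h3 σ]
    simp [Finset.card_univ, Fintype.card_perm, Nat.factorial_ne_zero]
  rw [h1]
  exact ContDiff.smul (contDiff_const : ContDiff ℝ ∞ fun _ : Fin n → ℂ => (r.factorial : ℂ)⁻¹)
    ((altCLM n r).contDiff.comp h)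

theorem contDiff_pullForm {ψ : Form n r} (hψ : ContDiff ℝ ∞ ψ) {G : (Fin n → ℂ) → (Fin n → ℂ)}
    (hG : ContDiff ℝ ∞ G) : ContDiff ℝ ∞ (pullForm G ψ) := by
  apply contDiff_of_multilinear
  have h1 : ContDiff ℝ ∞ (fderiv ℝ G) := hG.fderiv_right (by simp)
  have h2 : ContDiff ℝ ∞ fun m : Fin r → ((Fin n → ℂ) →L[ℝ] (Fin n → ℂ)) =>
      ContinuousMultilinearMap.compContinuousLinearMapContinuousMultilinear ℝ
      (fun _ : Fin r => Fin n → ℂ) (fun _ => Fin n → ℂ) ℂ m :=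
    ContinuousMultilinearMap.contDiff _
  have h3 : ContDiff ℝ ∞ fun α : (Fin n → ℂ) [⋀^Fin r]→L[ℝ] ℂ => α.toContinuousMultilinearMap :=
    (toContinuousMultilinearMapLI (𝕜 := ℝ) (E := Fin n → ℂ) (F := ℂ) (ι := Fin r)).contDiff
  exact (h2.comp (contDiff_pi.2 fun _ => h1)).clm_apply (h3.comp (hψ.comp hG))

theorem VPrime_le_V (a b : ℤ) : VPrime n a b r ≤ V n r := by
  rintro _ ⟨η, hη, rfl⟩
  have hE : ContDiff ℂ ∞ (expMap : (Fin n → ℂ) → _) :=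
    contDiff_pi.2 fun j => (contDiff_apply ℂ ℂ j).cexp
  have hper : ∀ z (k : Fin n → ℤ), expMap (fun j => z j + 2 * Real.pi * k j * Complex.I) = expMap z := by
    intro z k
    ext j
    simp only [expMap]
    rw [show z j + 2 * Real.pi * k j * Complex.I = z j + k j * (2 * Real.pi * Complex.I) by ring]
    exact Complex.exp_periodic.int_mul (k j) (z j)
  refine ⟨⟨?_, fun z => ?_⟩, fun z k => ?_⟩
  · have h1 : ContDiff ℝ ∞ fun z : Fin n → ℂ => (((Psi b z)⁻¹ * Psi a z : ℝ) : ℂ) := by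
      have hpos : ∀ z : Fin n → ℂ, 0 < 1 + ∑ i, Real.exp (2 * (z i).re) := fun z => by positivity
      have hS : ContDiff ℝ ∞ fun z : Fin n → ℂ => 1 + ∑ i, Real.exp (2 * (z i).re) := by
        refine contDiff_const.add (ContDiff.sum fun i _ => ?_)
        exact (contDiff_const.mul (Complex.reCLM.contDiff.comp (contDiff_apply ℝ ℂ i))).exp
      have hP : ∀ c : ℤ, ContDiff ℝ ∞ fun z : Fin n → ℂ => Psi c z := fun c =>
        contDiff_iff_contDiffAt.2 fun z => hS.contDiffAt.rpow_const_of_ne (hpos z).ne'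
      exact Complex.ofRealCLM.contDiff.comp
        (((hP b).inv fun z => (Real.rpow_pos_of_pos (hpos z) _).ne').mul (hP a))
    exact h1.smul (contDiff_pullForm (hη.1 0).1 (hE.restrict_scalars ℝ))
  · refine IsAntilinear.smul ?_ _
    have : fderiv ℝ expMap z = (fderiv ℂ expMap z).restrictScalars ℝ :=
      (hE.differentiable (by simp) z).fderiv_restrictScalars ℝ
    rw [pullForm, this]
    exact isAntilinear_comp ((hη.1 0).2 _) _
  · have h2 : fderiv ℝ (expMap : (Fin n → ℂ) → _)
        (fun j => z j + 2 * Real.pi * k j * Complex.I) = fderiv ℝ expMap z := by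
      have := fderiv_comp_add_right (𝕜 := ℝ) (f := (expMap : (Fin n → ℂ) → _)) (x := z)
        (fun j => 2 * Real.pi * k j * Complex.I)
      rw [show (fun j => z j + 2 * Real.pi * k j * Complex.I) =
        z + (fun j => 2 * Real.pi * k j * Complex.I) from rfl, ← this]
      congr 1
      ext1 y
      exact hper y k
    have h3 : ∀ c : ℤ, Psi c (fun j => z j + 2 * Real.pi * k j * Complex.I) = Psi c z := by
      intro c; simp [Psi]
    show (((Psi b _)⁻¹ * Psi a _ : ℝ) : ℂ) • pullForm expMap (η 0) _ =
      (((Psi b z)⁻¹ * Psi a z : ℝ) : ℂ) • pullForm expMap (η 0) z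
    rw [h3, h3, pullForm, pullForm, h2, hper]

theorem dV_mem {a b : ℤ} {ψ : Form n r} (hψ : ψ ∈ VPrime n a b r) :
    dV a b ψ ∈ VPrime n a b (r + 1) := by
  obtain ⟨η, hη, rfl⟩ := hψ
  rw [dV_toTorus hη]
  exact Submodule.mem_map_of_mem (Submodule.smul_mem _ 2 (dbar_mem_DG hη))

theorem dV_dV {a b : ℤ} {ψ : Form n r} (hψ : ψ ∈ VPrime n a b r) : dV a b (dV a b ψ) = 0 := by
  obtain ⟨η, hη, rfl⟩ := hψ
  have h := Submodule.smul_mem _ (2 : ℂ) (dbar_mem_DG hη)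
  rw [dV_toTorus hη, dV_toTorus h]
  have h0 : (fun l => dbar (((2 : ℂ) • fun l => dbar (η l)) l)) = (0 : Fin (n + 1) → Form n (r + 1 + 1)) := by
    ext1 l
    have hd : Differentiable ℝ (dbar (η l)) := (dbar_mem (hη.1 l)).1.differentiable (by simp)
    ext1 p
    have h1 : antilinearPart (fderiv ℝ ((2 : ℂ) • dbar (η l)) p) =
        (2 : ℂ) • antilinearPart (fderiv ℝ (dbar (η l)) p) := by
      rw [fderiv_const_smul (hd p)]
      ext1 u
      simp only [antilinearPart_apply, _root_.smul_apply]
      module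
    show alternatizeUncurryFin (antilinearPart (fderiv ℝ ((2 : ℂ) • dbar (η l)) p)) = 0
    rw [h1, alternatizeUncurryFin_smul]
    have h2 : alternatizeUncurryFin (antilinearPart (fderiv ℝ (dbar (η l)) p)) = 0 :=
      congrFun (dbar_dbar (hη.1 l).1) p
    rw [h2, smul_zero]
  have h3 : (2 : ℂ) • (0 : Fin (n + 1) → Form n (r + 1 + 1)) = 0 := by
    ext l z v
    simp
  rw [h0]
  exact (congrArg (toTorus n a b (r + 1 + 1)) h3).trans (_root_.map_zero _)

theorem dV_add (a b : ℤ) {ψ φ : Form n r} (hψ : Differentiable ℝ ψ) (hφ : Differentiable ℝ φ) :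
    dV a b (ψ + φ) = dV a b ψ + dV a b φ := by
  ext1 z
  have h1 : antilinearPart (fderiv ℝ (ψ + φ) z) =
      antilinearPart (fderiv ℝ ψ z) + antilinearPart (fderiv ℝ φ z) := by
    rw [fderiv_add (hψ z) (hφ z)]
    ext1 u
    simp only [antilinearPart_apply, _root_.add_apply]
    module
  have h2 : (sDiffForm a b z).smulRight ((ψ + φ) z) =
      (sDiffForm a b z).smulRight (ψ z) + (sDiffForm a b z).smulRight (φ z) := by
    ext1 u
    simp
  show (2 : ℂ) • alternatizeUncurryFin (antilinearPart (fderiv ℝ (ψ + φ) z)) -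
    alternatizeUncurryFin ((sDiffForm a b z).smulRight ((ψ + φ) z)) = dV a b ψ z + dV a b φ z
  rw [h1, h2, alternatizeUncurryFin_add, alternatizeUncurryFin_add]
  simp only [dV, dbar]
  module

theorem dV_smul (a b : ℤ) (c : ℂ) {ψ : Form n r} (hψ : Differentiable ℝ ψ) :
    dV a b (c • ψ) = c • dV a b ψ := by
  ext1 z
  have h1 : antilinearPart (fderiv ℝ (c • ψ) z) = c • antilinearPart (fderiv ℝ ψ z) := by
    rw [fderiv_const_smul (hψ z)]
    ext1 u
    simp only [antilinearPart_apply, _root_.smul_apply]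
    module
  have h2 : (sDiffForm a b z).smulRight ((c • ψ) z) = c • (sDiffForm a b z).smulRight (ψ z) := by
    ext1 u
    simp [smul_comm c]
  show (2 : ℂ) • alternatizeUncurryFin (antilinearPart (fderiv ℝ (c • ψ) z)) -
    alternatizeUncurryFin ((sDiffForm a b z).smulRight ((c • ψ) z)) = c • dV a b ψ z
  rw [h1, h2, alternatizeUncurryFin_smul, alternatizeUncurryFin_smul]
  simp only [dV, dbar]
  module

theorem VPrime_differentiable {a b : ℤ} {ψ : Form n r} (hψ : ψ ∈ VPrime n a b r) :
    Differentiable ℝ ψ := (VPrime_le_V a b hψ).1.1.differentiable (by simp)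

end lemmas

/-- The differential `d_ab` on `V'`. -/
def dVPrime (n : ℕ) (a b : ℤ) (r : ℕ) : VPrime n a b r →ₗ[ℂ] VPrime n a b (r + 1) where
  toFun ψ := ⟨dV a b ψ.1, dV_mem ψ.2⟩
  map_add' ψ φ := Subtype.ext (dV_add a b (VPrime_differentiable ψ.2) (VPrime_differentiable φ.2))
  map_smul' c ψ := Subtype.ext (dV_smul a b c (VPrime_differentiable ψ.2))

/-- The cochain complex `V'(O(a), O(b))`. -/
def VPrimeComplex (n : ℕ) (a b : ℤ) : CochainComplex (ModuleCat.{0} ℂ) ℕ :=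
  CochainComplex.of (fun r => ModuleCat.of ℂ (VPrime n a b r))
    (fun r => ModuleCat.ofHom (dVPrime n a b r))
    (fun r => by
      apply ModuleCat.hom_ext
      ext1 ψ
      exact Subtype.ext (dV_dV ψ.2))

/-- The polytope `P`, the closure of `B`, in the dual coordinates `x^i`. -/
def polytope (n : ℕ) : Set (Fin n → ℝ) := {x | (∀ i, 0 ≤ x i) ∧ ∑ i, x i ≤ 2}

/-- The Lagrangian section `L_a` over `P`, as a subset of the trivial torus bundle over `P`; the
fibre coordinates `y^i` are taken modulo the period lattice `ℤⁿ`. -/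
def lagrangian (n : ℕ) (a : ℤ) : Set ((Fin n → ℝ) × (Fin n → UnitAddCircle)) :=
  {p | p.1 ∈ polytope n ∧ ∀ i, p.2 i = (lagSection a p.1 i : UnitAddCircle)}

/-- `π(L_a ∩ L_b) ⊆ P`. -/
def intersectionLocus (n : ℕ) (a b : ℤ) : Set (Fin n → ℝ) :=
  Prod.fst '' (lagrangian n a ∩ lagrangian n b)

/-- The projection to `P` of `graph(s_a) ∩ graph(s_{b;I})`, where `s_{b;I} = s_b - I`. -/
def labelLocus (n : ℕ) (a b : ℤ) (I : Fin n → ℤ) : Set (Fin n → ℝ) :=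
  Prod.fst '' ({p : (Fin n → ℝ) × (Fin n → ℝ) | p.1 ∈ polytope n ∧ p.2 = lagSection a p.1} ∩
    {p | p.1 ∈ polytope n ∧ p.2 = fun j => lagSection b p.1 j - I j})

/-- The gradient of `f_{ab;I} = f_a - f_b + ∑ I_j x_j` (the difference of the potentials of the lifts
`s_a` and `s_{b;I}`, so `d f_{ab;I} = ∑ (s_a - s_b + I)^j dx_j`). For the Hessian metric one has
`grad f = ∑ (∂f/∂x_j) ∂/∂x^j`, so in the coordinates `x^j` the gradient is `s_a - s_b + I`; being affine
it extends to a neighbourhood of `P` (here: to all of `ℝⁿ`). -/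
def gradField {n : ℕ} (a b : ℤ) (I : Fin n → ℤ) (x : Fin n → ℝ) : Fin n → ℝ :=
  fun j => lagSection a x j - lagSection b x j + I j

/-- The stable manifold of `v` for the vector field `-grad f_{ab;I}`. -/
def stableManifold {n : ℕ} (a b : ℤ) (I : Fin n → ℤ) (v : Fin n → ℝ) : Set (Fin n → ℝ) :=
  {p | ∃ γ : ℝ → Fin n → ℝ, γ 0 = p ∧
    (∀ t, 0 ≤ t → HasDerivWithinAt γ (-gradField a b I (γ t)) (Set.Ici 0) t) ∧
    Filter.Tendsto γ Filter.atTop (𝓝 v)}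

/-- `W` is a generator of degree `r` and label `I` of `Mo(P)(L_a, L_b)`: a connected component of
`π(L_a ∩ L_b)`, coming from `graph(s_a) ∩ graph(s_{b;I})`, such that some `v ∈ W` is an interior
point of `S_v ∩ P` in the stable manifold `S_v`; its degree is the dimension of `S_v`. -/
structure IsMoGenerator {n : ℕ} (a b : ℤ) (I : Fin n → ℤ) (r : ℕ) (W : Set (Fin n → ℝ)) :
    Prop where
  component : ∃ x ∈ intersectionLocus n a b, W = connectedComponentIn (intersectionLocus n a b) x
  label : W ⊆ labelLocus n a b I
  interior : ∃ v ∈ W, stableManifold a b I v ∩ polytope n ∈ 𝓝[stableManifold a b I v] v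
  degree : ∀ v ∈ W, dimH (stableManifold a b I v) = r

/-- The basis of the degree `r` part of `Mo(P)(L_a, L_b)`. -/
def MoGen (n : ℕ) (a b : ℤ) (r : ℕ) : Type :=
  {W : Set (Fin n → ℝ) // ∃ I : Fin n → ℤ, IsMoGenerator a b I r W}

/-- The space `Mo(P)(L_a, L_b)` of morphisms, spanned over `ℂ` by the generators; it carries the zero
differential. -/
def MoComplex (n : ℕ) (a b : ℤ) : CochainComplex (ModuleCat.{0} ℂ) ℕ :=
  CochainComplex.of (fun r => ModuleCat.of ℂ (MoGen n a b r →₀ ℂ)) (fun _ => 0)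
    (fun _ => by simp)

/-- A generator as an element of `Mo(P)(L_a, L_b)`. -/
def moBasis {n : ℕ} {a b : ℤ} {r : ℕ} (W : MoGen n a b r) : (MoComplex n a b).X r :=
  (Finsupp.single W 1 : MoGen n a b r →₀ ℂ)

/-- The differential form on `M̌` underlying an element of `V'`. -/
def underlyingForm {n : ℕ} {a b : ℤ} {r : ℕ} (ψ : (VPrimeComplex n a b).X r) : Form n r :=
  (show VPrime n a b r from ψ).1

/-- The section `e_{ab;I}` before normalization, in the coordinates `x = (x^i)` of `P` and
`y = (y_i)` of the fibre of `M̌`. -/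
def monomialSection {n : ℕ} (a b : ℤ) (I : Fin n → ℕ) (x y : Fin n → ℝ) : ℂ :=
  (√((2 - ∑ j, x j) / 2) : ℂ) ^ ((b - a).toNat - ∑ j, I j) *
    ∏ j, ((√(x j / 2) : ℂ) * Complex.exp (Complex.I * y j)) ^ I j

/-- The constant `c_{ab;I}`, chosen so that the maximum over `P` of the absolute value is `1` (which
does not depend on `y`). -/
def normConst {n : ℕ} (a b : ℤ) (I : Fin n → ℕ) : ℝ :=
  (sSup ((fun x => ‖monomialSection a b I x 0‖) '' polytope n))⁻¹

/-- The normalized section `e_{ab;I}`. -/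
def basisSection {n : ℕ} (a b : ℤ) (I : Fin n → ℕ) (x y : Fin n → ℝ) : ℂ :=
  normConst a b I * monomialSection a b I x y

/-- The section `e_{ab;I}` as a `0`-form on `M̌`. -/
def basisForm {n : ℕ} (a b : ℤ) (I : Fin n → ℕ) : Form n 0 := fun z =>
  constOfIsEmpty ℝ _ (Fin 0)
    (basisSection a b I (dualCoord fun j => (z j).re) fun j => (z j).im)

/-- The point `v_{ab;I} = (2 i₁ / (b - a), …, 2 iₙ / (b - a))`. -/
def vertex {n : ℕ} (a b : ℤ) (I : Fin n → ℕ) : Fin n → ℝ := fun j => 2 * I j / ((b : ℝ) - a)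

end
end CPnMirror

open CPnMirror

namespace CPnMirror

noncomputable section

open scoped ContDiff Topology ENNReal
open ContinuousAlternatingMap

/-! Both complexes have computable cohomology, concentrated in degree 0, and the comparison matches
explicit bases.

Morse side. The difference of the two sections is affine with slope (b - a)/2 > 0. Lifts with a
given label therefore meet in at most one point, and the intersection locus is finite. The field
-grad is (b - a)/2 times the Euler field centred at the intersection point. It expands, so the
stable manifold is that single point (`stableManifold_eq`); hence every intersection point, even on
the boundary of the polytope, is a generator of degree 0 (`isMoGenerator_iff`).

Complex side. By `dV_toTorus`, restriction to the torus with the twist carries 2∂̄ to d_ab, and it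
is injective because the torus is dense (`toTorus_injOn`). What remains is the Dolbeault cohomology
of O(d), d = b - a > 0, on projective space. Undoing the twist turns e_I into a positive multiple of
the monomial w^I (`basisForm_eq_torusValue`), and its absolute value is maximal at the asserted
point by Gibbs' inequality (`prod_pow_lt_of_ne`).

Degree 0. A closed section is an entire function in one chart. Homogeneity bounds its growth by
order d, so Cauchy's estimate makes it a polynomial of degree at most d (`mem_polySpan_of_growth`).

Positive degree (`exists_primitive_DG`). A closed form of degree r + 1 lifts to a homogeneous closed
form f on ℂⁿ⁺¹ ∖ 0 with a singularity of order r + 1 - d at the origin (`homogForm_bound`). Since d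
≥ 1, this is weak enough for f to remain closed across the origin in the weak sense, so a
mollification of f is smooth and closed on the whole space, hence exact on polydiscs
(`dolbeault_polydisc`). Away from the origin the mollification differs from a multiple of f by an
exact form, so f has a primitive on an annulus around the unit sphere
(`exists_primitive_of_singular`). Averaging over the circle makes the primitive equivariant. Its
horizontal part on the sphere, extended homogeneously (`basicForm`), descends to a primitive on
projective space (`dbar_pullback_basicForm`).

One identity serves both the Dolbeault lemma and the mollification: for a rotation-invariant measure
on translations, averaging minus multiplication by the total mass is ∂̄T + T∂̄ with an explicit
operator T (`dbar_translHomotopy`). -/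

/-! ### Intersection points, labels and stable manifolds -/

theorem mem_labelLocus {n : ℕ} {a b : ℤ} {I : Fin n → ℤ} {x : Fin n → ℝ} :
    x ∈ labelLocus n a b I ↔
      x ∈ polytope n ∧ ∀ j, (a : ℝ) / 2 * x j = (b : ℝ) / 2 * x j - I j := by
  constructor
  · rintro ⟨p, ⟨⟨h1, h2⟩, -, h3⟩, rfl⟩
    exact ⟨h1, fun j => congrFun (h2.symm.trans h3) j⟩
  · rintro ⟨h1, h2⟩
    exact ⟨(x, lagSection a x), ⟨⟨h1, rfl⟩, h1, funext h2⟩, rfl⟩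

theorem labelLocus_subset_singleton {n : ℕ} {a b : ℤ} (hab : a < b) (I : Fin n → ℤ)
    {x : Fin n → ℝ} (hx : x ∈ labelLocus n a b I) : x = fun j => 2 * (I j : ℝ) / ((b : ℝ) - a) := by
  have hd : (0 : ℝ) < b - a := sub_pos.2 (by exact_mod_cast hab)
  obtain ⟨-, h⟩ := mem_labelLocus.1 hx
  ext j
  rw [eq_div_iff hd.ne']
  linarith [h j]

theorem vertex_mem_polytope {n : ℕ} {a b : ℤ} (hab : a < b) {I : Fin n → ℕ}
    (hI : ∑ j, (I j : ℤ) ≤ b - a) : vertex a b I ∈ polytope n := by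
  have hd : (0 : ℝ) < b - a := sub_pos.2 (by exact_mod_cast hab)
  refine ⟨fun i => by simp only [vertex]; positivity, ?_⟩
  simp only [vertex]
  rw [← Finset.sum_div, ← Finset.mul_sum, div_le_iff₀ hd]
  have : ((∑ j, (I j : ℤ) : ℤ) : ℝ) ≤ ((b - a : ℤ) : ℝ) := by exact_mod_cast hI
  push_cast at this
  linarith

theorem labelLocus_eq {n : ℕ} {a b : ℤ} (hab : a < b) {I : Fin n → ℕ}
    (hI : ∑ j, (I j : ℤ) ≤ b - a) :
    labelLocus n a b (fun j => (I j : ℤ)) = {vertex a b I} := by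
  have hd : (0 : ℝ) < b - a := sub_pos.2 (by exact_mod_cast hab)
  refine Set.Subset.antisymm (fun x hx => ?_) ?_
  · rw [Set.mem_singleton_iff, labelLocus_subset_singleton hab _ hx]
    ext j
    simp [vertex]
  · rintro _ rfl
    refine mem_labelLocus.2 ⟨vertex_mem_polytope hab hI, fun j => ?_⟩
    simp only [vertex]
    field_simp
    push_cast
    ring

/-- At the point 2J/(b - a) the inequalities that cut out the polytope become J ≥ 0 and |J| ≤ b - a,
so only the multi-indices of the sections occur as labels. -/
theorem exists_nat_of_mem_labelLocus {n : ℕ} {a b : ℤ} (hab : a < b) {J : Fin n → ℤ}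
    {x : Fin n → ℝ} (hx : x ∈ labelLocus n a b J) :
    ∃ I : Fin n → ℕ, ∑ j, (I j : ℤ) ≤ b - a ∧ J = (fun j => (I j : ℤ)) := by
  have hd : (0 : ℝ) < b - a := sub_pos.2 (by exact_mod_cast hab)
  obtain ⟨⟨h0, hs⟩, -⟩ := mem_labelLocus.1 hx
  have he := labelLocus_subset_singleton hab J hx
  have hJ : ∀ j, 0 ≤ J j := fun j => by
    have h := h0 j
    rw [he] at h
    by_contra hneg
    push Not at hneg
    have : (J j : ℝ) < 0 := by exact_mod_cast hneg
    have : 2 * (J j : ℝ) / (b - a) < 0 := div_neg_of_neg_of_pos (by linarith) hd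
    linarith
  refine ⟨fun j => (J j).toNat, ?_, funext fun j => (Int.toNat_of_nonneg (hJ j)).symm⟩
  simp only [Int.toNat_of_nonneg (hJ _)]
  rw [he, ← Finset.sum_div, ← Finset.mul_sum, div_le_iff₀ hd] at hs
  have : ((∑ j, J j : ℤ) : ℝ) ≤ ((b - a : ℤ) : ℝ) := by push_cast; linarith
  exact_mod_cast this

/-- Equality of the fibre coordinates modulo ℤ means that s_b - s_a is an integer vector, and this
vector is the label. -/
theorem mem_intersectionLocus {n : ℕ} {a b : ℤ} {x : Fin n → ℝ} :
    x ∈ intersectionLocus n a b ↔ ∃ J, x ∈ labelLocus n a b J := by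
  constructor
  · rintro ⟨p, ⟨⟨h1, h2⟩, -, h3⟩, rfl⟩
    have : ∀ j, ∃ k : ℤ, (k : ℝ) = (b : ℝ) / 2 * p.1 j - (a : ℝ) / 2 * p.1 j := fun j => by
      have h := (h2 j).symm.trans (h3 j)
      rw [eq_comm, ← sub_eq_zero, ← AddCircle.coe_sub, AddCircle.coe_eq_zero_iff] at h
      obtain ⟨k, hk⟩ := h
      exact ⟨k, by simpa [lagSection] using hk⟩
    choose J hJ using this
    exact ⟨J, mem_labelLocus.2 ⟨h1, fun j => by rw [hJ]; ring⟩⟩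
  · rintro ⟨J, hJ⟩
    obtain ⟨h1, h2⟩ := mem_labelLocus.1 hJ
    refine ⟨(x, fun j => (lagSection a x j : UnitAddCircle)), ⟨⟨h1, fun _ => rfl⟩, h1, fun j => ?_⟩, rfl⟩
    simp only [lagSection, h2 j]
    rw [AddCircle.coe_sub]
    have : ((J j : ℝ) : UnitAddCircle) = 0 := (AddCircle.coe_eq_zero_iff 1).2 ⟨J j, by simp⟩
    rw [this, sub_zero]

theorem intersectionLocus_eq_range {n : ℕ} {a b : ℤ} (hab : a < b) :
    intersectionLocus n a b =
      vertex a b '' {I : Fin n → ℕ | ∑ j, (I j : ℤ) ≤ b - a} := by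
  ext x
  rw [mem_intersectionLocus]
  constructor
  · rintro ⟨J, hJ⟩
    obtain ⟨I, hI, rfl⟩ := exists_nat_of_mem_labelLocus hab hJ
    rw [labelLocus_eq hab hI] at hJ
    exact ⟨I, hI, hJ.symm⟩
  · rintro ⟨I, hI, rfl⟩
    exact ⟨_, (labelLocus_eq hab hI).ge rfl⟩

theorem vertex_injective {n : ℕ} {a b : ℤ} (hab : a < b) :
    Function.Injective (vertex a b : (Fin n → ℕ) → Fin n → ℝ) := by
  have hd : (0 : ℝ) < b - a := sub_pos.2 (by exact_mod_cast hab)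
  intro I J h
  ext j
  have := congrFun h j
  simp only [vertex] at this
  field_simp at this
  exact_mod_cast this

theorem finite_degree_le {n : ℕ} (c : ℤ) : {I : Fin n → ℕ | ∑ j, (I j : ℤ) ≤ c}.Finite := by
  refine (Set.finite_Iic (fun _ : Fin n => c.toNat)).subset fun I hI j => ?_
  have h1 : (I j : ℤ) ≤ ∑ j, (I j : ℤ) :=
    Finset.single_le_sum (f := fun j => (I j : ℤ)) (fun _ _ => by positivity) (Finset.mem_univ j)
  have : (I j : ℤ) ≤ c := h1.trans hI
  simp only
  omega

/-- The locus is finite, hence totally disconnected. -/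
theorem connectedComponentIn_intersectionLocus {n : ℕ} {a b : ℤ} (hab : a < b)
    {x : Fin n → ℝ} (hx : x ∈ intersectionLocus n a b) :
    connectedComponentIn (intersectionLocus n a b) x = {x} := by
  have hfin : (intersectionLocus n a b).Finite := by
    rw [intersectionLocus_eq_range hab]
    exact (finite_degree_le _).image _
  refine Set.Subset.antisymm ?_ (Set.singleton_subset_iff.2 (mem_connectedComponentIn hx))
  intro y hy
  exact hfin.countable.isTotallyDisconnected _ (connectedComponentIn_subset _ _)
    isPreconnected_connectedComponentIn hy (mem_connectedComponentIn hx)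

/-- Along -grad the displacement from the vertex grows like exp((b - a)t/2), so the only trajectory
that converges to the vertex is the constant one. -/
theorem stableManifold_eq {n : ℕ} {a b : ℤ} (hab : a < b) (I : Fin n → ℕ) :
    stableManifold a b (fun j => (I j : ℤ)) (vertex a b I) = {vertex a b I} := by
  have hd : (0 : ℝ) < b - a := sub_pos.2 (by exact_mod_cast hab)
  have hgrad : ∀ x : Fin n → ℝ, ∀ j, gradField a b (fun j => (I j : ℤ)) x j =
      -((b - a) / 2 * (x j - vertex a b I j)) := by
    intro x j
    simp only [gradField, lagSection, vertex]
    push_cast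
    field_simp
    ring
  refine Set.Subset.antisymm ?_ ?_
  · rintro p ⟨γ, rfl, hγ, hlim⟩
    rw [Set.mem_singleton_iff]
    ext j
    set k : ℝ := (b - a) / 2 with hk
    have hkpos : 0 < k := by positivity
    -- Undoing the exponential growth gives a constant of motion. It tends to 0 along a convergent
    -- trajectory, so it vanishes at time 0.
    set h : ℝ → ℝ := fun t => Real.exp (-k * t) * (γ t j - vertex a b I j) with hh
    have hderiv : ∀ t, 0 ≤ t → HasDerivWithinAt h 0 (Set.Ici 0) t := by
      intro t ht
      have h1 := (hasDerivWithinAt_pi.1 (hγ t ht)) j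
      have h2 : HasDerivWithinAt (fun t => Real.exp (-k * t)) (Real.exp (-k * t) * (-k))
          (Set.Ici 0) t := by
        have := ((hasDerivAt_id t).const_mul (-k)).exp
        simpa using this.hasDerivWithinAt
      have h3 := h2.mul (h1.sub_const (vertex a b I j))
      refine h3.congr_deriv ?_
      simp only [Pi.neg_apply, hgrad]
      ring
    have hconst : ∀ t, 0 ≤ t → h t = h 0 := by
      intro t ht
      refine constant_of_has_deriv_right_zero (f := h) (a := 0) (b := t) (fun s hs => ?_) (fun s hs => ?_)
        t ⟨ht, le_rfl⟩
      · exact ((hderiv s hs.1).mono Set.Icc_subset_Ici_self).continuousWithinAt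
      · exact (hderiv s hs.1).mono (Set.Ici_subset_Ici.2 hs.1)
    have hlim0 : Filter.Tendsto h Filter.atTop (𝓝 (0 * (vertex a b I j - vertex a b I j))) := by
      refine Filter.Tendsto.mul ?_ (((tendsto_pi_nhds.1 hlim) j).sub_const _)
      have : Filter.Tendsto (fun t : ℝ => k * t) Filter.atTop Filter.atTop :=
        Filter.tendsto_id.const_mul_atTop hkpos
      have h4 := Real.tendsto_exp_neg_atTop_nhds_zero.comp this
      refine h4.congr fun t => ?_
      simp
    have hlim1 : Filter.Tendsto h Filter.atTop (𝓝 (h 0)) :=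
      tendsto_const_nhds.congr' ((Filter.eventually_ge_atTop 0).mono fun t ht => (hconst t ht).symm)
    have := tendsto_nhds_unique hlim1 hlim0
    simp only [hh] at this
    simp at this
    linarith
  · rintro _ rfl
    refine ⟨fun _ => vertex a b I, rfl, fun t _ => ?_, tendsto_const_nhds⟩
    have : -gradField a b (fun j => (I j : ℤ)) (vertex a b I) = 0 := by
      ext j
      rw [Pi.neg_apply, hgrad]
      simp
    rw [this]
    exact hasDerivWithinAt_const _ _ _

/-- The stable manifold is a single point of the polytope, so the interior condition is automatic
and the dimension is 0; only the label has to be identified. -/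
theorem isMoGenerator_iff {n : ℕ} {a b : ℤ} (hab : a < b) (J : Fin n → ℤ) (r : ℕ)
    (W : Set (Fin n → ℝ)) : IsMoGenerator a b J r W ↔
      r = 0 ∧ ∃ I : Fin n → ℕ, ∑ j, (I j : ℤ) ≤ b - a ∧ J = (fun j => (I j : ℤ)) ∧
        W = {vertex a b I} := by
  constructor
  · rintro ⟨⟨x, hx, rfl⟩, hlab, -, hdeg⟩
    rw [connectedComponentIn_intersectionLocus hab hx] at hlab hdeg ⊢
    have hxJ := hlab rfl
    obtain ⟨I, hI, rfl⟩ := exists_nat_of_mem_labelLocus hab hxJ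
    have hxv : x = vertex a b I := by
      have := hxJ
      rw [labelLocus_eq hab hI] at this
      exact this
    subst hxv
    refine ⟨?_, I, hI, rfl, rfl⟩
    have := hdeg _ rfl
    rw [stableManifold_eq hab, dimH_singleton] at this
    exact_mod_cast this.symm
  · rintro ⟨rfl, I, hI, rfl, rfl⟩
    have hv : vertex a b I ∈ intersectionLocus n a b := by
      rw [intersectionLocus_eq_range hab]
      exact ⟨I, hI, rfl⟩
    refine ⟨⟨_, hv, (connectedComponentIn_intersectionLocus hab hv).symm⟩,
      (labelLocus_eq hab hI).ge, ⟨_, rfl, ?_⟩, ?_⟩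
    · rw [stableManifold_eq hab, Set.inter_eq_self_of_subset_left
        (Set.singleton_subset_iff.2 (vertex_mem_polytope hab hI))]
      exact self_mem_nhdsWithin
    · rintro _ rfl
      rw [stableManifold_eq hab, dimH_singleton, Nat.cast_zero]

/-! ### Gibbs' inequality and the maximum of the normalized sections -/

/-- Gibbs' inequality: a monomial on the standard simplex has a strict maximum at the point
proportional to its exponents. -/
theorem prod_pow_lt_of_ne {ι : Type*} [Fintype ι] {k : ι → ℕ} {D : ℝ} (hD : 0 < D)
    (hk : ∑ j, (k j : ℝ) = D) {p : ι → ℝ} (hp : ∀ j, 0 ≤ p j) (hp1 : ∑ j, p j = 1)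
    (hne : p ≠ fun j => (k j : ℝ) / D) :
    ∏ j, p j ^ k j < ∏ j, ((k j : ℝ) / D) ^ k j := by
  have hqpos : ∀ j, 0 < ((k j : ℝ) / D) ^ k j := fun j => by
    rcases Nat.eq_zero_or_pos (k j) with h | h
    · simp [h]
    · have : (0 : ℝ) < k j := by exact_mod_cast h
      positivity
  have hQ : 0 < ∏ j, ((k j : ℝ) / D) ^ k j := Finset.prod_pos fun j _ => hqpos j
  -- If a factor on the left vanishes, the left side is 0, while the right side stays positive: a
  -- zero exponent contributes 0 ^ 0 = 1.
  by_cases h0 : ∃ j, p j ^ k j = 0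
  · obtain ⟨j, hj⟩ := h0
    rwa [Finset.prod_eq_zero (Finset.mem_univ j) hj]
  push Not at h0
  have hppos : ∀ j, 0 < p j ^ k j := fun j => lt_of_le_of_ne (pow_nonneg (hp j) _) (h0 j).symm
  -- This is x ≤ exp(x - 1) at x = D p_j / k_j, raised to the power k_j. The exponents D p_j - k_j
  -- sum to D - D = 0, so the exponentials cancel in the product.
  have hle : ∀ j, p j ^ k j ≤ ((k j : ℝ) / D) ^ k j * Real.exp (D * p j - k j) := fun j => by
    rcases Nat.eq_zero_or_pos (k j) with h | h
    · simp only [h, pow_zero, one_mul, Nat.cast_zero, sub_zero]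
      exact Real.one_le_exp (mul_nonneg hD.le (hp j))
    · have hkj : (0 : ℝ) < k j := by exact_mod_cast h
      have h1 : D * p j - k j = k j * (D * p j / k j - 1) := by field_simp
      rw [h1, Real.exp_nat_mul, ← mul_pow]
      refine pow_le_pow_left₀ (hp j) ?_ _
      have := Real.add_one_le_exp (D * p j / k j - 1)
      calc p j = (k j : ℝ) / D * (D * p j / k j - 1 + 1) := by field_simp; ring
        _ ≤ _ := by gcongr
  -- Some coordinate misses its optimal value, and there x < exp(x - 1) strictly; if its exponent is
  -- 0, the strict bound is 1 < exp(D p_j).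
  have hlt : ∃ j, p j ^ k j < ((k j : ℝ) / D) ^ k j * Real.exp (D * p j - k j) := by
    obtain ⟨j, hj⟩ : ∃ j, p j ≠ (k j : ℝ) / D := by
      by_contra hcon
      push Not at hcon
      exact hne (funext hcon)
    refine ⟨j, ?_⟩
    rcases Nat.eq_zero_or_pos (k j) with h | h
    · simp only [h, pow_zero, one_mul, Nat.cast_zero, sub_zero]
      rw [h] at hj
      have : 0 < p j := lt_of_le_of_ne (hp j) (by simpa using hj.symm)
      exact Real.one_lt_exp_iff.2 (by positivity)
    · have hkj : (0 : ℝ) < k j := by exact_mod_cast h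
      have h1 : D * p j - k j = k j * (D * p j / k j - 1) := by field_simp
      rw [h1, Real.exp_nat_mul, ← mul_pow]
      refine pow_lt_pow_left₀ ?_ (hp j) h.ne'
      have hne1 : D * p j / k j - 1 ≠ 0 := by
        intro h2
        apply hj
        field_simp at h2 ⊢
        linarith
      have := Real.add_one_lt_exp hne1
      calc p j = (k j : ℝ) / D * (D * p j / k j - 1 + 1) := by field_simp; ring
        _ < _ := by gcongr
  obtain ⟨j, hj⟩ := hlt
  have h2 := Finset.prod_lt_prod (fun i _ => hppos i) (fun i _ => hle i) ⟨j, Finset.mem_univ j, hj⟩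
  rw [Finset.prod_mul_distrib, ← Real.exp_sum, Finset.sum_sub_distrib, ← Finset.mul_sum, hp1, hk] at h2
  simpa using h2

theorem norm_monomialSection {n : ℕ} (a b : ℤ) (I : Fin n → ℕ) {x : Fin n → ℝ}
    (hx : x ∈ polytope n) (y : Fin n → ℝ) :
    ‖monomialSection a b I x y‖ =
      √(((2 - ∑ j, x j) / 2) ^ ((b - a).toNat - ∑ j, I j) * ∏ j, (x j / 2) ^ I j) := by
  have h0 : 0 ≤ (2 - ∑ j, x j) / 2 := by linarith [hx.2]
  have hs : √(((2 - ∑ j, x j) / 2) ^ ((b - a).toNat - ∑ j, I j)) =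
      √((2 - ∑ j, x j) / 2) ^ ((b - a).toNat - ∑ j, I j) := by
    rw [← Real.sqrt_sq (pow_nonneg (Real.sqrt_nonneg ((2 - ∑ j, x j) / 2)) _), ← pow_mul, mul_comm,
      pow_mul, Real.sq_sqrt h0]
  rw [Real.sqrt_mul (pow_nonneg h0 _), hs]
  have h1 : √(∏ j, (x j / 2) ^ I j) = ∏ j, √(x j / 2) ^ I j := by
    rw [← Real.sqrt_sq (Finset.prod_nonneg fun j _ => pow_nonneg (Real.sqrt_nonneg (x j / 2)) (I j)),
      ← Finset.prod_pow]
    congr 1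
    refine Finset.prod_congr rfl fun j _ => ?_
    rw [← pow_mul, mul_comm, pow_mul, Real.sq_sqrt (by linarith [hx.1 j])]
  rw [h1, monomialSection, norm_mul, norm_pow, norm_prod]
  congr 1
  · rw [Complex.norm_real, Real.norm_of_nonneg (Real.sqrt_nonneg _)]
  · refine Finset.prod_congr rfl fun j _ => ?_
    rw [norm_pow, norm_mul, Complex.norm_real, Real.norm_of_nonneg (Real.sqrt_nonneg _),
      mul_comm Complex.I, Complex.norm_exp_ofReal_mul_I, mul_one]

/-- The squared absolute value is a monomial of degree b - a in the barycentric coordinates (2 - ∑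
x_j)/2 and x_j/2, which sum to 1. Gibbs' inequality puts its strict maximum at the point
proportional to the exponents. -/
theorem norm_monomialSection_lt {n : ℕ} {a b : ℤ} (hab : a < b) {I : Fin n → ℕ}
    (hI : ∑ j, (I j : ℤ) ≤ b - a) {x : Fin n → ℝ} (hx : x ∈ polytope n) (hne : x ≠ vertex a b I)
    (y y' : Fin n → ℝ) :
    ‖monomialSection a b I x y‖ < ‖monomialSection a b I (vertex a b I) y'‖ := by
  have hd : (0 : ℝ) < b - a := sub_pos.2 (by exact_mod_cast hab)
  rw [norm_monomialSection a b I hx, norm_monomialSection a b I (vertex_mem_polytope hab hI)]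
  have hI' : ∑ j, I j ≤ (b - a).toNat := by
    zify
    rw [Int.toNat_of_nonneg (by omega)]
    exact hI
  set k : Fin (n + 1) → ℕ := Fin.cons ((b - a).toNat - ∑ j, I j) I with hk
  set p : Fin (n + 1) → ℝ := Fin.cons ((2 - ∑ j, x j) / 2) (fun j => x j / 2) with hp
  have hcast : (((b - a).toNat : ℕ) : ℝ) = b - a := by
    have : (((b - a).toNat : ℤ) : ℝ) = ((b - a : ℤ) : ℝ) := by
      rw [Int.toNat_of_nonneg (by omega)]
    push_cast at this
    exact this
  have hk1 : ∑ j, (k j : ℝ) = (b : ℝ) - a := by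
    rw [Fin.sum_univ_succ]
    simp only [hk, Fin.cons_zero, Fin.cons_succ]
    rw [Nat.cast_sub hI', hcast]
    push_cast
    ring
  have key := prod_pow_lt_of_ne hd hk1 (p := p) (fun j => ?_) ?_ ?_
  · rw [Fin.prod_univ_succ, Fin.prod_univ_succ] at key
    simp only [hk, hp, Fin.cons_zero, Fin.cons_succ] at key
    refine Real.sqrt_lt_sqrt ?_ (key.trans_eq ?_)
    · refine mul_nonneg (pow_nonneg (by linarith [hx.2]) _)
        (Finset.prod_nonneg fun j _ => pow_nonneg (by linarith [hx.1 j]) _)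
    · congr 2
      · rw [Nat.cast_sub hI', hcast]
        simp only [vertex]
        rw [← Finset.sum_div, ← Finset.mul_sum]
        push_cast
        field_simp
      · ext j
        simp only [vertex]
        congr 1
        field_simp
  · refine Fin.cases ?_ (fun i => ?_) j
    · simp only [hp, Fin.cons_zero]
      linarith [hx.2]
    · simp only [hp, Fin.cons_succ]
      linarith [hx.1 i]
  · rw [Fin.sum_univ_succ]
    simp only [hp, Fin.cons_zero, Fin.cons_succ]
    rw [← Finset.sum_div]
    ring
  · intro h
    apply hne
    ext j
    have := congrFun h j.succ
    simp only [hp, hk, Fin.cons_succ] at this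
    simp only [vertex]
    linarith [show (2 * (I j : ℝ) / (b - a)) = 2 * (I j / (b - a)) by ring]

theorem norm_monomialSection_vertex_pos {n : ℕ} {a b : ℤ} (hab : a < b) {I : Fin n → ℕ}
    (hI : ∑ j, (I j : ℤ) ≤ b - a) (y : Fin n → ℝ) :
    0 < ‖monomialSection a b I (vertex a b I) y‖ := by
  have hd : (0 : ℝ) < b - a := sub_pos.2 (by exact_mod_cast hab)
  have hI' : ∑ j, I j ≤ (b - a).toNat := by
    zify
    rw [Int.toNat_of_nonneg (by omega)]
    exact hI
  have hcast : (((b - a).toNat : ℕ) : ℝ) = b - a := by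
    have : (((b - a).toNat : ℤ) : ℝ) = ((b - a : ℤ) : ℝ) := by
      rw [Int.toNat_of_nonneg (by omega)]
    push_cast at this
    exact this
  rw [norm_monomialSection a b I (vertex_mem_polytope hab hI)]
  refine Real.sqrt_pos.2 (mul_pos ?_ (Finset.prod_pos fun j _ => ?_))
  · have : (2 - ∑ j, vertex a b I j) / 2 = (((b - a).toNat - ∑ j, I j : ℕ) : ℝ) / (b - a) := by
      rw [Nat.cast_sub hI', hcast]
      simp only [vertex]
      rw [← Finset.sum_div, ← Finset.mul_sum]
      push_cast
      field_simp
    rw [this]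
    rcases Nat.eq_zero_or_pos ((b - a).toNat - ∑ j, I j) with h | h
    · simp [h]
    · have : (0 : ℝ) < (((b - a).toNat - ∑ j, I j : ℕ) : ℝ) := by exact_mod_cast h
      positivity
  · simp only [vertex]
    rcases Nat.eq_zero_or_pos (I j) with h | h
    · simp [h]
    · have : (0 : ℝ) < I j := by exact_mod_cast h
      positivity

/-- The supremum is attained at the vertex, and the absolute value does not depend on the angles. -/
theorem normConst_eq {n : ℕ} {a b : ℤ} (hab : a < b) {I : Fin n → ℕ}
    (hI : ∑ j, (I j : ℤ) ≤ b - a) (y : Fin n → ℝ) :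
    normConst a b I = ‖monomialSection a b I (vertex a b I) y‖⁻¹ := by
  have h0 : ‖monomialSection a b I (vertex a b I) y‖ =
      ‖monomialSection a b I (vertex a b I) 0‖ := by
    rw [norm_monomialSection a b I (vertex_mem_polytope hab hI),
      norm_monomialSection a b I (vertex_mem_polytope hab hI)]
  rw [normConst, h0]
  congr 1
  refine IsGreatest.csSup_eq ⟨⟨_, vertex_mem_polytope hab hI, rfl⟩, ?_⟩
  rintro _ ⟨x, hx, rfl⟩
  by_cases h : x = vertex a b I
  · simp [h]
  · exact (norm_monomialSection_lt hab hI hx h 0 0).le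

theorem normConst_pos {n : ℕ} {a b : ℤ} (hab : a < b) {I : Fin n → ℕ}
    (hI : ∑ j, (I j : ℤ) ≤ b - a) : 0 < normConst a b I := by
  rw [normConst_eq hab hI 0]
  exact inv_pos.2 (norm_monomialSection_vertex_pos hab hI 0)

theorem basisSection_max {n : ℕ} {a b : ℤ} (hab : a < b) {I : Fin n → ℕ}
    (hI : ∑ j, (I j : ℤ) ≤ b - a) (y : Fin n → ℝ) :
    IsGreatest ((fun x => ‖basisSection a b I x y‖) '' polytope n) 1 ∧
      {x ∈ polytope n | ‖basisSection a b I x y‖ = 1} = {vertex a b I} := by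
  have hpos := norm_monomialSection_vertex_pos hab hI y
  have hn : ∀ x, ‖basisSection a b I x y‖ = ‖monomialSection a b I (vertex a b I) y‖⁻¹ *
      ‖monomialSection a b I x y‖ := fun x => by
    rw [basisSection, norm_mul, Complex.norm_real, Real.norm_of_nonneg (normConst_pos hab hI).le,
      normConst_eq hab hI y]
  have hv : ‖basisSection a b I (vertex a b I) y‖ = 1 := by
    rw [hn, inv_mul_cancel₀ hpos.ne']
  have hlt : ∀ x ∈ polytope n, x ≠ vertex a b I → ‖basisSection a b I x y‖ < 1 := by
    intro x hx hne
    rw [hn, inv_mul_lt_one₀ hpos]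
    exact norm_monomialSection_lt hab hI hx hne y y
  refine ⟨⟨⟨_, vertex_mem_polytope hab hI, hv⟩, ?_⟩, ?_⟩
  · rintro _ ⟨x, hx, rfl⟩
    by_cases h : x = vertex a b I
    · simp only [h, hv, le_refl]
    · exact (hlt x hx h).le
  · ext x
    constructor
    · rintro ⟨hx, h1⟩
      by_contra h
      exact (hlt x hx h).ne h1
    · rintro rfl
      exact ⟨vertex_mem_polytope hab hI, hv⟩

/-! ### Holomorphic pullback commutes with the Dolbeault operator -/

/-- The pullback of a differential form along a map between spaces of possibly different
dimensions. -/
def pullback {n m r : ℕ} (G : (Fin n → ℂ) → (Fin m → ℂ)) (ψ : Form m r) : Form n r := fun p =>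
  (ψ (G p)).compContinuousLinearMap (fderiv ℝ G p)

/-- The derivative of `G` is complex linear, so it respects conjugate-linear parts; its second
derivative is symmetric and dies under alternation; a holomorphic factor is invisible to ∂̄.
Regularity and type of ψ are required at one point only, so that forms singular at the origin are
admitted. -/
theorem dbar_smul_pullback {n m r : ℕ} {ψ : Form m r}
    {G : (Fin n → ℂ) → (Fin m → ℂ)} {g : (Fin n → ℂ) → ℂ} {p : Fin n → ℂ}
    (hd : DifferentiableAt ℝ ψ (G p)) (hanti : IsAntilinear (ψ (G p)))
    (hG : ContDiffAt ℂ 2 G p) (hg : DifferentiableAt ℂ g p) :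
    dbar (fun q => g q • pullback G ψ q) p = g p • pullback G (dbar ψ) p := by
  set L := ContinuousLinearMap.restrictScalarsL ℂ (Fin n → ℂ) (Fin m → ℂ) ℝ ℝ with hL
  have hGe : ∀ᶠ q in 𝓝 p, DifferentiableAt ℂ G q := by
    filter_upwards [hG.eventually (by simp)] with q hq using hq.differentiableAt (by simp)
  have hG1 : fderiv ℝ G =ᶠ[𝓝 p] fun q => L (fderiv ℂ G q) := by
    filter_upwards [hGe] with q hq using hq.fderiv_restrictScalars ℝ
  have hG2 : DifferentiableAt ℂ (fderiv ℂ G) p :=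
    (hG.fderiv_right (m := 1) (by norm_num)).differentiableAt (by simp)
  set H : (Fin n → ℂ) →L[ℝ] (Fin n → ℂ) →L[ℝ] (Fin m → ℂ) :=
    L.comp ((fderiv ℂ (fderiv ℂ G) p).restrictScalars ℝ) with hH
  have hG3 : HasFDerivAt (fderiv ℝ G) H p :=
    (L.hasFDerivAt.comp p (hG2.hasFDerivAt.restrictScalars ℝ)).congr_of_eventuallyEq hG1
  have hHI : ∀ u w, H (Complex.I • u) w = Complex.I • H u w := fun u w => by simp [hH, hL]
  have hsym : ∀ x y, H x y = H y x := fun x y => by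
    have := (hG.restrict_scalars ℝ).isSymmSndFDerivAt (by simp)
    rw [IsSymmSndFDerivAt, hG3.fderiv] at this
    exact this x y
  have hGp : DifferentiableAt ℂ G p := hG.differentiableAt (by simp)
  set A := fderiv ℂ G p with hA
  have hA' : fderiv ℝ G p = L A := hG1.self_of_nhds
  have hφ := ((hd.hasFDerivAt.comp p
    (hGp.hasFDerivAt.restrictScalars ℝ)).continuousAlternatingMapCompContinuousLinearMap hG3)
  have hprod := ((hg.hasFDerivAt.restrictScalars ℝ).smul hφ).fderiv
  have hfd : fderiv ℝ (fun q => g q • pullback G ψ q) p = _ := hprod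
  set D := fderiv ℝ ψ (G p) with hD
  have hanti : antilinearPart (fderiv ℝ (fun q => g q • pullback G ψ q) p) =
      g p • ((compContinuousLinearMapCLM (L A)).comp ((antilinearPart D).comp (L A)) +
        ((ψ (G p)).fderivCompContinuousLinearMap (L A)).comp H) := by
    rw [hfd]
    -- The term with the second derivative of `G` is already conjugate-linear in `u`, so it survives
    -- in the conjugate-linear part; the symmetry of `H` removes it later.
    have hT : ∀ u, ((ψ (G p)).fderivCompContinuousLinearMap (L A)) (H (Complex.I • u)) =
        (-Complex.I) • ((ψ (G p)).fderivCompContinuousLinearMap (L A)) (H u) := by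
      intro u
      ext v
      simp only [fderivCompContinuousLinearMap_apply, Finset.smul_sum,
        ContinuousAlternatingMap.smul_apply]
      refine Finset.sum_congr rfl fun i _ => ?_
      have e1 : ∀ w, (fun j => (Function.update (fun _ => L A) i (H w) : Fin r → _) j (v j)) =
          Function.update (fun j => A (v j)) i (H w (v i)) := by
        intro w; ext1 j
        rcases eq_or_ne j i with rfl | h <;> simp [*]
      rw [e1, e1, hHI]
      have := hanti (Function.update (fun j => A (v j)) i (H u (v i))) i Complex.I
      simpa using this
    ext1 u
    simp only [antilinearPart_apply, _root_.add_apply, _root_.smul_apply,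
      ContinuousLinearMap.comp_apply, ContinuousLinearMap.smulRight_apply,
      ContinuousLinearMap.coe_restrictScalars', hA', map_smul, hT, Function.comp_apply]
    have hLA : (L A) u = (fderiv ℂ G p) u := rfl
    rw [hLA]
    ext v
    simp only [ContinuousAlternatingMap.add_apply, ContinuousAlternatingMap.smul_apply,
      compContinuousLinearMapCLM_apply, compContinuousLinearMap_apply, smul_eq_mul]
    generalize ((ψ (G p)).fderivCompContinuousLinearMap (L A)) (H u) v = T
    generalize (ψ (G p)) (⇑(L A) ∘ v) = φ
    linear_combination (1 / 2 * (fderiv ℂ g p) u * φ - 1 / 2 * g p * T) * Complex.I_mul_I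
  show alternatizeUncurryFin (antilinearPart (fderiv ℝ (fun q => g q • pullback G ψ q) p)) = _
  rw [hanti, alternatizeUncurryFin_smul, alternatizeUncurryFin_add,
    alternatizeUncurryFin_fderivCompContinuousLinearMap_eq_zero _ _ hsym, add_zero]
  congr 1
  ext v
  simp only [pullback, dbar, hA', compContinuousLinearMap_apply, alternatizeUncurryFin_apply,
    ContinuousLinearMap.comp_apply]
  rfl

/-! ### Leibniz rule, exterior product with a one-form, and contraction -/

section tools
variable {n r : ℕ}

/-- The Dolbeault operator as a continuous linear function of the derivative. -/
def dbarL (n r : ℕ) : ((Fin n → ℂ) →L[ℝ] (Fin n → ℂ) [⋀^Fin r]→L[ℝ] ℂ) →L[ℝ]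
    (Fin n → ℂ) [⋀^Fin (r + 1)]→L[ℝ] ℂ :=
  (alternatizeUncurryFinCLM ℝ _ _).comp (antilinearPartL n _)

theorem dbar_eq_dbarL (ψ : Form n r) (p : Fin n → ℂ) : dbar ψ p = dbarL n r (fderiv ℝ ψ p) := by
  simp [dbarL, antilinearPartL_apply, dbar]

theorem dbar_add {ψ φ : Form n r} {p : Fin n → ℂ} (hψ : DifferentiableAt ℝ ψ p)
    (hφ : DifferentiableAt ℝ φ p) : dbar (ψ + φ) p = dbar ψ p + dbar φ p := by
  simp only [dbar_eq_dbarL, fderiv_add hψ hφ, map_add]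

theorem dbar_neg (ψ : Form n r) (p : Fin n → ℂ) : dbar (-ψ) p = -dbar ψ p := by
  simp only [dbar_eq_dbarL, fderiv_neg]
  rw [← neg_one_smul ℝ (fderiv ℝ ψ p), map_smul]
  ext v
  rw [ContinuousAlternatingMap.smul_apply, ContinuousAlternatingMap.neg_apply, neg_one_smul]

theorem dbar_sub {ψ φ : Form n r} {p : Fin n → ℂ} (hψ : DifferentiableAt ℝ ψ p)
    (hφ : DifferentiableAt ℝ φ p) : dbar (ψ - φ) p = dbar ψ p - dbar φ p := by
  rw [sub_eq_add_neg, dbar_add hψ hφ.neg, dbar_neg, sub_eq_add_neg]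

theorem dbar_const_smul {ψ : Form n r} {p : Fin n → ℂ} (hψ : DifferentiableAt ℝ ψ p) (c : ℂ) :
    dbar (c • ψ) p = c • dbar ψ p := by
  have h1 : antilinearPart (fderiv ℝ (c • ψ) p) = c • antilinearPart (fderiv ℝ ψ p) := by
    rw [fderiv_const_smul hψ]
    ext1 u
    simp only [antilinearPart_apply, _root_.smul_apply]
    module
  simp only [dbar, h1, alternatizeUncurryFin_smul]

/-- The exterior product of a `1`-form with an alternating form. -/
def wedgeOne (θ : (Fin n → ℂ) →L[ℝ] ℂ) (α : (Fin n → ℂ) [⋀^Fin r]→L[ℝ] ℂ) :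
    (Fin n → ℂ) [⋀^Fin (r + 1)]→L[ℝ] ℂ :=
  alternatizeUncurryFin (θ.smulRight α)

theorem dbar_fun_smul {f : (Fin n → ℂ) → ℂ} {ψ : Form n r} {p : Fin n → ℂ}
    (hf : DifferentiableAt ℝ f p) (hψ : DifferentiableAt ℝ ψ p) :
    dbar (fun z => f z • ψ z) p =
      wedgeOne (antilinearPart (fderiv ℝ f p)) (ψ p) + f p • dbar ψ p := by
  have h1 : antilinearPart (fderiv ℝ (fun z => f z • ψ z) p) =
      (antilinearPart (fderiv ℝ f p)).smulRight (ψ p) + f p • antilinearPart (fderiv ℝ ψ p) := by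
    have := (hf.hasFDerivAt.smul hψ.hasFDerivAt).fderiv
    rw [show (fun z => f z • ψ z) = f • ψ from rfl, this]
    ext1 u
    simp only [antilinearPart_apply, _root_.add_apply, _root_.smul_apply,
      ContinuousLinearMap.smulRight_apply]
    module
  rw [wedgeOne, dbar, dbar, h1, alternatizeUncurryFin_add, alternatizeUncurryFin_smul]

/-- In the alternating sum, the term that feeds `u` to `A` comes first; contraction commutes with
the others up to a shift of the index by one, whence the sign. This is the algebraic core of
Cartan's formula. -/
theorem curryLeft_alternatizeUncurryFin
    (A : (Fin n → ℂ) →L[ℝ] (Fin n → ℂ) [⋀^Fin (r + 1)]→L[ℝ] ℂ)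
    (B : (Fin n → ℂ) →L[ℝ] (Fin n → ℂ) [⋀^Fin r]→L[ℝ] ℂ) (u : Fin n → ℂ)
    (hB : ∀ v, B v = (A v).curryLeft u) :
    (alternatizeUncurryFin A).curryLeft u = A u - alternatizeUncurryFin B := by
  ext v
  simp only [curryLeft_apply_apply, alternatizeUncurryFin_apply, ContinuousAlternatingMap.sub_apply]
  rw [Fin.sum_univ_succ, sub_eq_add_neg, ← Finset.sum_neg_distrib]
  congr 1
  · simp
  · refine Finset.sum_congr rfl fun i _ => ?_
    rw [hB, curryLeft_apply_apply]
    have : i.succ.removeNth (Matrix.vecCons u v) = Matrix.vecCons u (i.removeNth v) := by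
      ext1 j
      refine Fin.cases ?_ (fun k => ?_) j
      · simp [Fin.removeNth]
      · simp [Fin.removeNth, Fin.succ_succAbove_succ]
    rw [this]
    simp [pow_succ]

theorem curryLeft_wedgeOne (θ : (Fin n → ℂ) →L[ℝ] ℂ) (α : (Fin n → ℂ) [⋀^Fin (r + 1)]→L[ℝ] ℂ)
    (u : Fin n → ℂ) :
    (wedgeOne θ α).curryLeft u = θ u • α - wedgeOne θ (α.curryLeft u) := by
  rw [wedgeOne, curryLeft_alternatizeUncurryFin _ (θ.smulRight (α.curryLeft u)) u]
  · rfl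
  · intro v
    ext w
    simp

/-- Contraction with a fixed vector as a continuous linear map. -/
def contract (n r : ℕ) (u : Fin n → ℂ) : ((Fin n → ℂ) [⋀^Fin (r + 1)]→L[ℝ] ℂ) →L[ℝ]
    (Fin n → ℂ) [⋀^Fin r]→L[ℝ] ℂ :=
  (ContinuousLinearMap.apply ℝ _ u).comp
    (curryLeftLI (𝕜 := ℝ) (E := Fin n → ℂ) (F := ℂ) (n := r)).toContinuousLinearMap

theorem contract_apply (u : Fin n → ℂ) (α : (Fin n → ℂ) [⋀^Fin (r + 1)]→L[ℝ] ℂ) :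
    contract n r u α = α.curryLeft u := rfl

theorem IsAntilinear.curryLeft {α : (Fin n → ℂ) [⋀^Fin (r + 1)]→L[ℝ] ℂ} (hα : IsAntilinear α)
    (u : Fin n → ℂ) : IsAntilinear (α.curryLeft u) := by
  intro v i c
  simp only [curryLeft_apply_apply]
  have := hα (Matrix.vecCons u v) i.succ c
  simp only [Matrix.cons_val_succ] at this
  rw [← this]
  congr 1
  ext1 j
  refine Fin.cases ?_ (fun k => ?_) j
  · simp [Function.update, (Fin.succ_ne_zero i).symm]
  · rcases eq_or_ne k i with rfl | h
    · simp
    · simp [Function.update_of_ne, h]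

theorem IsAntilinear.curryLeft_smul {α : (Fin n → ℂ) [⋀^Fin (r + 1)]→L[ℝ] ℂ} (hα : IsAntilinear α)
    (c : ℂ) (u : Fin n → ℂ) : α.curryLeft (c • u) = (starRingEnd ℂ) c • α.curryLeft u := by
  ext v
  have := hα (Matrix.vecCons u v) 0 c
  simp only [Matrix.cons_val_zero] at this
  simp only [curryLeft_apply_apply, ContinuousAlternatingMap.smul_apply, smul_eq_mul]
  rw [← this]
  congr 1
  ext1 j
  refine Fin.cases ?_ (fun k => ?_) j <;> simp

end tools

/-! ### Differentiation under integrals with compact support -/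

section integrals
open MeasureTheory

variable {E Y F : Type} [NormedAddCommGroup E] [NormedSpace ℝ E] [ProperSpace E]
  [NormedAddCommGroup Y] [NormedSpace ℝ Y] [SecondCountableTopology Y] [MeasurableSpace Y]
  [BorelSpace Y] [NormedAddCommGroup F] [NormedSpace ℝ F]

theorem ae_mem_of_measure_compl {Y : Type} [MeasurableSpace Y] {ν : Measure Y} {K : Set Y} (hν : ν Kᶜ = 0) : ∀ᵐ y ∂ν, y ∈ K := by
  rw [ae_iff]; exact hν

theorem integrable_of_continuous_compact {ν : Measure Y} [IsFiniteMeasure ν] {K : Set Y}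
    (hK : IsCompact K) (hν : ν Kᶜ = 0) {f : Y → F} (hf : Continuous f) : Integrable f ν := by
  obtain ⟨C, hC⟩ := hK.exists_bound_of_continuousOn hf.continuousOn
  refine Integrable.of_bound hf.aestronglyMeasurable C ?_
  filter_upwards [ae_mem_of_measure_compl hν] with y hy using hC y hy

theorem fderiv_partial {f : E → Y → F} (hf : ContDiff ℝ ∞ (fun q : E × Y => f q.1 q.2)) (x : E)
    (y : Y) : HasFDerivAt (fun x => f x y) ((fderiv ℝ (fun q : E × Y => f q.1 q.2) (x, y)).comp
      (ContinuousLinearMap.inl ℝ E Y)) x := by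
  have h1 := (hf.differentiable (by simp) (x, y)).hasFDerivAt
  exact HasFDerivAt.comp x (f := fun x => (x, y)) h1 (hasFDerivAt_prodMk_left x y)

theorem contDiff_partial {f : E → Y → F} (hf : ContDiff ℝ ∞ (fun q : E × Y => f q.1 q.2)) :
    ContDiff ℝ ∞ (fun q : E × Y => fderiv ℝ (fun x => f x q.2) q.1) := by
  have : (fun q : E × Y => fderiv ℝ (fun x => f x q.2) q.1) = fun q : E × Y =>
      (fderiv ℝ (fun q : E × Y => f q.1 q.2) q).comp (ContinuousLinearMap.inl ℝ E Y) := by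
    ext1 q
    exact (fderiv_partial hf q.1 q.2).fderiv
  rw [this]
  have h1 : ContDiff ℝ ∞ (fderiv ℝ (fun q : E × Y => f q.1 q.2)) := hf.fderiv_right (by simp)
  exact h1.clm_comp contDiff_const

/-- The partial derivative is bounded on the product of a closed ball with `K`, so a constant serves
as the dominating function. -/
theorem hasFDerivAt_integral_of_compact {ν : Measure Y} [IsFiniteMeasure ν] {K : Set Y}
    (hK : IsCompact K) (hν : ν Kᶜ = 0) {f : E → Y → F}
    (hf : ContDiff ℝ ∞ (fun q : E × Y => f q.1 q.2)) (x : E) :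
    HasFDerivAt (fun x => ∫ y, f x y ∂ν) (∫ y, fderiv ℝ (fun x => f x y) x ∂ν) x := by
  have hd := contDiff_partial hf
  obtain ⟨C, hC⟩ := ((isCompact_closedBall x 1).prod hK).exists_bound_of_continuousOn
    hd.continuous.continuousOn
  refine hasFDerivAt_integral_of_dominated_of_fderiv_le (bound := fun _ => C)
    (F' := fun x y => fderiv ℝ (fun x => f x y) x)
    (Metric.closedBall_mem_nhds x one_pos)
    (Filter.Eventually.of_forall fun x' =>
      (hf.continuous.comp (Continuous.prodMk_right x')).aestronglyMeasurable)
    (integrable_of_continuous_compact hK hν (hf.continuous.comp (Continuous.prodMk_right x)))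
    ((hd.continuous.comp (Continuous.prodMk_right x)).aestronglyMeasurable) ?_
    (integrable_const C) ?_
  · filter_upwards [ae_mem_of_measure_compl hν] with y hy x' hx' using hC (x', y) ⟨hx', hy⟩
  · exact Filter.Eventually.of_forall fun y x' _ =>
      (fderiv_partial hf x' y).differentiableAt.hasFDerivAt

/-- Induction on the order of differentiability. The target `F` must vary, because the derivative is
an integral of the same kind with values in linear maps. -/
theorem contDiff_integral_of_compact {ν : Measure Y} [IsFiniteMeasure ν] {K : Set Y}
    (hK : IsCompact K) (hν : ν Kᶜ = 0) {f : E → Y → F}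
    (hf : ContDiff ℝ ∞ (fun q : E × Y => f q.1 q.2)) :
    ContDiff ℝ ∞ (fun x => ∫ y, f x y ∂ν) := by
  rw [contDiff_infty]
  intro k
  induction k generalizing F with
  | zero =>
    refine contDiff_zero.2 ?_
    exact continuous_iff_continuousAt.2 fun x =>
      (hasFDerivAt_integral_of_compact hK hν hf x).continuousAt
  | succ k ih =>
    rw [Nat.cast_add, Nat.cast_one, contDiff_succ_iff_fderiv]
    refine ⟨fun x => (hasFDerivAt_integral_of_compact hK hν hf x).differentiableAt, by simp, ?_⟩
    have : fderiv ℝ (fun x => ∫ y, f x y ∂ν) = fun x => ∫ y, fderiv ℝ (fun x => f x y) x ∂ν :=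
      funext fun x => (hasFDerivAt_integral_of_compact hK hν hf x).fderiv
    rw [this]
    exact ih (contDiff_partial hf)

end integrals

/-! ### Integrals of families of forms -/

section formIntegrals
open MeasureTheory
variable {n r : ℕ} {Y : Type} [NormedAddCommGroup Y] [NormedSpace ℝ Y] [SecondCountableTopology Y]
  [MeasurableSpace Y] [BorelSpace Y]

theorem integral_form_apply {Y : Type} [MeasurableSpace Y] {ν : Measure Y} {f : Y → (Fin n → ℂ) [⋀^Fin r]→L[ℝ] ℂ}
    (hf : Integrable f ν) (v : Fin r → Fin n → ℂ) : (∫ y, f y ∂ν) v = ∫ y, f y v ∂ν :=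
  ((ContinuousAlternatingMap.apply ℝ (Fin n → ℂ) ℂ v).integral_comp_comm hf).symm

theorem isAntilinear_integral {ν : Measure Y} {f : Y → (Fin n → ℂ) [⋀^Fin r]→L[ℝ] ℂ}
    (hf : Integrable f ν) (h : ∀ y, IsAntilinear (f y)) : IsAntilinear (∫ y, f y ∂ν) := by
  intro v i c
  rw [integral_form_apply hf, integral_form_apply hf, ← integral_const_mul]
  exact integral_congr_ae (Filter.Eventually.of_forall fun y => h y v i c)

theorem integral_mem_smoothForms {ν : Measure Y} [IsFiniteMeasure ν] {K : Set Y}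
    (hK : IsCompact K) (hν : ν Kᶜ = 0) {f : (Fin n → ℂ) → Y → (Fin n → ℂ) [⋀^Fin r]→L[ℝ] ℂ}
    (hf : ContDiff ℝ ∞ (fun q : (Fin n → ℂ) × Y => f q.1 q.2))
    (h : ∀ x y, IsAntilinear (f x y)) : (fun x => ∫ y, f x y ∂ν) ∈ smoothForms n r :=
  ⟨contDiff_integral_of_compact hK hν hf, fun x => isAntilinear_integral
    (integrable_of_continuous_compact hK hν (hf.continuous.comp (Continuous.prodMk_right x))) (h x)⟩

theorem dbar_integral {ν : Measure Y} [IsFiniteMeasure ν] {K : Set Y}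
    (hK : IsCompact K) (hν : ν Kᶜ = 0) {f : (Fin n → ℂ) → Y → (Fin n → ℂ) [⋀^Fin r]→L[ℝ] ℂ}
    (hf : ContDiff ℝ ∞ (fun q : (Fin n → ℂ) × Y => f q.1 q.2)) (x : Fin n → ℂ) :
    dbar (fun x => ∫ y, f x y ∂ν) x = ∫ y, dbar (fun x => f x y) x ∂ν := by
  rw [dbar_eq_dbarL, (hasFDerivAt_integral_of_compact hK hν hf x).fderiv]
  simp only [dbar_eq_dbarL]
  exact ((dbarL n r).integral_comp_comm (integrable_of_continuous_compact hK hν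
    ((contDiff_partial hf).continuous.comp (Continuous.prodMk_right x)))).symm

end formIntegrals

/-! ### The homotopy formula for averages of translates -/

section homotopy
open MeasureTheory
variable {n r : ℕ}

/-- The average of the translates of a form with respect to a measure. -/
def translAverage (ν : Measure (Fin n → ℂ)) (ψ : Form n r) : Form n r := fun z =>
  ∫ u, ψ (z + u) ∂ν

/-- The integrand of the homotopy operator `translHomotopy`. -/
def translIntegrand (ψ : Form n (r + 1)) (z : Fin n → ℂ) (y : ℝ × (Fin n → ℂ)) :
    (Fin n → ℂ) [⋀^Fin r]→L[ℝ] ℂ :=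
  (2 : ℝ) • (ψ (z + y.1 • y.2)).curryLeft y.2

/-- The homotopy operator attached to a measure on the group of translations. -/
def translHomotopy (ν : Measure (Fin n → ℂ)) (ψ : Form n (r + 1)) : Form n r := fun z =>
  ∫ y, translIntegrand ψ z y ∂((volume.restrict (Set.Ioc (0 : ℝ) 1)).prod ν)

/-- Invariance of a measure under multiplication by complex numbers of absolute value one. -/
def IsRotationInvariant (ν : Measure (Fin n → ℂ)) : Prop :=
  ∀ θ : ℝ, ν.map (fun u => Complex.exp (θ * Complex.I) • u) = ν

theorem contDiff_curryLeft :
    ContDiff ℝ ∞ (fun α : (Fin n → ℂ) [⋀^Fin (r + 1)]→L[ℝ] ℂ => α.curryLeft) := by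
  refine IsBoundedLinearMap.contDiff ⟨⟨fun _ _ => rfl, fun _ _ => rfl⟩, 1, one_pos, fun x => ?_⟩
  rw [norm_curryLeft, one_mul]

theorem continuous_dbarL_comp {Y : Type} [TopologicalSpace Y]
    {f : Y → (Fin n → ℂ) →L[ℝ] (Fin n → ℂ) [⋀^Fin r]→L[ℝ] ℂ} (hf : Continuous f) :
    Continuous (fun y => dbarL n r (f y)) :=
  (dbarL n r).continuous.comp hf

theorem contDiff_curryLeft_transl {ψ : Form n (r + 1)} (hψ : ContDiff ℝ ∞ ψ) :
    ContDiff ℝ ∞ (fun q : (Fin n → ℂ) × (ℝ × (Fin n → ℂ)) => translIntegrand ψ q.1 q.2) := by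
  have h1 : ContDiff ℝ ∞ (fun q : (Fin n → ℂ) × (ℝ × (Fin n → ℂ)) => q.1 + q.2.1 • q.2.2) := by
    fun_prop
  have h2 : ContDiff ℝ ∞ (fun q : (Fin n → ℂ) × (ℝ × (Fin n → ℂ)) =>
      (ψ (q.1 + q.2.1 • q.2.2)).curryLeft) :=
    contDiff_curryLeft.comp (hψ.comp h1)
  have h3 : ContDiff ℝ ∞ (fun q : (Fin n → ℂ) × (ℝ × (Fin n → ℂ)) => q.2.2) := by fun_prop
  exact (h2.clm_apply h3).const_smul (2 : ℝ)

theorem contDiff_transl {ψ : Form n r} (hψ : ContDiff ℝ ∞ ψ) :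
    ContDiff ℝ ∞ (fun q : (Fin n → ℂ) × (Fin n → ℂ) => ψ (q.1 + q.2)) :=
  hψ.comp (contDiff_fst.add contDiff_snd)

theorem prod_compl_eq_zero {ν : Measure (Fin n → ℂ)} [IsFiniteMeasure ν]
    {K : Set (Fin n → ℂ)} (hν : ν Kᶜ = 0) :
    ((volume.restrict (Set.Ioc (0 : ℝ) 1)).prod ν) (Set.Icc (0 : ℝ) 1 ×ˢ K)ᶜ = 0 := by
  rw [Set.compl_prod_eq_union]
  refine measure_union_null ?_ ?_
  · rw [Measure.prod_prod, Measure.restrict_apply measurableSet_Icc.compl]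
    have : (Set.Icc (0 : ℝ) 1)ᶜ ∩ Set.Ioc 0 1 = ∅ := by
      ext s
      simp only [Set.mem_inter_iff, Set.mem_compl_iff, Set.mem_Icc, Set.mem_Ioc,
        Set.mem_empty_iff_false, iff_false]
      intro h
      exact h.1 ⟨h.2.1.le, h.2.2⟩
    simp [this]
  · rw [Measure.prod_prod, hν, mul_zero]

theorem translHomotopy_mem {ν : Measure (Fin n → ℂ)} [IsFiniteMeasure ν]
    {K : Set (Fin n → ℂ)} (hK : IsCompact K) (hν : ν Kᶜ = 0) {ψ : Form n (r + 1)}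
    (hψ : ψ ∈ smoothForms n (r + 1)) : translHomotopy ν ψ ∈ smoothForms n r := by
  refine integral_mem_smoothForms (isCompact_Icc.prod hK) (prod_compl_eq_zero hν)
    (contDiff_curryLeft_transl hψ.1) fun x y => ?_
  have := ((hψ.2 (x + y.1 • y.2)).curryLeft y.2).smul 2
  convert this using 1
  ext v
  simp [translIntegrand]

theorem dbar_comp_add {ψ : Form n r} (z w : Fin n → ℂ) :
    dbar (fun z => ψ (z + w)) z = dbar ψ (z + w) := by
  simp only [dbar_eq_dbarL, fderiv_comp_add_right]

theorem dbar_translAverage {ν : Measure (Fin n → ℂ)} [IsFiniteMeasure ν]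
    {K : Set (Fin n → ℂ)} (hK : IsCompact K) (hν : ν Kᶜ = 0) {ψ : Form n r}
    (hψ : ContDiff ℝ ∞ ψ) (z : Fin n → ℂ) :
    dbar (translAverage ν ψ) z = translAverage ν (dbar ψ) z := by
  have := dbar_integral hK hν (f := fun z u => ψ (z + u)) (contDiff_transl hψ) z
  simp only [dbar_comp_add] at this
  exact this

/-- Contraction with `u` and ∂̄ combine to the conjugate-linear part of the derivative at `u`, which
is half of the derivative along `u` plus half of `I` times the derivative along `I • u`. The factor
2 in `translIntegrand` clears the halves. -/
theorem cartan_formula {ψ : Form n (r + 1)} (hψ : Differentiable ℝ ψ) (z w u : Fin n → ℂ) :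
    dbar (fun z => (2 : ℝ) • (ψ (z + w)).curryLeft u) z + (2 : ℝ) • (dbar ψ (z + w)).curryLeft u =
      fderiv ℝ ψ (z + w) u + Complex.I • fderiv ℝ ψ (z + w) (Complex.I • u) := by
  set D := fderiv ℝ ψ (z + w) with hD
  have h1 : fderiv ℝ (fun z => (2 : ℝ) • (ψ (z + w)).curryLeft u) z =
      (2 : ℝ) • (contract n r u).comp D := by
    have h2 : HasFDerivAt (fun z => ψ (z + w)) D z := by
      have := (hψ (z + w)).hasFDerivAt
      exact (hasFDerivAt_comp_add_right w).2 this
    exact (((contract n r u).hasFDerivAt.comp z h2).const_smul (2 : ℝ)).fderiv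
  have h2 : (dbar ψ (z + w)).curryLeft u = antilinearPart D u -
      alternatizeUncurryFin (antilinearPart ((contract n r u).comp D)) := by
    refine curryLeft_alternatizeUncurryFin _ _ u fun v => ?_
    ext x
    simp only [antilinearPart_apply, ContinuousLinearMap.comp_apply, contract_apply,
      curryLeft_apply_apply, ContinuousAlternatingMap.smul_apply, ContinuousAlternatingMap.add_apply]
    rfl
  rw [dbar_eq_dbarL, h1, map_smul, h2]
  have h3 : dbarL n r ((contract n r u).comp D) =
      alternatizeUncurryFin (antilinearPart ((contract n r u).comp D)) := by
    simp [dbarL, antilinearPartL_apply]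
  rw [h3, antilinearPart_apply]
  ext v
  simp only [ContinuousAlternatingMap.add_apply, ContinuousAlternatingMap.smul_apply,
    ContinuousAlternatingMap.sub_apply, Complex.real_smul, smul_eq_mul]
  push_cast
  ring

theorem integral_rotation {ν : Measure (Fin n → ℂ)} (hrot : IsRotationInvariant ν)
    {F : Type} [NormedAddCommGroup F] [NormedSpace ℝ F] {f : (Fin n → ℂ) → F} (hf : Continuous f)
    (θ : ℝ) : ∫ u, f (Complex.exp (θ * Complex.I) • u) ∂ν = ∫ u, f u ∂ν := by
  have hm : Measurable fun u : Fin n → ℂ => Complex.exp (θ * Complex.I) • u :=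
    (continuous_const_smul _).measurable
  conv_rhs => rw [← hrot θ]
  rw [integral_map hm.aemeasurable hf.aestronglyMeasurable]

/-- The integral of the rotated function does not depend on the angle; its derivative at angle 0 is
the left side. -/
theorem integral_fderiv_rotation {ν : Measure (Fin n → ℂ)} [IsFiniteMeasure ν]
    {K : Set (Fin n → ℂ)} (hK : IsCompact K) (hν : ν Kᶜ = 0) (hrot : IsRotationInvariant ν)
    {F : Type} [NormedAddCommGroup F] [NormedSpace ℝ F] {f : (Fin n → ℂ) → F}
    (hf : ContDiff ℝ ∞ f) :
    ∫ u, fderiv ℝ f u (Complex.I • u) ∂ν = 0 := by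
  have hsm : ContDiff ℝ ∞ (fun q : ℝ × (Fin n → ℂ) => f (Complex.exp (q.1 * Complex.I) • q.2)) := by
    have h0 : ContDiff ℝ ∞ (fun q : ℝ × (Fin n → ℂ) => Complex.exp (q.1 * Complex.I)) :=
      ((Complex.ofRealCLM.contDiff.comp contDiff_fst).mul contDiff_const).cexp
    exact hf.comp (h0.smul contDiff_snd)
  have h1 := hasFDerivAt_integral_of_compact hK hν
    (f := fun (θ : ℝ) u => f (Complex.exp (θ * Complex.I) • u)) hsm (0 : ℝ)
  have h2 : (fun θ : ℝ => ∫ u, f (Complex.exp (θ * Complex.I) • u) ∂ν) =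
      fun _ => ∫ u, f u ∂ν := funext fun θ => integral_rotation hrot hf.continuous θ
  rw [h2] at h1
  have h3 := h1.unique (hasFDerivAt_const _ _)
  have hint : Integrable (fun u => fderiv ℝ (fun θ : ℝ => f (Complex.exp (θ * Complex.I) • u)) 0) ν :=
    integrable_of_continuous_compact hK hν
      ((contDiff_partial (f := fun (θ : ℝ) u => f (Complex.exp (θ * Complex.I) • u))
        hsm).continuous.comp (Continuous.prodMk_right (0 : ℝ)))
  have h4 := congrArg (fun L : ℝ →L[ℝ] F => L 1) h3
  simp only [_root_.zero_apply] at h4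
  rw [ContinuousLinearMap.integral_apply hint] at h4
  rw [← h4]
  refine integral_congr_ae (Filter.Eventually.of_forall fun u => ?_)
  have h5 : HasDerivAt (fun θ : ℝ => Complex.exp (θ * Complex.I) • u) (Complex.I • u) 0 := by
    have := ((Complex.ofRealCLM.hasDerivAt (x := (0 : ℝ))).mul_const Complex.I).cexp.smul_const u
    simpa using this
  have hfu : HasFDerivAt f (fderiv ℝ f u) (Complex.exp ((0 : ℝ) * Complex.I) • u) := by
    simpa using (hf.differentiable (by simp) u).hasFDerivAt
  have h6 := (hfu.comp_hasDerivAt (0 : ℝ) h5).hasFDerivAt.fderiv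
  have h7 := congrArg (fun L : ℝ →L[ℝ] F => L 1) h6
  simp only [ContinuousLinearMap.toSpanSingleton_apply, one_smul] at h7
  exact h7.symm

/-- The inner integral is the derivative in `s` of the average of `f (z + s • u)`, so this is the
fundamental theorem of calculus. -/
theorem integral_radial {ν : Measure (Fin n → ℂ)} [IsFiniteMeasure ν]
    {K : Set (Fin n → ℂ)} (hK : IsCompact K) (hν : ν Kᶜ = 0)
    {F : Type} [NormedAddCommGroup F] [NormedSpace ℝ F] [CompleteSpace F] {f : (Fin n → ℂ) → F}
    (hf : ContDiff ℝ ∞ f) (z : Fin n → ℂ) :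
    ∫ s in Set.Ioc (0 : ℝ) 1, ∫ u, fderiv ℝ f (z + s • u) u ∂ν =
      ∫ u, f (z + u) ∂ν - ν.real Set.univ • f z := by
  have hsm : ContDiff ℝ ∞ (fun q : ℝ × (Fin n → ℂ) => f (z + q.1 • q.2)) :=
    hf.comp (contDiff_const.add (contDiff_fst.smul contDiff_snd))
  have hg := contDiff_integral_of_compact hK hν (f := fun (s : ℝ) u => f (z + s • u)) hsm
  have hder : ∀ s : ℝ, HasDerivAt (fun s : ℝ => ∫ u, f (z + s • u) ∂ν)
      (∫ u, fderiv ℝ f (z + s • u) u ∂ν) s := by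
    intro s
    have h1 := (hasFDerivAt_integral_of_compact hK hν
      (f := fun (s : ℝ) u => f (z + s • u)) hsm s).hasDerivAt
    refine h1.congr_deriv ?_
    have hint : Integrable (fun u => fderiv ℝ (fun s : ℝ => f (z + s • u)) s) ν :=
      integrable_of_continuous_compact hK hν
        ((contDiff_partial (f := fun (s : ℝ) u => f (z + s • u)) hsm).continuous.comp
          (Continuous.prodMk_right s))
    rw [ContinuousLinearMap.integral_apply hint]
    refine integral_congr_ae (Filter.Eventually.of_forall fun u => ?_)
    have h5 : HasDerivAt (fun s : ℝ => z + s • u) u s := by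
      simpa using ((hasDerivAt_id s).smul_const u).const_add z
    have h6 := ((hf.differentiable (by simp) (z + s • u)).hasFDerivAt.comp_hasDerivAt s
      h5).hasFDerivAt.fderiv
    have h7 := congrArg (fun L : ℝ →L[ℝ] F => L 1) h6
    simp only [ContinuousLinearMap.toSpanSingleton_apply, one_smul] at h7
    exact h7
  have hd : (fun s : ℝ => ∫ u, fderiv ℝ f (z + s • u) u ∂ν) =
      deriv (fun s : ℝ => ∫ u, f (z + s • u) ∂ν) := funext fun s => (hder s).deriv.symm
  have hcont : Continuous (fun s : ℝ => ∫ u, fderiv ℝ f (z + s • u) u ∂ν) := by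
    rw [hd]; exact hg.continuous_deriv (by simp)
  rw [← intervalIntegral.integral_of_le zero_le_one,
    intervalIntegral.integral_eq_sub_of_hasDerivAt (fun s _ => hder s)
      (hcont.intervalIntegrable _ _)]
  simp

theorem continuous_dbar_curryLeft_transl {ψ : Form n (r + 1)} (hψ : ContDiff ℝ ∞ ψ)
    (z : Fin n → ℂ) : Continuous (fun y : ℝ × (Fin n → ℂ) =>
      dbar (fun z => translIntegrand ψ z y) z) := by
  have h := (contDiff_partial (contDiff_curryLeft_transl hψ)).continuous.comp
    (Continuous.prodMk_right z)
  simp only [dbar_eq_dbarL]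
  exact continuous_dbarL_comp h

theorem dbar_translHomotopy_aux {ν : Measure (Fin n → ℂ)} [IsFiniteMeasure ν]
    {K : Set (Fin n → ℂ)} (hK : IsCompact K) (hν : ν Kᶜ = 0)
    {ψ : Form n (r + 1)} (hψ : ψ ∈ smoothForms n (r + 1)) (z : Fin n → ℂ) :
    dbar (translHomotopy ν ψ) z = ∫ y, dbar (fun z => translIntegrand ψ z y) z
      ∂((volume.restrict (Set.Ioc (0 : ℝ) 1)).prod ν) :=
  dbar_integral (isCompact_Icc.prod (s := Set.Icc (0 : ℝ) 1) hK) (prod_compl_eq_zero hν)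
    (f := translIntegrand ψ) (contDiff_curryLeft_transl hψ.1) z

theorem dbar_translHomotopy_eq_integral {ν : Measure (Fin n → ℂ)} [IsFiniteMeasure ν]
    {K : Set (Fin n → ℂ)} (hK : IsCompact K) (hν : ν Kᶜ = 0)
    {ψ : Form n (r + 1)} (hψ : ψ ∈ smoothForms n (r + 1)) (z : Fin n → ℂ) :
    dbar (translHomotopy ν ψ) z + translHomotopy ν (dbar ψ) z =
      ∫ y : ℝ × (Fin n → ℂ), (fderiv ℝ ψ (z + y.1 • y.2) y.2 +
        Complex.I • fderiv ℝ ψ (z + y.1 • y.2) (Complex.I • y.2))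
          ∂((volume.restrict (Set.Ioc (0 : ℝ) 1)).prod ν) := by
  have hcpt := isCompact_Icc.prod (s := Set.Icc (0 : ℝ) 1) hK
  have hnull := prod_compl_eq_zero hν
  have hd : Differentiable ℝ ψ := hψ.1.differentiable (by simp)
  have hi2 := integrable_of_continuous_compact hcpt hnull
    ((contDiff_curryLeft_transl (dbar_mem hψ).1).continuous.comp (Continuous.prodMk_right z))
  have hi1 := integrable_of_continuous_compact hcpt hnull
    (continuous_dbar_curryLeft_transl hψ.1 z)
  rw [dbar_translHomotopy_aux hK hν hψ]
  refine (integral_add hi1 hi2).symm.trans ?_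
  have h : ∀ y : ℝ × (Fin n → ℂ), dbar (fun z => translIntegrand ψ z y) z +
      translIntegrand (dbar ψ) z y = fderiv ℝ ψ (z + y.1 • y.2) y.2 +
        Complex.I • fderiv ℝ ψ (z + y.1 • y.2) (Complex.I • y.2) := fun y =>
    cartan_formula hd z (y.1 • y.2) y.2
  simp only [← h]
  rfl

/-- The chain rule for `u ↦ f (z + s • u)` produces a factor `s` that has to be divided out; the
excluded value 0 is not in the half-open interval used by `translHomotopy`. -/
theorem integral_fderiv_rotation_transl {ν : Measure (Fin n → ℂ)} [IsFiniteMeasure ν]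
    {K : Set (Fin n → ℂ)} (hK : IsCompact K) (hν : ν Kᶜ = 0) (hrot : IsRotationInvariant ν)
    {F : Type} [NormedAddCommGroup F] [NormedSpace ℝ F] {f : (Fin n → ℂ) → F}
    (hf : ContDiff ℝ ∞ f) (z : Fin n → ℂ) {s : ℝ} (hs : s ≠ 0) :
    ∫ u, fderiv ℝ f (z + s • u) (Complex.I • u) ∂ν = 0 := by
  have hf' : ContDiff ℝ ∞ (fun u => f (z + s • u)) :=
    hf.comp (contDiff_const.add (contDiff_id.const_smul s))
  have h1 := integral_fderiv_rotation hK hν hrot hf'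
  have h2 : ∀ u, fderiv ℝ (fun u => f (z + s • u)) u (Complex.I • u) =
      s • fderiv ℝ f (z + s • u) (Complex.I • u) := by
    intro u
    have h3 : HasFDerivAt (fun u : Fin n → ℂ => z + s • u)
        (s • ContinuousLinearMap.id ℝ (Fin n → ℂ)) u :=
      ((hasFDerivAt_id u).const_smul s).const_add z
    have h4 := (hf.differentiable (by simp) (z + s • u)).hasFDerivAt.comp u h3
    have h5 : fderiv ℝ (fun u => f (z + s • u)) u = _ := h4.fderiv
    rw [h5]
    simp
  simp only [h2] at h1
  rw [integral_smul, smul_eq_zero] at h1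
  exact h1.resolve_left hs

/-- In the integrated Cartan formula the derivatives along `u` add up to the difference between the
average and the mass times ψ, while those along `I • u` cancel by rotation invariance. Thus ∂̄ alone
controls the effect of translations. -/
theorem dbar_translHomotopy {ν : Measure (Fin n → ℂ)} [IsFiniteMeasure ν]
    {K : Set (Fin n → ℂ)} (hK : IsCompact K) (hν : ν Kᶜ = 0) (hrot : IsRotationInvariant ν)
    {ψ : Form n (r + 1)} (hψ : ψ ∈ smoothForms n (r + 1)) (z : Fin n → ℂ) :
    dbar (translHomotopy ν ψ) z + translHomotopy ν (dbar ψ) z =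
      translAverage ν ψ z - ν.real Set.univ • ψ z := by
  have hcpt := isCompact_Icc.prod (s := Set.Icc (0 : ℝ) 1) hK
  have hnull := prod_compl_eq_zero hν
  have hcd : Continuous (fderiv ℝ ψ) := (hψ.1.continuous_fderiv (by simp))
  have c1 : Continuous fun y : ℝ × (Fin n → ℂ) => fderiv ℝ ψ (z + y.1 • y.2) y.2 :=
    (hcd.comp (g := fderiv ℝ ψ) (f := fun y : ℝ × (Fin n → ℂ) => z + y.1 • y.2)
      (by fun_prop)).clm_apply continuous_snd
  have c2 : Continuous fun y : ℝ × (Fin n → ℂ) =>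
      Complex.I • fderiv ℝ ψ (z + y.1 • y.2) (Complex.I • y.2) :=
    ((hcd.comp (g := fderiv ℝ ψ) (f := fun y : ℝ × (Fin n → ℂ) => z + y.1 • y.2)
      (by fun_prop)).clm_apply (continuous_snd.const_smul Complex.I)).fun_const_smul Complex.I
  have i1 := integrable_of_continuous_compact hcpt hnull c1
  have i2 := integrable_of_continuous_compact hcpt hnull c2
  rw [dbar_translHomotopy_eq_integral hK hν hψ, integral_add i1 i2, integral_prod _ i1,
    integral_prod _ i2, integral_radial hK hν hψ.1]
  have hz : ∀ s ∈ Set.Ioc (0 : ℝ) 1,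
      ∫ u, Complex.I • fderiv ℝ ψ (z + s • u) (Complex.I • u) ∂ν = 0 := by
    intro s hs
    rw [integral_smul, integral_fderiv_rotation_transl hK hν hrot hψ.1 z hs.1.ne', smul_zero]
  rw [setIntegral_congr_fun measurableSet_Ioc (g := fun _ => 0) hz]
  simp only [integral_zero, add_zero, translAverage]

end homotopy

/-! ### The Dolbeault lemma on polydiscs -/

section dolbeault
open MeasureTheory
variable {n r : ℕ}

theorem ae_transl {ν : Measure (Fin n → ℂ)} [IsFiniteMeasure ν] {K : Set (Fin n → ℂ)}
    (hν : ν Kᶜ = 0) : ∀ᵐ y ∂((volume.restrict (Set.Ioc (0 : ℝ) 1)).prod ν),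
      y ∈ Set.Icc (0 : ℝ) 1 ×ˢ K := by
  rw [ae_iff]
  exact prod_compl_eq_zero hν

theorem translHomotopy_congr {ν : Measure (Fin n → ℂ)} [IsFiniteMeasure ν] {K : Set (Fin n → ℂ)}
    (hν : ν Kᶜ = 0) {φ ψ : Form n (r + 1)} {z : Fin n → ℂ}
    (h : ∀ s ∈ Set.Icc (0 : ℝ) 1, ∀ u ∈ K, φ (z + s • u) = ψ (z + s • u)) :
    translHomotopy ν φ z = translHomotopy ν ψ z := by
  refine integral_congr_ae ?_
  filter_upwards [ae_transl hν] with y hy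
  simp only [translIntegrand, h y.1 hy.1 y.2 hy.2]

theorem translHomotopy_zero {ν : Measure (Fin n → ℂ)} (z : Fin n → ℂ) :
    translHomotopy ν (0 : Form n (r + 1)) z = 0 := by
  have : ∀ y, translIntegrand (0 : Form n (r + 1)) z y = 0 := fun y => by
    ext v
    simp [translIntegrand]
  simp [translHomotopy, this]

theorem translAverage_congr {ν : Measure (Fin n → ℂ)} {K : Set (Fin n → ℂ)}
    (hν : ν Kᶜ = 0) {φ ψ : Form n r} {z : Fin n → ℂ} (h : ∀ u ∈ K, φ (z + u) = ψ (z + u)) :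
    translAverage ν φ z = translAverage ν ψ z := by
  refine integral_congr_ae ?_
  filter_upwards [ae_mem_of_measure_compl hν] with y hy using h y hy

theorem translAverage_zero {ν : Measure (Fin n → ℂ)} (z : Fin n → ℂ) :
    translAverage ν (0 : Form n r) z = 0 := by
  simp [translAverage]

theorem zero_form_apply (v : Fin r → Fin n → ℂ) :
    (0 : (Fin n → ℂ) [⋀^Fin r]→L[ℝ] ℂ) v = 0 := rfl

theorem smul_zero_form (c : ℂ) : c • (0 : (Fin n → ℂ) [⋀^Fin r]→L[ℝ] ℂ) = 0 := by
  ext v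
  simp

theorem zero_smul_form (α : (Fin n → ℂ) [⋀^Fin r]→L[ℝ] ℂ) : (0 : ℂ) • α = 0 := by
  ext v
  simp

theorem curryLeft_curryLeft_swap (α : (Fin n → ℂ) [⋀^Fin (r + 2)]→L[ℝ] ℂ) (u v : Fin n → ℂ) :
    (α.curryLeft u).curryLeft v = -(α.curryLeft v).curryLeft u := by
  have h : ∀ u, ∀ w, ((α.curryLeft u).curryLeft u) w = 0 := fun u w => by
    rw [curryLeft_same]; rfl
  ext w
  have h' := h (u + v) w
  have hadd : ∀ x y, (α.curryLeft (u + v)).curryLeft x y =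
      (α.curryLeft u).curryLeft x y + (α.curryLeft v).curryLeft x y := fun x y => by
    rw [_root_.map_add]; rfl
  rw [_root_.map_add, ContinuousAlternatingMap.add_apply, hadd, hadd, h, h] at h'
  rw [ContinuousAlternatingMap.neg_apply]
  linear_combination h'

/-- A `(0, r + 1)`-form annihilated by contraction with the coordinate vectors vanishes. -/
theorem IsAntilinear.eq_zero_of_curryLeft {α : (Fin n → ℂ) [⋀^Fin (r + 1)]→L[ℝ] ℂ}
    (hα : IsAntilinear α) (h : ∀ j, α.curryLeft (Pi.single j 1) = 0) : α = 0 := by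
  ext v
  have h1 : v 0 = ∑ j, v 0 j • (Pi.single j 1 : Fin n → ℂ) := by
    ext i
    simp [Finset.sum_apply, Pi.single_apply]
  have h2 : α.curryLeft (v 0) = 0 := by
    rw [h1, _root_.map_sum]
    refine Finset.sum_eq_zero fun j _ => ?_
    rw [hα.curryLeft_smul, h, smul_zero]
  have h3 := congrArg (fun β => β (Fin.tail v)) h2
  simp only [curryLeft_apply_apply, zero_form_apply] at h3
  rw [zero_form_apply, ← h3]
  congr 1
  exact (Fin.cons_self_tail v).symm

/-- The homotopy operator contracts ψ with vectors of the support of the measure, and a further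
contraction passes under the integral. -/
theorem curryLeft_translHomotopy {ν : Measure (Fin n → ℂ)} [IsFiniteMeasure ν]
    {K : Set (Fin n → ℂ)} (hK : IsCompact K) (hν : ν Kᶜ = 0) {ψ : Form n (r + 2)}
    (hψ : ContDiff ℝ ∞ ψ) {v : Fin n → ℂ}
    (h : ∀ z, ∀ u ∈ K, ((ψ z).curryLeft u).curryLeft v = 0) (z : Fin n → ℂ) :
    (translHomotopy ν ψ z).curryLeft v = 0 := by
  have hint := integrable_of_continuous_compact (isCompact_Icc.prod (s := Set.Icc (0 : ℝ) 1) hK)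
    (prod_compl_eq_zero hν)
    ((contDiff_curryLeft_transl hψ).continuous.comp (Continuous.prodMk_right z))
  have h1 := (contract n r v).integral_comp_comm hint
  rw [← contract_apply, translHomotopy]
  refine h1.symm.trans (integral_eq_zero_of_ae ?_)
  filter_upwards [ae_transl hν] with y hy
  ext w
  have h2 := congrArg (fun α => α w) (h (z + y.1 • y.2) _ hy.2)
  simp only [curryLeft_apply_apply, zero_form_apply] at h2
  simp [translIntegrand, contract_apply, h2]

/-- The closed annulus of inner radius `S` and outer radius `S + 1`. -/
def annulus (S : ℝ) : Set ℂ := {z | S ≤ ‖z‖ ∧ ‖z‖ ≤ S + 1}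

theorem isCompact_annulus (S : ℝ) : IsCompact (annulus S) := by
  refine (isCompact_closedBall (0 : ℂ) (S + 1)).of_isClosed_subset ?_ fun z hz => by
    simpa using hz.2
  exact (isClosed_le continuous_const continuous_norm).inter
    (isClosed_le continuous_norm continuous_const)

/-- The embedding of the `k`-th coordinate axis. -/
def axisEmb (k : Fin n) (w : ℂ) : Fin n → ℂ := Pi.single k w

/-- Lebesgue measure on an annulus in the `k`-th coordinate axis. -/
def axisMeasure (k : Fin n) (S : ℝ) : Measure (Fin n → ℂ) :=
  (volume.restrict (annulus S)).map (axisEmb k)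

theorem continuous_axisEmb (k : Fin n) : Continuous (axisEmb k) :=
  continuous_single (A := fun _ : Fin n => ℂ) k

instance (k : Fin n) (S : ℝ) : IsFiniteMeasure (axisMeasure k S) := by
  have : IsFiniteMeasure ((volume : Measure ℂ).restrict (annulus S)) :=
    ⟨by rw [Measure.restrict_apply_univ]; exact (isCompact_annulus S).measure_lt_top⟩
  exact Measure.isFiniteMeasure_map _ _

theorem isCompact_axis (k : Fin n) (S : ℝ) : IsCompact (axisEmb k '' annulus S) :=
  (isCompact_annulus S).image (continuous_axisEmb k)

theorem axisMeasure_compl (k : Fin n) (S : ℝ) :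
    axisMeasure k S (axisEmb k '' annulus S)ᶜ = 0 := by
  rw [axisMeasure, Measure.map_apply (continuous_axisEmb k).measurable
    (isCompact_axis k S).measurableSet.compl, Measure.restrict_apply' (isCompact_annulus S).measurableSet]
  convert measure_empty (μ := volume)
  ext z
  simp only [Set.mem_inter_iff, Set.mem_preimage, Set.mem_compl_iff, Set.mem_empty_iff_false,
    iff_false]
  rintro ⟨h1, h2⟩
  exact h1 ⟨z, h2, rfl⟩

/-- On the axis, scalar rotation of ℂⁿ is rotation of ℂ, which preserves both Lebesgue measure and
the annulus. -/
theorem axisMeasure_rotation (k : Fin n) (S : ℝ) : IsRotationInvariant (axisMeasure k S) := by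
  intro θ
  have hc : ‖Complex.exp (θ * Complex.I)‖ = 1 := Complex.norm_exp_ofReal_mul_I θ
  have h1 : MeasurePreserving (fun z : ℂ => Complex.exp (θ * Complex.I) * z) volume volume := by
    have h0 : (fun z : ℂ => Complex.exp (θ * Complex.I) * z) = rotation (Circle.exp θ) := by
      ext1 z
      rw [rotation_apply, Circle.coe_exp]
    rw [h0]
    exact (rotation (Circle.exp θ)).measurePreserving
  have hpre : (fun z : ℂ => Complex.exp (θ * Complex.I) * z) ⁻¹' annulus S = annulus S := by
    ext z
    simp [annulus, hc]
  have h2 := h1.restrict_preimage (isCompact_annulus S).measurableSet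
  rw [hpre] at h2
  rw [axisMeasure, Measure.map_map (by fun_prop) (continuous_axisEmb k).measurable]
  have h3 : (fun u : Fin n → ℂ => Complex.exp (θ * Complex.I) • u) ∘ axisEmb k =
      axisEmb k ∘ fun z : ℂ => Complex.exp (θ * Complex.I) * z := by
    ext1 z
    simp only [Function.comp_apply, axisEmb]
    rw [← Pi.single_smul', smul_eq_mul]
  rw [h3, ← Measure.map_map (continuous_axisEmb k).measurable h1.measurable, h2.map_eq]

theorem axisMeasure_real_pos (k : Fin n) {S : ℝ} (hS : 0 ≤ S) :
    0 < (axisMeasure k S).real Set.univ := by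
  refine ENNReal.toReal_pos ?_ (measure_ne_top _ _)
  rw [axisMeasure, Measure.map_apply (continuous_axisEmb k).measurable MeasurableSet.univ,
    Set.preimage_univ, Measure.restrict_apply_univ]
  have hsub : Metric.ball ((S + 1 / 2 : ℝ) : ℂ) (1 / 2) ⊆ annulus S := by
    intro z hz
    rw [mem_ball_iff_norm] at hz
    have hn : ‖((S + 1 / 2 : ℝ) : ℂ)‖ = S + 1 / 2 := by
      rw [Complex.norm_real, Real.norm_of_nonneg (by linarith)]
    have h1 := abs_norm_sub_norm_le z ((S + 1 / 2 : ℝ) : ℂ)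
    rw [hn] at h1
    have h2 := abs_le.1 (h1.trans hz.le)
    exact ⟨by linarith [h2.1], by linarith [h2.2]⟩
  exact ((Metric.measure_ball_pos volume _ (by norm_num)).trans_le (measure_mono hsub)).ne'

theorem contDiff_smul_form {f : (Fin n → ℂ) → ℂ} (hf : ContDiff ℝ ∞ f) {ψ : Form n r}
    (hψ : ψ ∈ smoothForms n r) : (fun z => f z • ψ z) ∈ smoothForms n r :=
  ⟨hf.smul hψ.1, fun z => (hψ.2 z).smul (f z)⟩

/-- One step of the proof of the Dolbeault lemma: modulo an exact form, contraction with the `k`-th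
coordinate vector can be made to vanish. -/
theorem dolbeault_step {R : ℝ} (hR : 0 < R) (s : Finset (Fin n)) {k : Fin n} (hk : k ∉ s)
    {ψ : Form n (r + 1)} (hψ : ψ ∈ smoothForms n (r + 1))
    (hclosed : ∀ z, (∀ j ∈ s, ‖z j‖ < R) → dbar ψ z = 0)
    (hs : ∀ j ∈ s, ∀ z, (ψ z).curryLeft (Pi.single j 1) = 0) :
    ∃ η ∈ smoothForms n r, ∃ ψ' ∈ smoothForms n (r + 1),
      (∀ z, (∀ j ∈ insert k s, ‖z j‖ < R) → ψ z = dbar η z + ψ' z) ∧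
      (∀ j ∈ insert k s, ∀ z, (ψ' z).curryLeft (Pi.single j 1) = 0) := by
  -- From a point with `‖z k‖ < R`, a translation of length at least 2R + 2 along the axis leads to
  -- a `k`-th coordinate of norm at least R + 2, beyond the support of the cutoff of radius R + 1.
  -- The average then vanishes, and the homotopy formula yields a primitive.
  set ν := axisMeasure k (2 * R + 2) with hνdef
  have hK := isCompact_axis k (2 * R + 2)
  have hν := axisMeasure_compl k (2 * R + 2)
  set m := ν.real Set.univ with hm
  have hmpos : 0 < m := axisMeasure_real_pos k (by linarith)
  set b : ContDiffBump (0 : ℂ) := ⟨R, R + 1, hR, by linarith⟩ with hb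
  set χ : (Fin n → ℂ) → ℂ := fun z => (b (z k) : ℂ) with hχ
  have hχs : ContDiff ℝ ∞ χ :=
    Complex.ofRealCLM.contDiff.comp (b.contDiff.comp (contDiff_apply ℝ ℂ k))
  have hχd : Differentiable ℝ χ := hχs.differentiable (by simp)
  have hψd : Differentiable ℝ ψ := hψ.1.differentiable (by simp)
  have hχψ := contDiff_smul_form hχs hψ
  -- This is ∂̄χ ∧ ψ, all that is left of ∂̄(χψ) where ψ is closed. Translations along the `k`-th
  -- axis do not leave that region, since it only restricts coordinates in `s`.
  set β : Form n (r + 2) := fun z => wedgeOne (antilinearPart (fderiv ℝ χ z)) (ψ z) with hβ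
  have hβeq : ∀ z, dbar (fun z => χ z • ψ z) z = β z + χ z • dbar ψ z := fun z =>
    dbar_fun_smul (hχd z) (hψd z)
  have hβmem : β ∈ smoothForms n (r + 2) := by
    have h1 := Submodule.sub_mem _ (dbar_mem hχψ) (contDiff_smul_form hχs (dbar_mem hψ))
    convert h1 using 1
    ext1 z
    rw [Pi.sub_apply, hβeq, add_sub_cancel_right]
  -- With zero average and χ = 1, the homotopy formula for T reads ∂̄T(χψ) + Tβ = -mψ.
  refine ⟨(((-m⁻¹ : ℝ) : ℂ)) • translHomotopy ν (fun z => χ z • ψ z),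
    Submodule.smul_mem _ _ (translHomotopy_mem hK hν hχψ),
    (((-m⁻¹ : ℝ) : ℂ)) • translHomotopy ν β, Submodule.smul_mem _ _ (translHomotopy_mem hK hν hβmem),
    fun z hz => ?_, fun j hj z => ?_⟩
  · have hzk : ‖z k‖ < R := hz k (Finset.mem_insert_self _ _)
    have h1 := dbar_translHomotopy hK hν (axisMeasure_rotation k _) hχψ z
    have h2 : translHomotopy ν (dbar fun z => χ z • ψ z) z = translHomotopy ν β z := by
      refine translHomotopy_congr hν ?_
      rintro t - _ ⟨w, -, rfl⟩
      rw [hβeq, hclosed, smul_zero_form, add_zero]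
      intro j hj
      have hjk : j ≠ k := fun h => hk (h ▸ hj)
      simpa [hjk, axisEmb] using hz j (Finset.mem_insert_of_mem hj)
    have h3 : translAverage ν (fun z => χ z • ψ z) z = 0 := by
      rw [← translAverage_zero (ν := ν) z]
      refine translAverage_congr hν ?_
      rintro _ ⟨w, hw, rfl⟩
      have h0 : b (z k + w) = 0 := by
        refine b.zero_of_le_dist ?_
        rw [dist_zero_right]
        have h5 : ‖w‖ ≤ ‖z k + w‖ + ‖z k‖ := by
          simpa using norm_sub_le (z k + w) (z k)
        have h6 : 2 * R + 2 ≤ ‖w‖ := hw.1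
        show R + 1 ≤ ‖z k + w‖
        linarith
      simp [hχ, h0, axisEmb, zero_smul_form]
    have h4 : χ z = 1 := by
      have : b (z k) = 1 := b.one_of_mem_closedBall (by
        rw [mem_closedBall_zero_iff]; exact hzk.le)
      simp [hχ, this]
    rw [h2, h3, h4] at h1
    have hdiff : DifferentiableAt ℝ (translHomotopy ν fun z => χ z • ψ z) z :=
      (translHomotopy_mem hK hν hχψ).1.differentiable (by simp) z
    rw [dbar_const_smul hdiff, Pi.smul_apply]
    ext v
    have h5 := congrArg (fun α => α v) h1
    have h7 : (axisMeasure k (2 * R + 2)).real Set.univ = m := rfl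
    rw [h7] at h5
    simp only [ContinuousAlternatingMap.smul_apply, ContinuousAlternatingMap.sub_apply,
      ContinuousAlternatingMap.add_apply, zero_form_apply, Complex.real_smul, smul_eq_mul,
      one_mul] at h5 ⊢
    have h6 : (m : ℂ) ≠ 0 := by exact_mod_cast hmpos.ne'
    rw [← mul_add]
    refine Eq.trans ?_ (congrArg _ h5.symm)
    rw [zero_sub, Complex.ofReal_neg, Complex.ofReal_inv, neg_mul_neg, inv_mul_cancel_left₀ h6]
  · have h1 : (translHomotopy ν β z).curryLeft (Pi.single j 1) = 0 := by
      -- For `j = k` the two contractions are with parallel vectors. For `j ∈ s` the contraction of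
      -- β vanishes: χ depends on `z k` only, and ψ is annihilated by that direction.
      refine curryLeft_translHomotopy hK hν hβmem.1 ?_ z
      rintro z _ ⟨w, -, rfl⟩
      rcases Finset.mem_insert.1 hj with rfl | hjs
      · have : axisEmb j w = w • Pi.single j 1 := by
          rw [axisEmb, ← Pi.single_smul', smul_eq_mul, mul_one]
        rw [this, (hβmem.2 z).curryLeft_smul]
        ext v
        have h2 := congrArg (fun α => α v) (curryLeft_same (β z) (Pi.single j 1))
        simp only [zero_form_apply, curryLeft_apply_apply] at h2
        simp only [curryLeft_apply_apply, ContinuousAlternatingMap.smul_apply, h2, smul_zero,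
          zero_form_apply]
      · have hjk : j ≠ k := fun h => hk (h ▸ hjs)
        rw [curryLeft_curryLeft_swap]
        have h2 : (β z).curryLeft (Pi.single j 1) = 0 := by
          rw [hβ]
          simp only
          rw [curryLeft_wedgeOne, hs j hjs]
          have h3 : fderiv ℝ χ z = (fderiv ℝ (fun w : ℂ => (b w : ℂ)) (z k)).comp
              (ContinuousLinearMap.proj k) := by
            have h4 : DifferentiableAt ℝ (fun w : ℂ => (b w : ℂ)) (z k) :=
              (Complex.ofRealCLM.contDiff.comp (b.contDiff (n := ⊤))).differentiable (by simp) _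
            exact (HasFDerivAt.comp z h4.hasFDerivAt
              (ContinuousLinearMap.proj (R := ℝ) (φ := fun _ : Fin n => ℂ) k).hasFDerivAt).fderiv
          have h5 : antilinearPart (fderiv ℝ χ z) (Pi.single j 1) = 0 := by
            rw [antilinearPart_apply, h3]
            simp [hjk.symm]
          ext v
          simp [h5, wedgeOne, alternatizeUncurryFin_apply]
        rw [h2]
        ext v
        simp
    have h2 : ((((-m⁻¹ : ℝ) : ℂ)) • translHomotopy ν β) z =
        (((-m⁻¹ : ℝ) : ℂ)) • translHomotopy ν β z := rfl
    rw [h2]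
    ext v
    have h3 := congrArg (fun α => α v) h1
    simp only [curryLeft_apply_apply, zero_form_apply] at h3
    simp only [curryLeft_apply_apply, ContinuousAlternatingMap.smul_apply, h3, smul_zero,
      zero_form_apply]

theorem isOpen_polydisc (s : Finset (Fin n)) (R : ℝ) :
    IsOpen {z : Fin n → ℂ | ∀ j ∈ s, ‖z j‖ < R} := by
  have : {z : Fin n → ℂ | ∀ j ∈ s, ‖z j‖ < R} = ⋂ j ∈ s, {z | ‖z j‖ < R} := by
    ext z; simp
  rw [this]
  exact isOpen_biInter_finset fun j _ => isOpen_lt (continuous_apply j).norm continuous_const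

/-- The Dolbeault lemma: a closed smooth `(0, r + 1)`-form on `ℂⁿ` is exact on every polydisc, with
a globally defined smooth primitive. -/
theorem dolbeault_polydisc {R : ℝ} (hR : 0 < R) {ψ : Form n (r + 1)}
    (hψ : ψ ∈ smoothForms n (r + 1)) (hclosed : ∀ z, dbar ψ z = 0) :
    ∃ η ∈ smoothForms n r, ∀ z, (∀ j, ‖z j‖ < R) → dbar η z = ψ z := by
  -- Coordinates are eliminated one at a time. Once all of them annihilate the remainder, it
  -- vanishes, because a conjugate-linear form is determined by its contractions with the complex
  -- coordinate vectors.
  have key : ∀ s : Finset (Fin n), ∃ η ∈ smoothForms n r, ∃ ψ' ∈ smoothForms n (r + 1),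
      (∀ z, (∀ j ∈ s, ‖z j‖ < R) → ψ z = dbar η z + ψ' z) ∧
      (∀ j ∈ s, ∀ z, (ψ' z).curryLeft (Pi.single j 1) = 0) := by
    intro s
    induction s using Finset.induction_on with
    | empty =>
      refine ⟨0, Submodule.zero_mem _, ψ, hψ, fun z _ => ?_, by simp⟩
      have : dbar (0 : Form n r) z = 0 := by
        rw [dbar_eq_dbarL, fderiv_zero]
        exact _root_.map_zero _
      rw [this, zero_add]
    | insert k s hk ih =>
      obtain ⟨η, hη, ψ', hψ', h1, h2⟩ := ih
      have hηd : Differentiable ℝ (dbar η) := (dbar_mem hη).1.differentiable (by simp)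
      have hψ'd : Differentiable ℝ ψ' := hψ'.1.differentiable (by simp)
      -- The remainder is known to be closed only where the treated coordinates are small;
      -- `dolbeault_step` assumes no more than that.
      have h3 : ∀ z, (∀ j ∈ s, ‖z j‖ < R) → dbar ψ' z = 0 := by
        intro z hz
        have he : ψ =ᶠ[𝓝 z] dbar η + ψ' := by
          filter_upwards [(isOpen_polydisc s R).mem_nhds hz] with w hw using h1 w hw
        have h4 := dbar_congr he
        rw [hclosed, dbar_add (hηd z) (hψ'd z), dbar_dbar hη.1] at h4
        simpa using h4.symm
      obtain ⟨η', hη', ψ'', hψ'', h5, h6⟩ := dolbeault_step hR s hk hψ' h3 h2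
      refine ⟨η + η', Submodule.add_mem _ hη hη', ψ'', hψ'', fun z hz => ?_, h6⟩
      rw [dbar_add (hη.1.differentiable (by simp) z) (hη'.1.differentiable (by simp) z), add_assoc,
        ← h5 z hz, h1 z fun j hj => hz j (Finset.mem_insert_of_mem hj)]
  obtain ⟨η, hη, ψ', hψ', h1, h2⟩ := key Finset.univ
  refine ⟨η, hη, fun z hz => ?_⟩
  rw [h1 z fun j _ => hz j, (hψ'.2 z).eq_zero_of_curryLeft fun j => h2 j (Finset.mem_univ j) z,
    add_zero]

end dolbeault

/-! ### Mollification by a radial bump -/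

section mollify
open MeasureTheory
variable {N r : ℕ}

/-- A smooth bump function on `ℂᴺ` depending only on the Euclidean norm. -/
def radialBump (N : ℕ) {ε : ℝ} (hε : 0 < ε) (u : Fin N → ℂ) : ℝ :=
  (⟨ε ^ 2 / 2, ε ^ 2, by positivity, half_lt_self (by positivity)⟩ : ContDiffBump (0 : ℝ))
    (∑ j, ‖u j‖ ^ 2)

variable {ε : ℝ} (hε : 0 < ε)

theorem contDiff_radialBump : ContDiff ℝ ∞ (radialBump N hε) := by
  refine (ContDiffBump.contDiff (n := ⊤) _).comp ?_
  exact ContDiff.sum fun j _ => (contDiff_apply ℝ ℂ j).norm_sq ℝ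

theorem radialBump_nonneg (u : Fin N → ℂ) : 0 ≤ radialBump N hε u := ContDiffBump.nonneg _

theorem radialBump_smul {c : ℂ} (hc : ‖c‖ = 1) (u : Fin N → ℂ) :
    radialBump N hε (c • u) = radialBump N hε u := by
  simp [radialBump, hc]

theorem radialBump_zero_pos : 0 < radialBump N hε 0 := by
  refine ContDiffBump.pos_of_mem_ball _ ?_
  simpa using pow_pos hε 2

theorem radialBump_eq_zero {u : Fin N → ℂ} (hu : u ∉ Metric.closedBall 0 ε) :
    radialBump N hε u = 0 := by
  refine ContDiffBump.zero_of_le_dist _ ?_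
  have h : ¬ ∀ j, ‖u j‖ ≤ ε := by
    rwa [mem_closedBall_zero_iff, pi_norm_le_iff_of_nonneg hε.le] at hu
  push Not at h
  obtain ⟨j, hj⟩ := h
  have h1 : ‖u j‖ ^ 2 ≤ ∑ i, ‖u i‖ ^ 2 :=
    Finset.single_le_sum (f := fun i => ‖u i‖ ^ 2) (fun i _ => by positivity) (Finset.mem_univ j)
  have h2 : ε ^ 2 ≤ ‖u j‖ ^ 2 := by gcongr
  rw [dist_zero_right, Real.norm_of_nonneg (by positivity)]
  exact h2.trans h1

theorem hasCompactSupport_radialBump : HasCompactSupport (radialBump N hε) :=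
  HasCompactSupport.intro (isCompact_closedBall 0 ε) fun _ hu => radialBump_eq_zero hε hu

/-- The measure with density `radialBump`. -/
def bumpMeasure (N : ℕ) {ε : ℝ} (hε : 0 < ε) : Measure (Fin N → ℂ) :=
  volume.withDensity fun u => ENNReal.ofReal (radialBump N hε u)

theorem measurable_radialBump : Measurable fun u => ENNReal.ofReal (radialBump N hε u) :=
  (contDiff_radialBump hε).continuous.measurable.ennreal_ofReal

instance : IsFiniteMeasure (bumpMeasure N hε) := by
  refine isFiniteMeasure_withDensity_ofReal ?_
  exact ((contDiff_radialBump hε).continuous.integrable_of_hasCompactSupport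
    (hasCompactSupport_radialBump hε)).2

theorem bumpMeasure_compl : bumpMeasure N hε (Metric.closedBall 0 ε)ᶜ = 0 := by
  rw [bumpMeasure, withDensity_apply _ measurableSet_closedBall.compl]
  rw [setLIntegral_congr_fun measurableSet_closedBall.compl
    (g := 0) fun u hu => by simp [radialBump_eq_zero hε hu]]
  simp

theorem bumpMeasure_rotation : IsRotationInvariant (bumpMeasure N hε) := by
  intro θ
  have hc : ‖Complex.exp (θ * Complex.I)‖ = 1 := Complex.norm_exp_ofReal_mul_I θ
  have h1 : MeasurePreserving (fun z : ℂ => Complex.exp (θ * Complex.I) * z) volume volume := by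
    have h0 : (fun z : ℂ => Complex.exp (θ * Complex.I) * z) = rotation (Circle.exp θ) := by
      ext1 z
      rw [rotation_apply, Circle.coe_exp]
    rw [h0]
    exact (rotation (Circle.exp θ)).measurePreserving
  have h2 : MeasurePreserving (fun u : Fin N → ℂ => Complex.exp (θ * Complex.I) • u)
      volume volume := volume_preserving_pi fun _ => h1
  ext s hs
  rw [Measure.map_apply h2.measurable hs, bumpMeasure, withDensity_apply _ (h2.measurable hs),
    withDensity_apply _ hs, ← h2.setLIntegral_comp_preimage hs (measurable_radialBump hε)]
  simp only [radialBump_smul hε hc]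

theorem integral_bumpMeasure {F : Type} [NormedAddCommGroup F] [NormedSpace ℝ F]
    (f : (Fin N → ℂ) → F) : ∫ u, f u ∂bumpMeasure N hε = ∫ u, radialBump N hε u • f u := by
  rw [bumpMeasure, integral_withDensity_eq_integral_toReal_smul (measurable_radialBump hε)
    (Filter.Eventually.of_forall fun _ => ENNReal.ofReal_lt_top)]
  simp only [ENNReal.toReal_ofReal (radialBump_nonneg hε _)]

theorem bumpMeasure_real_pos : 0 < (bumpMeasure N hε).real Set.univ := by
  have h := integral_bumpMeasure (N := N) hε (fun _ => (1 : ℝ))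
  simp only [integral_const, smul_eq_mul, mul_one] at h
  rw [h]
  refine (contDiff_radialBump hε).continuous.integral_pos_of_hasCompactSupport_nonneg_nonzero
    (hasCompactSupport_radialBump hε) (radialBump_nonneg hε) (radialBump_zero_pos hε).ne'

/-- Convolution with `radialBump`. -/
def mollify {F : Type} [NormedAddCommGroup F] [NormedSpace ℝ F] {ε : ℝ} (hε : 0 < ε)
    (f : (Fin N → ℂ) → F) (x : Fin N → ℂ) : F :=
  ∫ t, radialBump N hε (x - t) • f t

variable {F : Type} [NormedAddCommGroup F] [NormedSpace ℝ F]

theorem mollify_eq (f : (Fin N → ℂ) → F) :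
    mollify hε f = convolution f (radialBump N hε) (ContinuousLinearMap.lsmul ℝ ℝ).flip volume := by
  ext1 x
  simp [mollify, convolution]

theorem contDiff_mollify [CompleteSpace F] {f : (Fin N → ℂ) → F} (hf : LocallyIntegrable f) :
    ContDiff ℝ ∞ (mollify hε f) := by
  rw [mollify_eq]
  exact (hasCompactSupport_radialBump hε).contDiff_convolution_right (n := ⊤) _ hf
    (contDiff_radialBump hε)

/-- The derivative falls on the bump, so local integrability of `f` is enough. -/
theorem fderiv_mollify [CompleteSpace F] {f : (Fin N → ℂ) → F} (hf : LocallyIntegrable f)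
    (x : Fin N → ℂ) : fderiv ℝ (mollify hε f) x =
      ∫ t, (fderiv ℝ (radialBump N hε) (x - t)).smulRight (f t) := by
  rw [mollify_eq]
  refine ((hasCompactSupport_radialBump hε).hasFDerivAt_convolution_right
    (ContinuousLinearMap.lsmul ℝ ℝ).flip hf
    ((contDiff_radialBump hε).of_le (by simp)) x).fderiv.trans ?_
  rw [convolution]
  congr 1

/-- The bump is even, so convolution with it is an average of translates; this brings the homotopy
formula to bear on mollification. -/
theorem mollify_eq_translAverage (f : (Fin N → ℂ) → F) (x : Fin N → ℂ) :
    mollify hε f x = ∫ u, f (x + u) ∂bumpMeasure N hε := by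
  rw [integral_bumpMeasure, mollify, ← integral_add_left_eq_self _ x]
  refine integral_congr_ae (Filter.Eventually.of_forall fun u => ?_)
  have := radialBump_smul (N := N) hε (c := -1) (by simp) u
  simp only [neg_one_smul] at this
  simp only [sub_add_cancel_left, this]

/-- Dominated convergence with the derivative on the bump; no convergence of derivatives of `f k` is
needed. -/
theorem tendsto_fderiv_mollify [CompleteSpace F] {f : ℕ → (Fin N → ℂ) → F}
    {f₀ : (Fin N → ℂ) → F} {g : (Fin N → ℂ) → ℝ} (hf : ∀ k, LocallyIntegrable (f k)) (hf₀ : LocallyIntegrable f₀)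
    (hg : LocallyIntegrable g) (hfg : ∀ k, ∀ t, ‖f k t‖ ≤ g t)
    (hlim : ∀ᵐ t, Filter.Tendsto (fun k => f k t) Filter.atTop (𝓝 (f₀ t))) (x : Fin N → ℂ) :
    Filter.Tendsto (fun k => fderiv ℝ (mollify hε (f k)) x) Filter.atTop
      (𝓝 (fderiv ℝ (mollify hε f₀) x)) := by
  rw [fderiv_mollify hε hf₀]
  simp only [fun k => fderiv_mollify hε (hf k) x]
  have hD : Continuous fun t => fderiv ℝ (radialBump N hε) (x - t) :=
    ((contDiff_radialBump hε).continuous_fderiv (by simp)).comp (continuous_const.sub continuous_id)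
  have hDs : HasCompactSupport fun t => fderiv ℝ (radialBump N hε) (x - t) :=
    ((hasCompactSupport_radialBump hε).fderiv ℝ).comp_homeomorph (Homeomorph.subLeft x)
  refine tendsto_integral_of_dominated_convergence
    (fun t => ‖fderiv ℝ (radialBump N hε) (x - t)‖ • g t) (fun k => ?_) ?_ (fun k => ?_) ?_
  · exact (ContinuousLinearMap.smulRightL ℝ (Fin N → ℂ) F).aestronglyMeasurable_comp₂
      hD.aestronglyMeasurable (hf k).aestronglyMeasurable
  · exact hg.integrable_smul_left_of_hasCompactSupport hD.norm hDs.norm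
  · refine Filter.Eventually.of_forall fun t => ?_
    rw [ContinuousLinearMap.norm_smulRight_apply]
    exact mul_le_mul_of_nonneg_left (hfg k t) (norm_nonneg _)
  · filter_upwards [hlim] with t ht
    exact ((ContinuousLinearMap.smulRightL ℝ (Fin N → ℂ) F
      (fderiv ℝ (radialBump N hε) (x - t))).continuous.tendsto _).comp ht

theorem tendsto_mollify_zero {f : ℕ → (Fin N → ℂ) → F}
    {g : (Fin N → ℂ) → ℝ} (hf : ∀ k, LocallyIntegrable (f k))
    (hg : LocallyIntegrable g) (hfg : ∀ k, ∀ t, ‖f k t‖ ≤ g t)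
    (hlim : ∀ᵐ t, Filter.Tendsto (fun k => f k t) Filter.atTop (𝓝 0)) (x : Fin N → ℂ) :
    Filter.Tendsto (fun k => mollify hε (f k) x) Filter.atTop (𝓝 0) := by
  have hD : Continuous fun t => radialBump N hε (x - t) :=
    (contDiff_radialBump hε).continuous.comp (continuous_const.sub continuous_id)
  have hDs : HasCompactSupport fun t => radialBump N hε (x - t) :=
    (hasCompactSupport_radialBump hε).comp_homeomorph (Homeomorph.subLeft x)
  rw [← integral_zero (Fin N → ℂ) F]
  refine tendsto_integral_of_dominated_convergence
    (fun t => ‖radialBump N hε (x - t)‖ • g t) (fun k => ?_) ?_ (fun k => ?_) ?_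
  · exact hD.aestronglyMeasurable.smul (hf k).aestronglyMeasurable
  · exact hg.integrable_smul_left_of_hasCompactSupport hD.norm hDs.norm
  · refine Filter.Eventually.of_forall fun t => ?_
    rw [norm_smul]
    exact mul_le_mul_of_nonneg_left (hfg k t) (norm_nonneg _)
  · filter_upwards [hlim] with t ht
    simpa using ht.const_smul (radialBump N hε (x - t))

end mollify

/-! ### Closed forms with a weak singularity at the origin -/

section singular
open MeasureTheory
variable {N r : ℕ}

/-- A smooth function on `ℂᴺ`, equal to `0` where `‖t‖ ≤ 1 / l` and to `1` where `‖t‖ ≥ 2 / l`. -/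
def cutoff (N : ℕ) (l : ℝ) (t : Fin N → ℂ) : ℝ :=
  1 - (⟨1, 2, one_pos, one_lt_two⟩ : ContDiffBump (0 : Fin N → ℂ)) (l • t)

theorem contDiff_cutoff (l : ℝ) : ContDiff ℝ ∞ (cutoff N l) :=
  contDiff_const.sub ((ContDiffBump.contDiff (n := ⊤) _).comp (contDiff_id.const_smul l))

theorem cutoff_eq_zero {l : ℝ} (hl : 0 < l) {t : Fin N → ℂ} (ht : l * ‖t‖ ≤ 1) :
    cutoff N l t = 0 := by
  rw [cutoff, ContDiffBump.one_of_mem_closedBall, sub_self]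
  rwa [mem_closedBall_zero_iff, norm_smul, Real.norm_of_nonneg hl.le]

theorem cutoff_eq_one {l : ℝ} (hl : 0 < l) {t : Fin N → ℂ} (ht : 2 ≤ l * ‖t‖) :
    cutoff N l t = 1 := by
  rw [cutoff, ContDiffBump.zero_of_le_dist, sub_zero]
  rwa [dist_zero_right, norm_smul, Real.norm_of_nonneg hl.le]

theorem abs_cutoff_le (l : ℝ) (t : Fin N → ℂ) : |cutoff N l t| ≤ 1 := by
  have h1 := ContDiffBump.nonneg (⟨1, 2, one_pos, one_lt_two⟩ : ContDiffBump (0 : Fin N → ℂ))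
    (x := l • t)
  have h2 := ContDiffBump.le_one (⟨1, 2, one_pos, one_lt_two⟩ : ContDiffBump (0 : Fin N → ℂ))
    (x := l • t)
  rw [cutoff, abs_le]
  constructor <;> linarith

theorem fderiv_cutoff_eq_zero {l : ℝ} (hl : 0 < l) {t : Fin N → ℂ} (ht : 2 < l * ‖t‖) :
    fderiv ℝ (cutoff N l) t = 0 := by
  have h : cutoff N l =ᶠ[𝓝 t] fun _ => 1 := by
    have hc : Continuous fun t : Fin N → ℂ => l * ‖t‖ := by fun_prop
    filter_upwards [(isOpen_lt continuous_const hc).mem_nhds ht] with s hs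
      using cutoff_eq_one hl (le_of_lt hs)
  rw [h.fderiv_eq, fderiv_fun_const]
  rfl

/-- By scaling, the derivative is at most a constant times `l`, and it vanishes where `l * ‖t‖ > 2`;
so `l` can be traded for `2 / ‖t‖`. Uniformity in `l` is needed for dominated convergence. -/
theorem exists_fderiv_cutoff_le : ∃ B, 0 ≤ B ∧ ∀ l : ℝ, 0 < l → ∀ t : Fin N → ℂ, t ≠ 0 →
    ‖fderiv ℝ (cutoff N l) t‖ ≤ B * ‖t‖⁻¹ := by
  obtain ⟨B, hB⟩ := (isCompact_closedBall (0 : Fin N → ℂ) 2).exists_bound_of_continuousOn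
    ((contDiff_cutoff (N := N) 1).continuous_fderiv (by simp)).continuousOn
  have hB0 : 0 ≤ B := (norm_nonneg _).trans (hB 0 (by simp))
  refine ⟨2 * B, by positivity, fun l hl t ht => ?_⟩
  have htn : 0 < ‖t‖ := norm_pos_iff.2 ht
  by_cases h : 2 < l * ‖t‖
  · rw [fderiv_cutoff_eq_zero hl h, norm_zero]
    positivity
  · push Not at h
    have h1 : cutoff N l = fun t => cutoff N 1 (l • t) := by
      ext1 t
      simp [cutoff]
    have h2 : fderiv ℝ (cutoff N l) t = l • fderiv ℝ (cutoff N 1) (l • t) := by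
      have h3 : HasFDerivAt (fun t => cutoff N 1 (l • t)) _ t :=
        ((contDiff_cutoff (N := N) 1).differentiable (by simp) (l • t)).hasFDerivAt.comp t
          ((hasFDerivAt_id t).const_smul l)
      rw [h1, h3.fderiv]
      ext u
      simp
    have h3 := hB (l • t) (by
      rwa [mem_closedBall_zero_iff, norm_smul, Real.norm_of_nonneg hl.le])
    rw [h2, norm_smul, Real.norm_of_nonneg hl.le]
    calc l * ‖fderiv ℝ (cutoff N 1) (l • t)‖ ≤ l * B := by gcongr
      _ ≤ 2 * B * ‖t‖⁻¹ := by
        rw [← div_eq_mul_inv, le_div_iff₀ htn]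
        nlinarith

theorem norm_wedgeOne_le (θ : (Fin N → ℂ) →L[ℝ] ℂ) (α : (Fin N → ℂ) [⋀^Fin r]→L[ℝ] ℂ) :
    ‖wedgeOne θ α‖ ≤ (r + 1) * (‖θ‖ * ‖α‖) := by
  refine (norm_alternatizeUncurryFin_le _).trans ?_
  refine mul_le_mul_of_nonneg_left ?_ (by positivity)
  refine ContinuousLinearMap.opNorm_le_bound _ (by positivity) fun v => ?_
  rw [ContinuousLinearMap.smulRight_apply]
  have h1 : ‖θ v • α‖ = ‖θ v‖ * ‖α‖ := norm_smul _ _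
  rw [h1]
  nlinarith [θ.le_opNorm v, norm_nonneg α]

theorem exists_norm_wedgeOne_le (N r : ℕ) : ∃ K, 0 ≤ K ∧ ∀ (A : (Fin N → ℂ) →L[ℝ] ℂ)
    (α : (Fin N → ℂ) [⋀^Fin r]→L[ℝ] ℂ), ‖wedgeOne (antilinearPart A) α‖ ≤ K * (‖A‖ * ‖α‖) := by
  refine ⟨(r + 1) * ‖antilinearPartL N ℂ‖, by positivity, fun A α => ?_⟩
  have h1 := norm_wedgeOne_le (antilinearPart A) α
  have h2 : ‖antilinearPart A‖ ≤ ‖antilinearPartL N ℂ‖ * ‖A‖ := by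
    rw [← antilinearPartL_apply]
    exact ContinuousLinearMap.le_opNorm _ _
  refine h1.trans ?_
  rw [mul_assoc, ← mul_assoc ‖antilinearPartL N ℂ‖]
  refine mul_le_mul_of_nonneg_left ?_ (by positivity)
  exact mul_le_mul_of_nonneg_right h2 (norm_nonneg _)

variable {f : Form N (r + 1)}

/-- `cutoff • f`. -/
def cutForm (l : ℝ) (f : Form N r) : Form N r := fun t => (cutoff N l t : ℂ) • f t

theorem cutForm_eventuallyEq_zero {l : ℝ} (hl : 0 < l) (f : Form N r) :
    cutForm l f =ᶠ[𝓝 0] fun _ => 0 := by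
  have hc : Continuous fun t : Fin N → ℂ => l * ‖t‖ := by fun_prop
  have h0 : (0 : Fin N → ℂ) ∈ {t | l * ‖t‖ < 1} := by simp
  filter_upwards [(isOpen_lt hc continuous_const).mem_nhds h0] with s hs
  rw [cutForm, cutoff_eq_zero hl (le_of_lt hs), Complex.ofReal_zero, zero_smul_form]

theorem cutForm_mem {f : Form N r} (hf : ∀ t ≠ 0, ContDiffAt ℝ ∞ f t)
    (hanti : ∀ t, IsAntilinear (f t)) {l : ℝ} (hl : 0 < l) : cutForm l f ∈ smoothForms N r := by
  refine ⟨contDiff_iff_contDiffAt.2 fun t => ?_, fun t => (hanti t).smul _⟩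
  rcases eq_or_ne t 0 with rfl | ht
  · exact contDiffAt_const.congr_of_eventuallyEq (cutForm_eventuallyEq_zero hl f)
  · exact (Complex.ofRealCLM.contDiff.comp (contDiff_cutoff l)).contDiffAt.smul (hf t ht)

theorem dbar_cutForm_zero {l : ℝ} (hl : 0 < l) (f : Form N r) : dbar (cutForm l f) 0 = 0 := by
  rw [dbar_congr (cutForm_eventuallyEq_zero hl f), dbar_eq_dbarL, fderiv_fun_const]
  exact _root_.map_zero _

theorem dbar_cutForm {f : Form N r} (hf : ∀ t ≠ 0, ContDiffAt ℝ ∞ f t)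
    (hcl : ∀ t ≠ 0, dbar f t = 0) (l : ℝ) {t : Fin N → ℂ} (ht : t ≠ 0) :
    dbar (cutForm l f) t =
      wedgeOne (antilinearPart (Complex.ofRealCLM.comp (fderiv ℝ (cutoff N l) t))) (f t) := by
  have h1 : HasFDerivAt (fun t => (cutoff N l t : ℂ))
      (Complex.ofRealCLM.comp (fderiv ℝ (cutoff N l) t)) t :=
    Complex.ofRealCLM.hasFDerivAt.comp t
      ((contDiff_cutoff l).differentiable (by simp) t).hasFDerivAt
  have h2 := dbar_fun_smul (ψ := f) h1.differentiableAt ((hf t ht).differentiableAt (by simp))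
  rw [h1.fderiv, hcl t ht, smul_zero_form, add_zero] at h2
  exact h2

theorem dbar_cutForm_eq_zero {f : Form N r} (hf : ∀ t ≠ 0, ContDiffAt ℝ ∞ f t)
    (hcl : ∀ t ≠ 0, dbar f t = 0) {l : ℝ} (hl : 0 < l) {t : Fin N → ℂ} (ht : 2 < l * ‖t‖) :
    dbar (cutForm l f) t = 0 := by
  have ht0 : t ≠ 0 := by
    rintro rfl
    norm_num at ht
  rw [dbar_cutForm hf hcl l ht0, fderiv_cutoff_eq_zero hl ht]
  ext v
  simp [wedgeOne, alternatizeUncurryFin_apply, antilinearPart_apply]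

/-- Only the derivative of the cutoff contributes, at the cost of one factor `‖t‖⁻¹`. This loss is
the reason for the condition `α + 1 < 2 * N` on the order of the singularity. -/
theorem exists_norm_dbar_cutForm_le (N r : ℕ) : ∃ K, 0 ≤ K ∧ ∀ f : Form N r,
    (∀ t ≠ 0, ContDiffAt ℝ ∞ f t) → (∀ t ≠ 0, dbar f t = 0) → ∀ l : ℝ, 0 < l → ∀ t,
    ‖dbar (cutForm l f) t‖ ≤ K * (‖f t‖ * ‖t‖⁻¹) := by
  obtain ⟨B, hB0, hB⟩ := exists_fderiv_cutoff_le (N := N)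
  obtain ⟨K, hK0, hK⟩ := exists_norm_wedgeOne_le N r
  refine ⟨K * B, by positivity, fun f hf hcl l hl t => ?_⟩
  rcases eq_or_ne t 0 with rfl | ht
  · rw [dbar_cutForm_zero hl, norm_zero]
    positivity
  · rw [dbar_cutForm hf hcl l ht]
    have h1 : ‖Complex.ofRealCLM.comp (fderiv ℝ (cutoff N l) t)‖ ≤ B * ‖t‖⁻¹ := by
      refine (ContinuousLinearMap.opNorm_comp_le _ _).trans ?_
      rw [Complex.ofRealCLM_norm, one_mul]
      exact hB l hl t ht
    calc _ ≤ _ := hK _ _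
      _ ≤ K * (B * ‖t‖⁻¹ * ‖f t‖) := by gcongr
      _ = _ := by ring

theorem aestronglyMeasurable_of_contDiffAt (hN : 1 ≤ N) {f : Form N r}
    (hf : ∀ t ≠ 0, ContDiffAt ℝ ∞ f t) : AEStronglyMeasurable f := by
  have : Nonempty (Fin N) := ⟨⟨0, hN⟩⟩
  have h1 : ContinuousOn f {0}ᶜ := fun t ht => (hf t ht).continuousAt.continuousWithinAt
  have h2 := h1.aestronglyMeasurable (μ := volume) (measurableSet_singleton 0).compl
  rwa [Measure.restrict_eq_self_of_ae_mem] at h2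
  exact Measure.ae_ne volume 0

/-- The threshold 2N is the real dimension of ℂᴺ. -/
theorem locallyIntegrable_of_bound (hN : 1 ≤ N) {F : Type} [NormedAddCommGroup F]
    {f : (Fin N → ℂ) → F} {C α : ℝ} (hα : α < 2 * N) (hm : AEStronglyMeasurable f)
    (hb : ∀ t ≠ 0, ‖f t‖ ≤ C * ‖t‖ ^ (-α)) : LocallyIntegrable f := by
  have : Nonempty (Fin N) := ⟨⟨0, hN⟩⟩
  have hfr : Module.finrank ℝ (Fin N → ℂ) = 2 * N := by
    rw [Module.finrank_pi_fintype]
    simp [mul_comm]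
  refine locallyIntegrable_of_norm_le_rpow (by rw [hfr]; omega) (C := C) (α := α)
    (by rw [hfr]; exact_mod_cast hα) ?_ hm
  filter_upwards [Measure.ae_ne volume 0] with t ht using hb t ht

/-- A closed form with a weak singularity at the origin is exact on every annulus. -/
theorem exists_primitive_of_singular (hN : 1 ≤ N) (hf : ∀ t ≠ 0, ContDiffAt ℝ ∞ f t)
    (hanti : ∀ t, IsAntilinear (f t)) (hcl : ∀ t ≠ 0, dbar f t = 0) {C α : ℝ}
    (hα : α + 1 < 2 * N) (hb : ∀ t ≠ 0, ‖f t‖ ≤ C * ‖t‖ ^ (-α)) {ε R : ℝ} (hε : 0 < ε)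
    (hR : 0 < R) :
    ∃ ψ ∈ smoothForms N r, ∀ t, ε < ‖t‖ → ‖t‖ < R → dbar ψ t = f t := by
  have hε4 : 0 < ε / 4 := by positivity
  have hm := aestronglyMeasurable_of_contDiffAt hN hf
  have hint : LocallyIntegrable f := locallyIntegrable_of_bound hN (by linarith) hm hb
  have hintn : LocallyIntegrable fun t => ‖f t‖ :=
    locallyIntegrable_of_bound hN (C := C) (α := α) (by linarith) hm.norm fun t ht => by
      rw [norm_norm]
      exact hb t ht
  have hint' : LocallyIntegrable fun t => ‖f t‖ * ‖t‖⁻¹ := by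
    refine locallyIntegrable_of_bound hN hα (C := C)
      (hm.norm.mul (by fun_prop : Measurable fun t : Fin N → ℂ => ‖t‖⁻¹).aestronglyMeasurable)
      fun t ht => ?_
    have htn : 0 < ‖t‖ := norm_pos_iff.2 ht
    rw [norm_mul, norm_norm, norm_inv, norm_norm, neg_add, Real.rpow_add htn, Real.rpow_neg_one,
      ← mul_assoc]
    gcongr
    exact hb t ht
  -- Smooth across the origin; it remains to see that it is closed, and that away from the origin it
  -- differs from a multiple of `f` by an exact form.
  set G := mollify hε4 f with hG
  have hGc : ContDiff ℝ ∞ G := contDiff_mollify hε4 hint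
  have hGa : G ∈ smoothForms N (r + 1) := by
    refine ⟨hGc, fun x => isAntilinear_integral ?_ fun t v i c => ?_⟩
    · exact hint.integrable_smul_left_of_hasCompactSupport
        ((contDiff_radialBump hε4).continuous.comp (continuous_const.sub continuous_id))
        ((hasCompactSupport_radialBump hε4).comp_homeomorph (Homeomorph.subLeft x))
    · simp only [ContinuousAlternatingMap.smul_apply, hanti t v i c, Complex.real_smul]
      ring
  have hsm : ∀ l : ℝ, 0 < l → cutForm l f ∈ smoothForms N (r + 1) := fun l hl =>
    cutForm_mem hf hanti hl
  have hK := isCompact_closedBall (0 : Fin N → ℂ) (ε / 4)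
  have hν := bumpMeasure_compl (N := N) hε4
  have hmol : ∀ {s : ℕ} (φ : Form N s), mollify hε4 φ = translAverage (bumpMeasure N hε4) φ :=
    fun φ => funext fun x => mollify_eq_translAverage hε4 φ x
  have hkpos : ∀ k : ℕ, (0 : ℝ) < k + 1 := fun k => by positivity
  have hlarge : ∀ t : Fin N → ℂ, t ≠ 0 → ∀ᶠ k : ℕ in Filter.atTop, 2 < ((k : ℝ) + 1) * ‖t‖ := by
    intro t ht
    have := (Filter.tendsto_atTop_add_const_right _ (1 : ℝ)
      tendsto_natCast_atTop_atTop).atTop_mul_const (norm_pos_iff.2 ht)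
    exact this.eventually_gt_atTop 2
  have : Nonempty (Fin N) := ⟨⟨0, hN⟩⟩
  -- The singularity carries no residue. The smooth forms `cutForm (k + 1) f` tend to `f`, and their
  -- ∂̄ tends to 0 almost everywhere under the integrable bound `K * (‖f t‖ * ‖t‖⁻¹)`. Mollification
  -- commutes with ∂̄ on them, and both sides pass to the limit.
  have hGcl : ∀ x, dbar G x = 0 := by
    intro x
    have h1 : Filter.Tendsto (fun k : ℕ => fderiv ℝ (mollify hε4 (cutForm ((k : ℝ) + 1) f)) x)
        Filter.atTop (𝓝 (fderiv ℝ G x)) := by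
      refine tendsto_fderiv_mollify hε4
        (fun k => (hsm _ (hkpos k)).1.continuous.locallyIntegrable) hint
        (g := fun t => ‖f t‖) hintn (fun k t => ?_) ?_ x
      · rw [cutForm, norm_smul, Complex.norm_real]
        exact mul_le_of_le_one_left (norm_nonneg _) (abs_cutoff_le _ _)
      · filter_upwards [Measure.ae_ne volume 0] with t ht
        refine tendsto_const_nhds.congr' ?_
        filter_upwards [hlarge t ht] with k hk
        rw [cutForm, cutoff_eq_one (hkpos k) hk.le]
        ext v
        simp
    have h2 := ((dbarL N (r + 1)).continuous.tendsto _).comp h1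
    rw [← dbar_eq_dbarL] at h2
    obtain ⟨K, hK0, hKb⟩ := exists_norm_dbar_cutForm_le N (r + 1)
    have h3 := tendsto_mollify_zero hε4 (f := fun k : ℕ => dbar (cutForm ((k : ℝ) + 1) f))
      (fun k => (dbar_mem (hsm _ (hkpos k))).1.continuous.locallyIntegrable)
      (hint'.smul K) (fun k t => hKb f hf hcl _ (hkpos k) t) (by
        filter_upwards [Measure.ae_ne volume 0] with t ht
        refine tendsto_const_nhds.congr' ?_
        filter_upwards [hlarge t ht] with k hk
        rw [dbar_cutForm_eq_zero hf hcl (hkpos k) hk]) x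
    refine tendsto_nhds_unique h2 (h3.congr fun k => ?_)
    rw [Function.comp_apply, ← dbar_eq_dbarL, hmol, hmol,
      dbar_translAverage hK hν (hsm _ (hkpos k)).1]
  obtain ⟨G', hG', hGG'⟩ := dolbeault_polydisc hR hGa hGcl
  set ν := bumpMeasure N hε4 with hνdef
  set m := ν.real Set.univ with hmdef
  have hmpos : 0 < m := bumpMeasure_real_pos hε4
  have hl : 0 < 4 / ε := by positivity
  -- A smooth form that equals `f` where `‖t‖ ≥ ε / 2`, hence at every translate by at most ε/4 of a
  -- point with `‖t‖ > ε`.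
  obtain ⟨f₁, hf₁⟩ : ∃ f₁, f₁ = cutForm (4 / ε) f := ⟨_, rfl⟩
  have hf₁m : f₁ ∈ smoothForms N (r + 1) := hf₁ ▸ hsm _ hl
  have hT := translHomotopy_mem hK hν hf₁m
  -- On the annulus the homotopy formula for `f₁` says that ∂̄ of `translHomotopy ν f₁` is G - m f,
  -- and G is ∂̄G' there.
  refine ⟨((m⁻¹ : ℝ) : ℂ) • (G' - translHomotopy ν f₁),
    Submodule.smul_mem _ _ (Submodule.sub_mem _ hG' hT), fun t ht1 ht2 => ?_⟩
  have hGd := hG'.1.differentiable (by simp) t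
  have hTd := hT.1.differentiable (by simp) t
  have h1 := dbar_translHomotopy hK hν (bumpMeasure_rotation hε4) hf₁m t
  have hfar : ∀ u ∈ Metric.closedBall (0 : Fin N → ℂ) (ε / 4), ∀ s ∈ Set.Icc (0 : ℝ) 1,
      2 < 4 / ε * ‖t + s • u‖ := by
    intro u hu s hs
    rw [mem_closedBall_zero_iff] at hu
    have h2 : ‖t‖ ≤ ‖t + s • u‖ + ‖s • u‖ := by
      simpa using norm_sub_le (t + s • u) (s • u)
    have h3 : ‖s • u‖ ≤ ε / 4 := by
      rw [norm_smul, Real.norm_of_nonneg hs.1]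
      exact (mul_le_of_le_one_left (norm_nonneg _) hs.2).trans hu
    rw [div_mul_eq_mul_div, lt_div_iff₀ hε]
    linarith
  have h2 : translHomotopy ν (dbar f₁) t = 0 := by
    rw [← translHomotopy_zero (ν := ν) t]
    refine translHomotopy_congr hν ?_
    intro s hs u hu
    rw [hf₁]
    exact dbar_cutForm_eq_zero hf hcl hl (hfar u hu s hs)
  have h3 : translAverage ν f₁ t = G t := by
    rw [hG, hmol]
    refine translAverage_congr hν fun u hu => ?_
    have h4 := hfar u hu 1 (by simp)
    rw [one_smul] at h4
    rw [hf₁, cutForm, cutoff_eq_one hl h4.le]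
    ext v
    simp
  have h5 : f₁ t = f t := by
    have h4 := hfar 0 (by simpa using hε4.le) 0 (by simp)
    rw [smul_zero, add_zero] at h4
    rw [hf₁, cutForm, cutoff_eq_one hl h4.le]
    ext v
    simp
  rw [h2, add_zero, h3, h5] at h1
  rw [dbar_const_smul (hGd.sub hTd), dbar_sub hGd hTd,
    hGG' t fun j => (norm_le_pi_norm t j).trans_lt ht2, h1]
  ext v
  have h6 : (m : ℂ) ≠ 0 := by exact_mod_cast hmpos.ne'
  rw [← hmdef]
  simp only [ContinuousAlternatingMap.smul_apply, ContinuousAlternatingMap.sub_apply,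
    Complex.real_smul, smul_eq_mul, Complex.ofReal_inv]
  rw [sub_sub_cancel, inv_mul_cancel_left₀ h6]

end singular

/-! ### Smoothness and type of pullbacks -/

section pullbackSmooth
variable {n m r : ℕ} {X : Type} [NormedAddCommGroup X] [NormedSpace ℝ X]

/-- Alternatization divided by r! is a continuous linear left inverse of the inclusion into
multilinear maps, so smoothness can be tested there. -/
theorem contDiffAt_of_multilinear {f : X → (Fin n → ℂ) [⋀^Fin r]→L[ℝ] ℂ} {x₀ : X}
    (h : ContDiffAt ℝ ∞ (fun x => (f x).toContinuousMultilinearMap) x₀) : ContDiffAt ℝ ∞ f x₀ := by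
  have h1 : f = fun x => ((r.factorial : ℂ)⁻¹) • altCLM n r (f x).toContinuousMultilinearMap := by
    ext x v
    have : ∀ σ : Equiv.Perm (Fin r), f x (v ∘ σ) = Equiv.Perm.sign σ • f x v := fun σ =>
      (f x).toAlternatingMap.map_perm v σ
    have h2 : altCLM n r (f x).toContinuousMultilinearMap v =
        ∑ σ : Equiv.Perm (Fin r), (Equiv.Perm.sign σ : ℤ) • f x (v ∘ σ) := by
      simp only [altCLM, liftCLM_apply, _root_.sum_apply, _root_.smul_apply]
      rfl
    have h3 : ∀ σ : Equiv.Perm (Fin r), (Equiv.Perm.sign σ : ℤ) • f x (v ∘ σ) = f x v :=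
      fun σ => by
        rw [this, Units.smul_def, smul_smul, Int.units_coe_mul_self, one_smul]
    rw [ContinuousAlternatingMap.smul_apply, h2, Finset.sum_congr rfl fun σ _ => h3 σ]
    simp [Finset.card_univ, Fintype.card_perm, Nat.factorial_ne_zero]
  rw [h1]
  exact ContDiffAt.smul (contDiffAt_const : ContDiffAt ℝ ∞ (fun _ : X => (r.factorial : ℂ)⁻¹) x₀)
    ((altCLM n r).contDiff.contDiffAt.comp x₀ h)

theorem contDiffAt_compContinuousLinearMap {ψ : X → (Fin m → ℂ) [⋀^Fin r]→L[ℝ] ℂ}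
    {A : X → (Fin n → ℂ) →L[ℝ] (Fin m → ℂ)} {x₀ : X} (hψ : ContDiffAt ℝ ∞ ψ x₀)
    (hA : ContDiffAt ℝ ∞ A x₀) :
    ContDiffAt ℝ ∞ (fun x => (ψ x).compContinuousLinearMap (A x)) x₀ := by
  apply contDiffAt_of_multilinear
  have h2 : ContDiff ℝ ∞ fun B : Fin r → ((Fin n → ℂ) →L[ℝ] (Fin m → ℂ)) =>
      ContinuousMultilinearMap.compContinuousLinearMapContinuousMultilinear ℝ
      (fun _ : Fin r => Fin n → ℂ) (fun _ => Fin m → ℂ) ℂ B :=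
    ContinuousMultilinearMap.contDiff _
  have h3 : ContDiff ℝ ∞ fun α : (Fin m → ℂ) [⋀^Fin r]→L[ℝ] ℂ => α.toContinuousMultilinearMap :=
    (toContinuousMultilinearMapLI (𝕜 := ℝ) (E := Fin m → ℂ) (F := ℂ) (ι := Fin r)).contDiff
  exact (h2.contDiffAt.comp x₀ (contDiffAt_pi.2 fun _ => hA)).clm_apply
    (h3.contDiffAt.comp x₀ hψ)

theorem IsAntilinear.comp {α : (Fin m → ℂ) [⋀^Fin r]→L[ℝ] ℂ} (hα : IsAntilinear α)
    (A : (Fin n → ℂ) →L[ℂ] (Fin m → ℂ)) :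
    IsAntilinear (α.compContinuousLinearMap (A.restrictScalars ℝ)) := by
  intro v i c
  have : (fun j => A (Function.update v i (c • v i) j)) =
      Function.update (fun j => A (v j)) i (c • A (v i)) := by
    ext1 j
    rcases eq_or_ne j i with rfl | h <;> simp [*]
  have h := hα (fun j => A (v j)) i c
  rw [← this] at h
  exact h

theorem contDiffAt_pullback {ψ : Form m r} (hψ : ContDiff ℝ ∞ ψ) {G : (Fin n → ℂ) → (Fin m → ℂ)}
    {p : Fin n → ℂ} (hG : ContDiffAt ℂ ∞ G p) : ContDiffAt ℝ ∞ (pullback G ψ) p :=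
  contDiffAt_compContinuousLinearMap (hψ.contDiffAt.comp p (hG.restrict_scalars ℝ))
    ((hG.restrict_scalars ℝ).fderiv_right (by simp))

theorem isAntilinear_pullback {ψ : Form m r} {G : (Fin n → ℂ) → (Fin m → ℂ)}
    {p : Fin n → ℂ} (hψ : IsAntilinear (ψ (G p))) (hG : DifferentiableAt ℂ G p) :
    IsAntilinear (pullback G ψ p) := by
  rw [pullback, hG.fderiv_restrictScalars ℝ]
  exact hψ.comp _

end pullbackSmooth

/-! ### Twisted forms on projective space as homogeneous forms on ℂⁿ⁺¹ ∖ 0 -/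

section homogeneous
variable {n r : ℕ}

/-- Affine coordinates in the chart `l` of the point with homogeneous coordinates `t`. -/
def affineCoord (l : Fin (n + 1)) (t : Fin (n + 1) → ℂ) : Fin n → ℂ := fun j =>
  t (l.succAbove j) / t l

theorem chartChange_eq (l m : Fin (n + 1)) (w : Fin n → ℂ) :
    chartChange l m w = affineCoord m (homogCoord l w) := rfl

theorem homogCoord_self (l : Fin (n + 1)) (w : Fin n → ℂ) : homogCoord l w l = 1 := by
  simp [homogCoord]

theorem homogCoord_succAbove (l : Fin (n + 1)) (w : Fin n → ℂ) (j : Fin n) :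
    homogCoord l w (l.succAbove j) = w j := by
  simp [homogCoord]

theorem affineCoord_homogCoord (l : Fin (n + 1)) (w : Fin n → ℂ) :
    affineCoord l (homogCoord l w) = w := by
  ext j
  simp [affineCoord, homogCoord_self, homogCoord_succAbove]

theorem affineCoord_smul (l : Fin (n + 1)) {c : ℂ} (hc : c ≠ 0) (t : Fin (n + 1) → ℂ) :
    affineCoord l (c • t) = affineCoord l t := by
  ext j
  simp [affineCoord, mul_div_mul_left _ _ hc]

theorem homogCoord_affineCoord {l : Fin (n + 1)} {t : Fin (n + 1) → ℂ} (ht : t l ≠ 0) :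
    homogCoord l (affineCoord l t) = (t l)⁻¹ • t := by
  ext m
  rcases Fin.eq_self_or_eq_succAbove l m with rfl | ⟨k, rfl⟩
  · simp [homogCoord_self, ht]
  · simp [homogCoord_succAbove, affineCoord, div_eq_inv_mul]

theorem contDiffAt_affineCoord {l : Fin (n + 1)} {t : Fin (n + 1) → ℂ} (ht : t l ≠ 0) :
    ContDiffAt ℂ ∞ (affineCoord l) t :=
  contDiffAt_pi.2 fun _ => ((contDiff_apply ℂ ℂ _).contDiffAt).div
    (contDiff_apply ℂ ℂ l).contDiffAt ht

theorem contDiff_homogCoord (l : Fin (n + 1)) :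
    ContDiff ℂ ∞ (homogCoord l : (Fin n → ℂ) → _) := by
  refine contDiff_pi.2 fun m => ?_
  rcases Fin.eq_self_or_eq_succAbove l m with rfl | ⟨k, rfl⟩
  · simpa [homogCoord] using contDiff_const
  · simpa [homogCoord] using contDiff_apply ℂ ℂ k

theorem eventually_coord_ne_zero {l : Fin (n + 1)} {t : Fin (n + 1) → ℂ} (ht : t l ≠ 0) :
    ∀ᶠ s in 𝓝 t, s l ≠ 0 :=
  (continuous_apply l).continuousAt.eventually_ne ht

theorem pullback_comp {m k : ℕ} {G : (Fin n → ℂ) → (Fin m → ℂ)} {H : (Fin k → ℂ) → (Fin n → ℂ)}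
    {ψ : Form m r} {p : Fin k → ℂ} (hG : DifferentiableAt ℝ G (H p)) (hH : DifferentiableAt ℝ H p) :
    pullback (G ∘ H) ψ p = pullback H (pullback G ψ) p := by
  rw [pullback, fderiv_comp p hG hH]
  rfl

theorem pullback_congr {m : ℕ} {G H : (Fin n → ℂ) → (Fin m → ℂ)} {ψ : Form m r} {p : Fin n → ℂ}
    (h : G =ᶠ[𝓝 p] H) : pullback G ψ p = pullback H ψ p := by
  rw [pullback, pullback, h.fderiv_eq, h.self_of_nhds]

/-- The expression in the chart `l` of the homogeneous form of degree `d` on `ℂⁿ⁺¹ ∖ 0` attached to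
a form on projective space with values in `O(d)`. -/
def chartForm (d : ℤ) (η : Fin (n + 1) → Form n r) (l : Fin (n + 1)) : Form (n + 1) r := fun t =>
  t l ^ d • pullback (affineCoord l) (η l) t

/-- The affine coordinates in chart `m` factor through those in chart `l`, and the transition factor
`(t m / t l) ^ (b - a)` turns one power into the other. -/
theorem chartForm_eq {a b : ℤ} {η : Fin (n + 1) → Form n r} (hη : η ∈ DG n a b r)
    {l m : Fin (n + 1)} {t : Fin (n + 1) → ℂ} (hl : t l ≠ 0) (hm : t m ≠ 0) :
    chartForm (b - a) η l t = chartForm (b - a) η m t := by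
  have hh : homogCoord l (affineCoord l t) m ≠ 0 := by
    rw [homogCoord_affineCoord hl]
    simp [hl, hm]
  have h1 := hη.2 l m (affineCoord l t) hh
  have hc : affineCoord m =ᶠ[𝓝 t] chartChange l m ∘ affineCoord l := by
    filter_upwards [eventually_coord_ne_zero hl] with s hs
    rw [Function.comp_apply, chartChange_eq, homogCoord_affineCoord hs,
      affineCoord_smul _ (inv_ne_zero hs)]
  have hd1 : DifferentiableAt ℝ (affineCoord l) t :=
    ((contDiffAt_affineCoord hl).restrict_scalars ℝ).differentiableAt (by simp)
  have hd2 : DifferentiableAt ℝ (chartChange l m) (affineCoord l t) := by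
    have := (contDiffAt_affineCoord hh).comp (affineCoord l t)
      (contDiff_homogCoord l).contDiffAt
    exact (this.restrict_scalars ℝ).differentiableAt (by simp)
  rw [chartForm, chartForm, pullback_congr hc, pullback_comp hd2 hd1]
  rw [pullback, h1, homogCoord_affineCoord hl]
  ext v
  simp only [ContinuousAlternatingMap.smul_apply, compContinuousLinearMap_apply, Pi.smul_apply,
    smul_eq_mul]
  rw [mul_zpow, inv_zpow, ← mul_assoc, mul_inv_cancel_left₀ (zpow_ne_zero _ hl)]
  rfl

open Classical in
/-- The homogeneous form on `ℂⁿ⁺¹ ∖ 0` attached to a form on projective space with values in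
`O(d)`. -/
def homogForm (d : ℤ) (η : Fin (n + 1) → Form n r) : Form (n + 1) r := fun t =>
  if h : ∃ l, t l ≠ 0 then chartForm d η h.choose t else 0

theorem homogForm_eq {a b : ℤ} {η : Fin (n + 1) → Form n r} (hη : η ∈ DG n a b r)
    {l : Fin (n + 1)} {t : Fin (n + 1) → ℂ} (hl : t l ≠ 0) :
    homogForm (b - a) η t = chartForm (b - a) η l t := by
  have h : ∃ l, t l ≠ 0 := ⟨l, hl⟩
  rw [homogForm, dif_pos h, chartForm_eq hη h.choose_spec hl]

variable {a b : ℤ} {η : Fin (n + 1) → Form n r}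

theorem homogForm_eventuallyEq (hη : η ∈ DG n a b r) {l : Fin (n + 1)} {t : Fin (n + 1) → ℂ}
    (hl : t l ≠ 0) : homogForm (b - a) η =ᶠ[𝓝 t] chartForm (b - a) η l := by
  filter_upwards [eventually_coord_ne_zero hl] with s hs using homogForm_eq hη hs

theorem exists_coord_ne_zero {t : Fin (n + 1) → ℂ} (ht : t ≠ 0) : ∃ l, t l ≠ 0 := by
  by_contra h
  push Not at h
  exact ht (funext h)

theorem differentiableAt_coord_zpow (d : ℤ) {l : Fin (n + 1)} {t : Fin (n + 1) → ℂ}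
    (hl : t l ≠ 0) : DifferentiableAt ℂ (fun t : Fin (n + 1) → ℂ => t l ^ d) t :=
  (differentiableAt_apply l t).zpow (Or.inl hl)

theorem contDiffAt_zpow {d : ℤ} {z : ℂ} (hz : z ≠ 0) : ContDiffAt ℂ ∞ (fun z : ℂ => z ^ d) z := by
  cases d with
  | ofNat k => simpa using (contDiff_id.pow k).contDiffAt
  | negSucc k =>
    simp only [zpow_negSucc]
    exact ((contDiff_id.pow (k + 1)).contDiffAt).inv (pow_ne_zero _ hz)

theorem contDiffAt_homogForm (hη : η ∈ DG n a b r) {t : Fin (n + 1) → ℂ} (ht : t ≠ 0) :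
    ContDiffAt ℝ ∞ (homogForm (b - a) η) t := by
  obtain ⟨l, hl⟩ := exists_coord_ne_zero ht
  refine ContDiffAt.congr_of_eventuallyEq ?_ (homogForm_eventuallyEq hη hl)
  have h1 : ContDiffAt ℝ ∞ (fun t : Fin (n + 1) → ℂ => t l ^ (b - a)) t :=
    ((contDiffAt_zpow hl).comp t (contDiff_apply ℂ ℂ l).contDiffAt).restrict_scalars ℝ
  exact h1.smul (contDiffAt_pullback (hη.1 l).1 (contDiffAt_affineCoord hl))

theorem isAntilinear_homogForm (hη : η ∈ DG n a b r) (t : Fin (n + 1) → ℂ) :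
    IsAntilinear (homogForm (b - a) η t) := by
  by_cases h : ∃ l, t l ≠ 0
  · obtain ⟨l, hl⟩ := h
    rw [homogForm_eq hη hl]
    exact (isAntilinear_pullback ((hη.1 l).2 _)
      ((contDiffAt_affineCoord hl).differentiableAt (by simp))).smul _
  · rw [homogForm, dif_neg h]
    exact IsAntilinear.zero

theorem dbar_homogForm (hη : η ∈ DG n a b r) (hcl : ∀ l z, dbar (η l) z = 0)
    {t : Fin (n + 1) → ℂ} (ht : t ≠ 0) : dbar (homogForm (b - a) η) t = 0 := by
  obtain ⟨l, hl⟩ := exists_coord_ne_zero ht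
  have h1 : dbar (chartForm (b - a) η l) t = _ := dbar_smul_pullback (ψ := η l)
    ((hη.1 l).1.differentiable (by simp) _) ((hη.1 l).2 _)
    ((contDiffAt_affineCoord hl).of_le (WithTop.coe_le_coe.2 le_top)) (differentiableAt_coord_zpow (b - a) hl)
  rw [dbar_congr (homogForm_eventuallyEq hη hl), h1, pullback, hcl]
  ext v
  simp

/-- `affineCoord` is invariant under scaling, so its derivative at `c • t` does to `c • v` what the
derivative at `t` does to `v`; only the power of `t l` scales. -/
theorem homogForm_smul (hη : η ∈ DG n a b r) {c : ℂ} (hc : c ≠ 0) {t : Fin (n + 1) → ℂ}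
    (ht : t ≠ 0) (v : Fin r → Fin (n + 1) → ℂ) :
    homogForm (b - a) η (c • t) (fun i => c • v i) = c ^ (b - a) * homogForm (b - a) η t v := by
  obtain ⟨l, hl⟩ := exists_coord_ne_zero ht
  have hcl : (c • t) l ≠ 0 := by simp [hc, hl]
  have hder : ∀ v, fderiv ℝ (affineCoord l) (c • t) (c • v) = fderiv ℝ (affineCoord l) t v := by
    intro v
    have h1 : affineCoord l = affineCoord l ∘ fun s => c • s := by
      ext1 s
      rw [Function.comp_apply, affineCoord_smul l hc]
    have h2 : HasFDerivAt (fun s : Fin (n + 1) → ℂ => c • s)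
        (c • ContinuousLinearMap.id ℝ (Fin (n + 1) → ℂ)) t := (hasFDerivAt_id t).const_smul c
    have h3 := (((contDiffAt_affineCoord hcl).restrict_scalars ℝ).differentiableAt
      (by simp)).hasFDerivAt.comp t h2
    rw [← h1] at h3
    rw [h3.fderiv]
    simp
  rw [homogForm_eq hη hl, homogForm_eq hη hcl, chartForm, chartForm]
  simp only [ContinuousAlternatingMap.smul_apply, pullback, compContinuousLinearMap_apply,
    affineCoord_smul l hc, Pi.smul_apply, smul_eq_mul, mul_zpow]
  rw [mul_assoc]
  congr 3
  ext1 i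
  exact hder (v i)

/-- Scaling reduces to the compact unit sphere. The degree `b - a` counts vectors scaled along with
the point; keeping the `r` vectors fixed costs `r` factors `‖t‖⁻¹`. -/
theorem homogForm_bound (hη : η ∈ DG n a b r) : ∃ C : ℝ, ∀ t ≠ 0,
    ‖homogForm (b - a) η t‖ ≤ C * ‖t‖ ^ (-((r : ℝ) - (b - a : ℤ))) := by
  obtain ⟨C, hC⟩ := (isCompact_sphere (0 : Fin (n + 1) → ℂ) 1).exists_bound_of_continuousOn
    (f := homogForm (b - a) η) fun t ht => by
      refine (contDiffAt_homogForm hη ?_).continuousAt.continuousWithinAt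
      rintro rfl
      simp at ht
  refine ⟨C, fun t ht => ?_⟩
  have htn : 0 < ‖t‖ := norm_pos_iff.2 ht
  set c : ℂ := (‖t‖ : ℂ) with hcdef
  have hc : c ≠ 0 := Complex.ofReal_ne_zero.2 htn.ne'
  have hcn : ‖c‖ = ‖t‖ := by simp [hcdef]
  set u := c⁻¹ • t with hu
  have hun : ‖u‖ = 1 := by rw [hu, norm_smul, norm_inv, hcn, inv_mul_cancel₀ htn.ne']
  have hu0 : u ≠ 0 := by
    rintro h
    rw [h, norm_zero] at hun
    exact zero_ne_one hun
  have htu : c • u = t := by rw [hu, smul_inv_smul₀ hc]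
  have hCu := hC u (by simp [hun])
  have hC0 : 0 ≤ C := (norm_nonneg _).trans hCu
  refine ContinuousAlternatingMap.opNorm_le_bound _ (by positivity) fun v => ?_
  have h1 := homogForm_smul hη hc hu0 (fun i => c⁻¹ • v i)
  simp only [htu, smul_inv_smul₀ hc] at h1
  rw [h1, norm_mul, norm_zpow, hcn]
  have h2 := (homogForm (b - a) η u).le_opNorm (fun i => c⁻¹ • v i)
  have h3 : ∏ i, ‖c⁻¹ • v i‖ = (‖t‖ ^ r)⁻¹ * ∏ i, ‖v i‖ := by
    simp only [norm_smul, norm_inv, hcn, Finset.prod_mul_distrib, Finset.prod_const,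
      Finset.card_univ, Fintype.card_fin, inv_pow]
  rw [h3] at h2
  have h4 : ‖t‖ ^ (-((r : ℝ) - (b - a : ℤ))) = ‖t‖ ^ (b - a) * (‖t‖ ^ r)⁻¹ := by
    rw [neg_sub, Real.rpow_sub htn, Real.rpow_natCast, Real.rpow_intCast, div_eq_mul_inv]
  rw [h4]
  have hp : 0 ≤ ∏ i, ‖v i‖ := Finset.prod_nonneg fun i _ => norm_nonneg _
  calc _ ≤ ‖t‖ ^ (b - a) * (C * ((‖t‖ ^ r)⁻¹ * ∏ i, ‖v i‖)) := by
        refine mul_le_mul_of_nonneg_left (h2.trans ?_) (by positivity)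
        exact mul_le_mul_of_nonneg_right hCu (by positivity)
    _ = _ := by ring

end homogeneous

/-! ### Primitives of homogeneous forms on annuli -/

section solve
variable {n r : ℕ} {a b : ℤ}

/-- More than 2n vectors are dependent over ℝ. This crude bound suffices, as the analytic argument
covers the remaining degrees. -/
theorem form_eq_zero_of_lt (h : 2 * n < r) (α : (Fin n → ℂ) [⋀^Fin r]→L[ℝ] ℂ) : α = 0 := by
  ext v
  refine α.toAlternatingMap.map_linearDependent v fun hv => ?_
  have h1 := hv.fintype_card_le_finrank
  have h2 : Module.finrank ℝ (Fin n → ℂ) = 2 * n := by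
    rw [Module.finrank_pi_fintype]
    simp [mul_comm]
  rw [h2, Fintype.card_fin] at h1
  omega

/-- The homogeneous form attached to a closed form with values in a positive line bundle is exact on
annuli. -/
theorem exists_primitive_homogForm (hab : a < b) (hr : r ≤ 2 * n)
    {η : Fin (n + 1) → Form n (r + 1)} (hη : η ∈ DG n a b (r + 1))
    (hcl : ∀ l z, dbar (η l) z = 0) {ε R : ℝ} (hε : 0 < ε) (hR : 0 < R) :
    ∃ ψ ∈ smoothForms (n + 1) r, ∀ t, ε < ‖t‖ → ‖t‖ < R →
      dbar ψ t = homogForm (b - a) η t := by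
  obtain ⟨C, hC⟩ := homogForm_bound hη
  refine exists_primitive_of_singular (by omega) (fun t ht => contDiffAt_homogForm hη ht)
    (isAntilinear_homogForm hη) (fun t ht => dbar_homogForm hη hcl ht) ?_ hC hε hR
  -- The singularity has order r + 1 - (b - a), which must be less than 2(n + 1) - 1. This is where
  -- positivity of the line bundle enters.
  have h1 : ((b - a : ℤ) : ℝ) ≥ 1 := by exact_mod_cast (by omega : (1 : ℤ) ≤ b - a)
  have h2 : (r : ℝ) ≤ 2 * n := by exact_mod_cast hr
  push_cast at h1 ⊢
  linarith

end solve

theorem contDiffAt_zpow_comp {X : Type} [NormedAddCommGroup X] [NormedSpace ℝ X] {f : X → ℂ} {x : X}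
    (hf : ContDiffAt ℝ ∞ f x) (hx : f x ≠ 0) (d : ℤ) : ContDiffAt ℝ ∞ (fun x => f x ^ d) x :=
  ContDiffAt.comp (g := fun z : ℂ => z ^ d) x ((contDiffAt_zpow hx).restrict_scalars ℝ) hf

/-! ### Averaging over the circle -/

section average
open MeasureTheory
variable {N r : ℕ}

/-- The integrand of the average of a form over the circle group acting by scalars with weight `d`. -/
def circleIntegrand (d : ℤ) (ψ : Form N r) (t : Fin N → ℂ) (θ : ℝ) :
    (Fin N → ℂ) [⋀^Fin r]→L[ℝ] ℂ :=
  Complex.exp (θ * Complex.I) ^ (-d) • (ψ (Complex.exp (θ * Complex.I) • t)).compContinuousLinearMap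
    (Complex.exp (θ * Complex.I) • ContinuousLinearMap.id ℝ (Fin N → ℂ))

/-- The average of a form over the circle group acting by scalars with weight `d`. -/
def circleAverageForm (d : ℤ) (ψ : Form N r) : Form N r := fun t =>
  ∫ θ in Set.Ioc 0 (2 * Real.pi), circleIntegrand d ψ t θ

theorem circleIntegrand_apply (d : ℤ) (ψ : Form N r) (t : Fin N → ℂ) (θ : ℝ)
    (v : Fin r → Fin N → ℂ) : circleIntegrand d ψ t θ v = Complex.exp (θ * Complex.I) ^ (-d) *
      ψ (Complex.exp (θ * Complex.I) • t) (fun i => Complex.exp (θ * Complex.I) • v i) := rfl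

theorem contDiff_expI : ContDiff ℝ ∞ fun θ : ℝ => Complex.exp (θ * Complex.I) :=
  (Complex.ofRealCLM.contDiff.mul contDiff_const).cexp

theorem contDiff_circleIntegrand (d : ℤ) {ψ : Form N r} (hψ : ContDiff ℝ ∞ ψ) :
    ContDiff ℝ ∞ (fun q : (Fin N → ℂ) × ℝ => circleIntegrand d ψ q.1 q.2) := by
  have he : ContDiff ℝ ∞ fun q : (Fin N → ℂ) × ℝ => Complex.exp (q.2 * Complex.I) :=
    contDiff_expI.comp contDiff_snd
  refine contDiff_iff_contDiffAt.2 fun q => ?_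
  have h1 : ContDiffAt ℝ ∞ (fun q : (Fin N → ℂ) × ℝ => Complex.exp (q.2 * Complex.I) ^ (-d)) q :=
    contDiffAt_zpow_comp he.contDiffAt (Complex.exp_ne_zero _) _
  refine h1.smul (contDiffAt_compContinuousLinearMap ?_ ?_)
  · exact hψ.contDiffAt.comp q (he.smul contDiff_fst).contDiffAt
  · exact (he.smul contDiff_const).contDiffAt

theorem isAntilinear_circleIntegrand (d : ℤ) {ψ : Form N r} (hψ : ∀ t, IsAntilinear (ψ t))
    (t : Fin N → ℂ) (θ : ℝ) : IsAntilinear (circleIntegrand d ψ t θ) :=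
  ((hψ _).comp (Complex.exp (θ * Complex.I) • ContinuousLinearMap.id ℂ (Fin N → ℂ))).smul _

theorem dbar_circleIntegrand (d : ℤ) {ψ : Form N r} (hψ : ψ ∈ smoothForms N r)
    (t : Fin N → ℂ) (θ : ℝ) :
    dbar (fun t => circleIntegrand d ψ t θ) t = circleIntegrand d (dbar ψ) t θ := by
  set c := Complex.exp (θ * Complex.I) with hc
  have hf : ∀ t, fderiv ℝ (fun s : Fin N → ℂ => c • s) t =
      c • ContinuousLinearMap.id ℝ (Fin N → ℂ) := fun t =>
    ((hasFDerivAt_id t).const_smul c).fderiv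
  have h1 := dbar_smul_pullback (ψ := ψ) (G := fun s => c • s) (g := fun _ => c ^ (-d)) (p := t)
    (hψ.1.differentiable (by simp) _) (hψ.2 _) (contDiff_id.const_smul c).contDiffAt
    (differentiableAt_const _)
  simp only [pullback, hf] at h1
  exact h1

theorem circle_compact : IsCompact (Set.Icc (0 : ℝ) (2 * Real.pi)) := isCompact_Icc

theorem circle_compl : (volume.restrict (Set.Ioc (0 : ℝ) (2 * Real.pi)))
    (Set.Icc (0 : ℝ) (2 * Real.pi))ᶜ = 0 := by
  rw [Measure.restrict_apply measurableSet_Icc.compl]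
  convert measure_empty (μ := volume)
  ext x
  simp only [Set.mem_inter_iff, Set.mem_compl_iff, Set.mem_Icc, Set.mem_Ioc,
    Set.mem_empty_iff_false, iff_false]
  rintro ⟨h1, h2, h3⟩
  exact h1 ⟨h2.le, h3⟩

theorem circleAverageForm_mem (d : ℤ) {ψ : Form N r} (hψ : ψ ∈ smoothForms N r) :
    circleAverageForm d ψ ∈ smoothForms N r :=
  integral_mem_smoothForms circle_compact circle_compl (contDiff_circleIntegrand d hψ.1)
    fun t θ => isAntilinear_circleIntegrand d hψ.2 t θ

theorem dbar_circleAverageForm (d : ℤ) {ψ : Form N r} (hψ : ψ ∈ smoothForms N r) (t : Fin N → ℂ) :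
    dbar (circleAverageForm d ψ) t = circleAverageForm d (dbar ψ) t := by
  have h := dbar_integral circle_compact circle_compl (f := circleIntegrand d ψ)
    (contDiff_circleIntegrand d hψ.1) t
  simp only [dbar_circleIntegrand d hψ] at h
  exact h

theorem circleAverageForm_apply (d : ℤ) {ψ : Form N r} (hψ : ContDiff ℝ ∞ ψ) (t : Fin N → ℂ)
    (v : Fin r → Fin N → ℂ) : circleAverageForm d ψ t v =
      ∫ θ in (0 : ℝ)..2 * Real.pi, circleIntegrand d ψ t θ v := by
  rw [intervalIntegral.integral_of_le Real.two_pi_pos.le, circleAverageForm]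
  refine integral_form_apply (integrable_of_continuous_compact circle_compact circle_compl ?_) v
  exact (contDiff_circleIntegrand d hψ).continuous.comp (Continuous.prodMk_right t)

/-- Multiplication by exp(iφ) shifts the variable of integration by φ, and the integrand has period
2π. -/
theorem circleAverageForm_equivariant (d : ℤ) {ψ : Form N r} (hψ : ContDiff ℝ ∞ ψ) {c : ℂ}
    (hc : ‖c‖ = 1) (t : Fin N → ℂ) (v : Fin r → Fin N → ℂ) :
    circleAverageForm d ψ (c • t) (fun i => c • v i) = c ^ d * circleAverageForm d ψ t v := by
  set φ := Complex.arg c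
  have hcφ : Complex.exp (φ * Complex.I) = c := by
    have := Complex.norm_mul_exp_arg_mul_I c
    rwa [hc, Complex.ofReal_one, one_mul] at this
  have hc0 : c ≠ 0 := by
    rintro rfl
    simp at hc
  have h1 : ∀ θ : ℝ, circleIntegrand d ψ (c • t) θ (fun i => c • v i) =
      c ^ d * circleIntegrand d ψ t (θ + φ) v := by
    intro θ
    have h2 : Complex.exp ((θ + φ : ℝ) * Complex.I) = Complex.exp (θ * Complex.I) * c := by
      rw [← hcφ, ← Complex.exp_add]
      push_cast
      ring_nf
    rw [circleIntegrand_apply, circleIntegrand_apply, h2]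
    simp only [smul_smul]
    rw [mul_zpow, ← mul_assoc, mul_left_comm, ← zpow_add₀ hc0, add_neg_cancel, zpow_zero, mul_one]
  have hper : Function.Periodic (fun θ => circleIntegrand d ψ t θ v) (2 * Real.pi) := by
    intro θ
    have h3 : Complex.exp ((θ + 2 * Real.pi : ℝ) * Complex.I) = Complex.exp (θ * Complex.I) := by
      push_cast
      rw [add_mul, Complex.exp_periodic]
    simp only [circleIntegrand_apply, h3]
  rw [circleAverageForm_apply d hψ, circleAverageForm_apply d hψ]
  simp only [h1]
  rw [intervalIntegral.integral_const_mul]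
  congr 1
  rw [intervalIntegral.integral_comp_add_right (fun θ => circleIntegrand d ψ t θ v)]
  have := hper.intervalIntegral_add_eq φ 0
  rw [zero_add] at this
  rw [zero_add, add_comm, this]

/-- The integrand is constant. Equivariance is asked along the orbit of `t` only, because ∂̄ of the
primitive is known to be homogeneous just on an annulus. -/
theorem circleAverageForm_of_equivariant (d : ℤ) {F : Form N r} {t : Fin N → ℂ}
    {α : (Fin N → ℂ) [⋀^Fin r]→L[ℝ] ℂ}
    (hF : ∀ c : ℂ, ‖c‖ = 1 → ∀ v, F (c • t) (fun i => c • v i) = c ^ d * α v) :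
    circleAverageForm d F t = (2 * Real.pi : ℝ) • α := by
  have h1 : ∀ θ, circleIntegrand d F t θ = α := by
    intro θ
    ext v
    rw [circleIntegrand_apply, hF _ (Complex.norm_exp_ofReal_mul_I θ), ← mul_assoc,
      ← zpow_add₀ (Complex.exp_ne_zero _), neg_add_cancel, zpow_zero, one_mul]
  simp only [circleAverageForm, h1]
  rw [integral_const]
  simp [Measure.real, Real.pi_pos.le]

/-- Averaging commutes with ∂̄, the circle acting by complex linear maps, and it preserves the
homogeneous right-hand side up to the factor 2π, the annulus being invariant. -/
theorem exists_equivariant_primitive {n : ℕ} {a b : ℤ} (hab : a < b) (hr : r ≤ 2 * n)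
    {η : Fin (n + 1) → Form n (r + 1)} (hη : η ∈ DG n a b (r + 1))
    (hcl : ∀ l z, dbar (η l) z = 0) {ε R : ℝ} (hε : 0 < ε) (hR : 0 < R) :
    ∃ ψ ∈ smoothForms (n + 1) r, (∀ t, ε < ‖t‖ → ‖t‖ < R →
      dbar ψ t = homogForm (b - a) η t) ∧ ∀ c : ℂ, ‖c‖ = 1 → ∀ t v,
      ψ (c • t) (fun i => c • v i) = c ^ (b - a) * ψ t v := by
  obtain ⟨ψ, hψ, h⟩ := exists_primitive_homogForm hab hr hη hcl hε hR
  have hm := circleAverageForm_mem (b - a) hψ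
  refine ⟨((2 * Real.pi)⁻¹ : ℂ) • circleAverageForm (b - a) ψ, Submodule.smul_mem _ _ hm,
    fun t ht1 ht2 => ?_, fun c hc t v => ?_⟩
  · rw [dbar_const_smul (hm.1.differentiable (by simp) t), dbar_circleAverageForm _ hψ,
      circleAverageForm_of_equivariant (b - a) (α := homogForm (b - a) η t)]
    · ext v
      have : (Real.pi : ℂ) ≠ 0 := Complex.ofReal_ne_zero.2 Real.pi_ne_zero
      simp only [ContinuousAlternatingMap.smul_apply, Complex.real_smul, smul_eq_mul]
      push_cast
      field_simp
    · intro c hc v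
      have hn : ‖c • t‖ = ‖t‖ := by rw [norm_smul, hc, one_mul]
      rw [h _ (hn ▸ ht1) (hn ▸ ht2)]
      refine homogForm_smul hη ?_ ?_ v
      · rintro rfl
        simp at hc
      · rintro rfl
        rw [norm_zero] at ht1
        exact absurd ht1 hε.le.not_gt
  · have := circleAverageForm_equivariant (b - a) hψ.1 hc t v
    simp only [Pi.smul_apply, ContinuousAlternatingMap.smul_apply, smul_eq_mul, this]
    ring

end average

/-! ### Horizontal projection and basic forms -/

section basic
variable {N r : ℕ}

/-- The Euclidean norm on `ℂᴺ`. -/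
def euclid (t : Fin N → ℂ) : ℝ := √(∑ j, ‖t j‖ ^ 2)

/-- The Hermitian product `v ↦ ∑ v_j t̄_j`. -/
def herm (t : Fin N → ℂ) : (Fin N → ℂ) →L[ℂ] ℂ :=
  ∑ j, (starRingEnd ℂ) (t j) • ContinuousLinearMap.proj (R := ℂ) (φ := fun _ : Fin N => ℂ) j

theorem herm_apply (t v : Fin N → ℂ) : herm t v = ∑ j, (starRingEnd ℂ) (t j) * v j := by
  simp [herm]

theorem herm_add (s t v : Fin N → ℂ) : herm (s + t) v = herm s v + herm t v := by
  simp [herm_apply, add_mul, Finset.sum_add_distrib]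

theorem herm_smul (c : ℂ) (t v : Fin N → ℂ) : herm (c • t) v = (starRingEnd ℂ) c * herm t v := by
  simp [herm_apply, Finset.mul_sum, mul_assoc]

theorem euclid_sq (t : Fin N → ℂ) : euclid t ^ 2 = ∑ j, ‖t j‖ ^ 2 :=
  Real.sq_sqrt (by positivity)

theorem herm_self (t : Fin N → ℂ) : herm t t = (euclid t : ℂ) ^ 2 := by
  rw [herm_apply, ← Complex.ofReal_pow, euclid_sq]
  push_cast
  refine Finset.sum_congr rfl fun j _ => ?_
  rw [← Complex.conj_mul']

theorem herm_conj (s t : Fin N → ℂ) : (starRingEnd ℂ) (herm s t) = herm t s := by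
  simp [herm_apply, mul_comm]

theorem sum_sq_pos {t : Fin N → ℂ} (ht : t ≠ 0) : 0 < ∑ j, ‖t j‖ ^ 2 := by
  obtain ⟨j, hj⟩ : ∃ j, t j ≠ 0 := by
    by_contra h
    push Not at h
    exact ht (funext h)
  exact Finset.sum_pos' (fun i _ => by positivity) ⟨j, Finset.mem_univ j, by positivity⟩

theorem euclid_pos {t : Fin N → ℂ} (ht : t ≠ 0) : 0 < euclid t := Real.sqrt_pos.2 (sum_sq_pos ht)

theorem euclid_smul (c : ℂ) (t : Fin N → ℂ) : euclid (c • t) = ‖c‖ * euclid t := by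
  simp only [euclid, Pi.smul_apply, smul_eq_mul, norm_mul, mul_pow, ← Finset.mul_sum]
  rw [Real.sqrt_mul (by positivity), Real.sqrt_sq (norm_nonneg c)]

theorem contDiffAt_euclid {t : Fin N → ℂ} (ht : t ≠ 0) : ContDiffAt ℝ ∞ (euclid (N := N)) t := by
  have h1 : ContDiff ℝ ∞ fun t : Fin N → ℂ => ∑ j, ‖t j‖ ^ 2 :=
    ContDiff.sum fun j _ => (contDiff_apply ℝ ℂ j).norm_sq ℝ
  exact h1.contDiffAt.sqrt (sum_sq_pos ht).ne'

/-- The orthogonal projection to the complement of `t`, divided by the norm of `t`. -/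
def horizProj (t : Fin N → ℂ) : (Fin N → ℂ) →L[ℂ] (Fin N → ℂ) :=
  ((euclid t : ℂ)⁻¹) • (ContinuousLinearMap.id ℂ _ -
    (herm t).smulRight ((((euclid t : ℂ) ^ 2)⁻¹) • t))

theorem horizProj_apply (t v : Fin N → ℂ) : horizProj t v =
    ((euclid t : ℂ)⁻¹) • (v - herm t v • (((euclid t : ℂ) ^ 2)⁻¹) • t) := rfl

theorem horizProj_self {t : Fin N → ℂ} (ht : t ≠ 0) : horizProj t t = 0 := by
  have h : (euclid t : ℂ) ≠ 0 := Complex.ofReal_ne_zero.2 (euclid_pos ht).ne'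
  rw [horizProj_apply, herm_self, smul_smul, mul_inv_cancel₀ (pow_ne_zero 2 h), one_smul, sub_self,
    smul_zero]

/-- Division by the Euclidean norm leaves only the phase of `c`; so equivariance of ψ under the
circle is enough to make `basicForm` homogeneous. -/
theorem horizProj_smul {c : ℂ} (hc : c ≠ 0) (t v : Fin N → ℂ) :
    horizProj (c • t) (c • v) = (c * (‖c‖ : ℂ)⁻¹) • horizProj t v := by
  have hn : (‖c‖ : ℂ) ≠ 0 := Complex.ofReal_ne_zero.2 (norm_ne_zero_iff.2 hc)
  have h2 : (starRingEnd ℂ) c * c = (‖c‖ : ℂ) ^ 2 := Complex.conj_mul' c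
  rw [horizProj_apply, horizProj_apply, herm_smul, map_smul, euclid_smul]
  push_cast
  simp only [mul_inv, mul_pow, smul_smul, smul_sub, smul_eq_mul]
  congr 2
  · ring
  · have h3 : (starRingEnd ℂ) c * c * ((‖c‖ : ℂ) ^ 2)⁻¹ = 1 := by
      rw [h2, mul_inv_cancel₀ (pow_ne_zero 2 hn)]
    linear_combination (c * (‖c‖ : ℂ)⁻¹ * (euclid t : ℂ)⁻¹ * herm t v * ((euclid t : ℂ) ^ 2)⁻¹) * h3

theorem contDiffAt_horizProj {t : Fin N → ℂ} (ht : t ≠ 0) :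
    ContDiffAt ℝ ∞ (fun t : Fin N → ℂ => (horizProj t).restrictScalars ℝ) t := by
  have he : ContDiffAt ℝ ∞ (fun t : Fin N → ℂ => (euclid t : ℂ)) t :=
    Complex.ofRealCLM.contDiff.contDiffAt.comp t (contDiffAt_euclid ht)
  have h0 : (euclid t : ℂ) ≠ 0 := Complex.ofReal_ne_zero.2 (euclid_pos ht).ne'
  have hh : ContDiff ℝ ∞ (fun t : Fin N → ℂ => herm t) := by
    refine ContDiff.sum fun j _ => ?_
    have h2 : ContDiff ℝ ∞ fun t : Fin N → ℂ => (starRingEnd ℂ) (t j) :=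
      Complex.conjCLE.contDiff.comp (contDiff_apply ℝ ℂ j)
    exact h2.smul (contDiff_const (c := ContinuousLinearMap.proj (R := ℂ) (φ := fun _ : Fin N => ℂ) j))
  have h1 : ContDiffAt ℝ ∞ (fun t : Fin N → ℂ => horizProj t) t := by
    refine (he.inv h0).smul (contDiffAt_const.sub ?_)
    have h2 : ContDiffAt ℝ ∞ (fun t : Fin N → ℂ => (((euclid t : ℂ) ^ 2)⁻¹) • t) t :=
      ((he.pow 2).inv (pow_ne_zero 2 h0)).smul contDiffAt_id
    exact (((ContinuousLinearMap.smulRightL ℂ (Fin N → ℂ) (Fin N → ℂ)).isBoundedBilinearMap.contDiff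
      (n := ∞)).restrict_scalars ℝ).contDiffAt.comp t (hh.contDiffAt.prodMk h2)
  exact (ContinuousLinearMap.restrictScalarsL ℂ (Fin N → ℂ) (Fin N → ℂ) ℝ ℝ).contDiff.contDiffAt.comp
    t h1

/-- The form on `ℂᴺ ∖ 0`, horizontal and homogeneous of degree `d`, that extends the horizontal part
of the restriction of `ψ` to the unit sphere. -/
def basicForm (d : ℤ) (ψ : Form N r) : Form N r := fun t =>
  (euclid t : ℂ) ^ d • (ψ ((euclid t : ℂ)⁻¹ • t)).compContinuousLinearMap
    ((horizProj t).restrictScalars ℝ)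

theorem basicForm_apply (d : ℤ) (ψ : Form N r) (t : Fin N → ℂ) (v : Fin r → Fin N → ℂ) :
    basicForm d ψ t v = (euclid t : ℂ) ^ d * ψ ((euclid t : ℂ)⁻¹ • t) fun i => horizProj t (v i) :=
  rfl

theorem contDiffAt_basicForm (d : ℤ) {ψ : Form N r} (hψ : ContDiff ℝ ∞ ψ) {t : Fin N → ℂ}
    (ht : t ≠ 0) : ContDiffAt ℝ ∞ (basicForm d ψ) t := by
  have he : ContDiffAt ℝ ∞ (fun t : Fin N → ℂ => (euclid t : ℂ)) t :=
    Complex.ofRealCLM.contDiff.contDiffAt.comp t (contDiffAt_euclid ht)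
  have h0 : (euclid t : ℂ) ≠ 0 := Complex.ofReal_ne_zero.2 (euclid_pos ht).ne'
  have h1 : ContDiffAt ℝ ∞ (fun t : Fin N → ℂ => (euclid t : ℂ) ^ d) t :=
    contDiffAt_zpow_comp he h0 d
  have h2 : ContDiffAt ℝ ∞ (fun t : Fin N → ℂ => (euclid t : ℂ)⁻¹ • t) t :=
    (he.inv h0).smul contDiffAt_id
  exact h1.smul (contDiffAt_compContinuousLinearMap (hψ.contDiffAt.comp t h2)
    (contDiffAt_horizProj ht))

theorem isAntilinear_basicForm (d : ℤ) {ψ : Form N r} (hψ : ∀ t, IsAntilinear (ψ t))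
    (t : Fin N → ℂ) : IsAntilinear (basicForm d ψ t) :=
  ((hψ _).comp (horizProj t)).smul _

/-- The derivative of `c • T` has an extra term along `T`, which the horizontal projection kills.
The phase of `c` is absorbed by equivariance of ψ, its modulus by the power of the Euclidean norm.
So a change of lift acts like a change of frame of O(d), even for a scalar `c` that is not
holomorphic. -/
theorem pullback_basicForm {k : ℕ} {d : ℤ} {ψ : Form N r}
    (heq : ∀ c : ℂ, ‖c‖ = 1 → ∀ t v, ψ (c • t) (fun i => c • v i) = c ^ d * ψ t v)
    {S T : (Fin k → ℂ) → (Fin N → ℂ)} {c : (Fin k → ℂ) → ℂ} {w : Fin k → ℂ}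
    (hS : S =ᶠ[𝓝 w] fun w => c w • T w) (hc : DifferentiableAt ℝ c w)
    (hT : DifferentiableAt ℝ T w) (hcw : c w ≠ 0) (hTw : T w ≠ 0) :
    pullback S (basicForm d ψ) w = c w ^ d • pullback T (basicForm d ψ) w := by
  have hn : (‖c w‖ : ℂ) ≠ 0 := Complex.ofReal_ne_zero.2 (norm_ne_zero_iff.2 hcw)
  have hT0 : (euclid (T w) : ℂ) ≠ 0 := Complex.ofReal_ne_zero.2 (euclid_pos hTw).ne'
  have h1 : HasFDerivAt S _ w := (hc.hasFDerivAt.smul hT.hasFDerivAt).congr_of_eventuallyEq hS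
  set e := c w * (‖c w‖ : ℂ)⁻¹ with he
  have hen : ‖e‖ = 1 := by
    rw [he, norm_mul, norm_inv, Complex.norm_real, norm_norm, mul_inv_cancel₀]
    exact norm_ne_zero_iff.2 hcw
  have hder : ∀ v, horizProj (c w • T w) (fderiv ℝ S w v) =
      e • horizProj (T w) (fderiv ℝ T w v) := by
    intro v
    have h2 : fderiv ℝ S w v =
        c w • (fderiv ℝ T w v + ((c w)⁻¹ * fderiv ℝ c w v) • T w) := by
      rw [h1.fderiv, smul_add, smul_smul, mul_inv_cancel_left₀ hcw]
      rfl
    rw [h2, horizProj_smul hcw, map_add, map_smul, horizProj_self hTw, smul_zero, add_zero]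
  ext v
  simp only [pullback, compContinuousLinearMap_apply, ContinuousAlternatingMap.smul_apply,
    basicForm_apply, Function.comp_apply, smul_eq_mul, hS.self_of_nhds, hder]
  have h3 : ((euclid (c w • T w) : ℂ)⁻¹) • c w • T w = e • (euclid (T w) : ℂ)⁻¹ • T w := by
    rw [euclid_smul, smul_smul, smul_smul, he]
    push_cast
    rw [mul_inv]
    congr 1
    ring
  rw [h3, heq e hen, euclid_smul, he, mul_zpow, inv_zpow]
  push_cast
  rw [mul_zpow]
  have := zpow_ne_zero d hn
  field_simp

end basic

/-! ### The Dolbeault operator of a basic form on horizontal vectors -/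

section horizontal
variable {N r : ℕ}

theorem ne_zero_of_euclid {t : Fin N → ℂ} (h : euclid t = 1) : t ≠ 0 := by
  rintro rfl
  simp [euclid] at h

theorem euclid_sq_line {t₀ x : Fin N → ℂ} (h1 : euclid t₀ = 1) (hx : herm t₀ x = 0) (s : ℝ) :
    euclid (t₀ + s • x) = √(1 + s ^ 2 * euclid x ^ 2) := by
  have h2 : ((euclid (t₀ + s • x) ^ 2 : ℝ) : ℂ) = ((1 + s ^ 2 * euclid x ^ 2 : ℝ) : ℂ) := by
    have h3 : herm x t₀ = 0 := by rw [← herm_conj, hx, _root_.map_zero]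
    push_cast
    rw [← herm_self, ← Complex.coe_smul, herm_add, herm_smul, map_add, map_add, map_smul, map_smul,
      herm_self, herm_self, h1, hx, h3, Complex.conj_ofReal]
    simp only [smul_eq_mul]
    push_cast
    ring
  have h4 := Complex.ofReal_injective h2
  rw [← h4]
  exact (Real.sqrt_sq (Real.sqrt_nonneg _)).symm

theorem hasDerivAt_euclid_line {t₀ x : Fin N → ℂ} (h1 : euclid t₀ = 1) (hx : herm t₀ x = 0) :
    HasDerivAt (fun s : ℝ => euclid (t₀ + s • x)) 0 0 := by
  simp only [euclid_sq_line h1 hx]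
  have h2 : HasDerivAt (fun s : ℝ => 1 + s ^ 2 * euclid x ^ 2) 0 0 := by
    have := ((hasDerivAt_pow 2 (0 : ℝ)).mul_const (euclid x ^ 2)).const_add 1
    simpa using this
  simpa using h2.sqrt (by simp)

/-- The Euclidean norm is stationary along a horizontal line through the unit sphere, so the scalar
factor and the rescaling of the point contribute nothing extra. Only the moving projection does: it
pushes `v i` off the horizontal space at the rate `-(herm x (v i) • t₀)`. -/
theorem fderiv_basicForm_horizontal (d : ℤ) {ψ : Form N r} (hψ : ContDiff ℝ ∞ ψ)
    {t₀ x : Fin N → ℂ} (h1 : euclid t₀ = 1) (hx : herm t₀ x = 0) {v : Fin r → Fin N → ℂ}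
    (hv : ∀ i, herm t₀ (v i) = 0) :
    fderiv ℝ (basicForm d ψ) t₀ x v =
      fderiv ℝ ψ t₀ x v + ∑ i, ψ t₀ (Function.update v i (-(herm x (v i) • t₀))) := by
  have ht0 := ne_zero_of_euclid h1
  have hc : HasDerivAt (fun s : ℝ => t₀ + s • x) x 0 := by
    simpa using ((hasDerivAt_id (0 : ℝ)).smul_const x).const_add t₀
  have hd : HasFDerivAt (basicForm d ψ) (fderiv ℝ (basicForm d ψ) t₀) (t₀ + (0 : ℝ) • x) := by
    rw [zero_smul, add_zero]
    exact ((contDiffAt_basicForm d hψ ht0).differentiableAt (by simp)).hasFDerivAt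
  have hleft : HasDerivAt (fun s : ℝ => basicForm d ψ (t₀ + s • x) v)
      (fderiv ℝ (basicForm d ψ) t₀ x v) 0 := by
    have h2 := HasFDerivAt.comp_hasDerivAt (0 : ℝ) (f := fun s : ℝ => t₀ + s • x) hd hc
    exact (ContinuousAlternatingMap.apply ℝ (Fin N → ℂ) ℂ v).hasFDerivAt.comp_hasDerivAt 0 h2
  set u : ℝ → ℂ := fun s => (euclid (t₀ + s • x) : ℂ) with hu
  have hu0 : u 0 = 1 := by simp [hu, h1]
  have hud : HasDerivAt u 0 0 := by
    have := (hasDerivAt_euclid_line h1 hx).ofReal_comp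
    simpa using this
  have hui : HasDerivAt (fun s => (u s)⁻¹) 0 0 := by
    have := hud.inv (by rw [hu0]; exact one_ne_zero)
    exact this.congr_deriv (by simp)
  have hui2 : HasDerivAt (fun s => (u s ^ 2)⁻¹) 0 0 := by
    have := (hud.pow 2).inv (by rw [Pi.pow_apply, hu0]; simp)
    exact this.congr_deriv (by simp)
  have huz : HasDerivAt (fun s => u s ^ d) 0 0 := by
    have := (hasDerivAt_zpow d (u 0) (Or.inl (by rw [hu0]; exact one_ne_zero))).scomp (0 : ℝ) hud
    exact this.congr_deriv (by simp)
  have hP : HasDerivAt (fun s : ℝ => (u s)⁻¹ • (t₀ + s • x)) x 0 := by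
    have := hui.smul hc
    exact this.congr_deriv (by simp [hu0])
  have hQ : ∀ i, HasDerivAt (fun s : ℝ => horizProj (t₀ + s • x) (v i)) (-(herm x (v i) • t₀)) 0 := by
    intro i
    have h2 : ∀ s : ℝ, horizProj (t₀ + s • x) (v i) =
        (u s)⁻¹ • (v i - ((s : ℂ) * herm x (v i)) • (u s ^ 2)⁻¹ • (t₀ + s • x)) := by
      intro s
      rw [horizProj_apply, herm_add, hv i, zero_add, ← Complex.coe_smul, herm_smul,
        Complex.conj_ofReal]
      simp only [hu, Complex.coe_smul]
    simp only [h2]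
    have h3 : HasDerivAt (fun s : ℝ => (s : ℂ) * herm x (v i)) (herm x (v i)) 0 := by
      have := ((hasDerivAt_id (0 : ℝ)).ofReal_comp).mul_const (herm x (v i))
      simpa using this
    have h4 := hui.smul ((h3.smul (hui2.smul hc)).const_sub (v i))
    exact h4.congr_deriv (by simp [hu0])
  have hF : HasDerivAt (fun s : ℝ => ψ ((u s)⁻¹ • (t₀ + s • x))) (fderiv ℝ ψ t₀ x) 0 := by
    have h2 : HasFDerivAt ψ (fderiv ℝ ψ t₀) ((u 0)⁻¹ • (t₀ + (0 : ℝ) • x)) := by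
      rw [hu0, zero_smul, add_zero, inv_one, one_smul]
      exact (hψ.differentiable (by simp) t₀).hasFDerivAt
    exact h2.comp_hasDerivAt 0 hP
  have happ := (HasFDerivAt.continuousAlternatingMap_apply hF.hasFDerivAt
    (fun i => (hQ i).hasFDerivAt)).hasDerivAt
  have hright := huz.mul happ
  have huniq := hleft.unique hright
  have hP0 : horizProj t₀ = ContinuousLinearMap.id ℂ (Fin N → ℂ) - (herm t₀).smulRight t₀ := by
    ext1 y
    rw [horizProj_apply, h1]
    simp
  have hQ0 : ∀ i, horizProj t₀ (v i) = v i := by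
    intro i
    rw [hP0]
    simp [hv i]
  rw [huniq]
  simp [hu0, hQ0]

/-- The correction is complex linear in `x`: `herm x` is conjugate-linear in `x`, and ψ conjugates
once more. Hence the conjugate-linear part does not see it. -/
theorem antilinearPart_basicForm (d : ℤ) {ψ : Form N r} (hψ : ψ ∈ smoothForms N r)
    {t₀ x : Fin N → ℂ} (h1 : euclid t₀ = 1) (hx : herm t₀ x = 0) {v : Fin r → Fin N → ℂ}
    (hv : ∀ i, herm t₀ (v i) = 0) :
    antilinearPart (fderiv ℝ (basicForm d ψ) t₀) x v = antilinearPart (fderiv ℝ ψ t₀) x v := by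
  have hIx : herm t₀ (Complex.I • x) = 0 := by rw [map_smul, hx, smul_zero]
  have hup : ∀ (c : ℂ) (i : Fin r), ψ t₀ (Function.update v i (-(c • t₀))) =
      -((starRingEnd ℂ) c * ψ t₀ (Function.update v i t₀)) := by
    intro c i
    have := hψ.2 t₀ (Function.update v i t₀) i (-c)
    simpa using this
  simp only [antilinearPart_apply, ContinuousAlternatingMap.smul_apply,
    ContinuousAlternatingMap.add_apply, fderiv_basicForm_horizontal d hψ.1 h1 hx hv,
    fderiv_basicForm_horizontal d hψ.1 h1 hIx hv, hup, herm_smul, smul_eq_mul, map_mul,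
    Complex.conj_conj, Finset.sum_neg_distrib]
  simp only [mul_assoc, ← Finset.mul_sum]
  linear_combination (-1 / 2 * ∑ i, (starRingEnd ℂ) (herm x (v i)) *
    ψ t₀ (Function.update v i t₀)) * Complex.I_mul_I

theorem dbar_basicForm_horizontal (d : ℤ) {ψ : Form N r} (hψ : ψ ∈ smoothForms N r)
    {t₀ : Fin N → ℂ} (h1 : euclid t₀ = 1) {v : Fin (r + 1) → Fin N → ℂ}
    (hv : ∀ i, herm t₀ (v i) = 0) : dbar (basicForm d ψ) t₀ v = dbar ψ t₀ v := by
  simp only [dbar, alternatizeUncurryFin_apply]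
  refine Finset.sum_congr rfl fun i _ => ?_
  rw [antilinearPart_basicForm d hψ h1 (hv i) (v := i.removeNth v) fun j => hv _]

end horizontal

/-! ### Descent to projective space and vanishing of higher cohomology -/

section descent
variable {n r : ℕ} {a b : ℤ}

theorem homogCoord_ne_zero (l : Fin (n + 1)) (w : Fin n → ℂ) : homogCoord l w ≠ 0 := by
  intro h
  have := congrFun h l
  simp [homogCoord_self] at this

theorem pullback_basicForm_mem {d : ℤ} {ψ : Form (n + 1) r} (hψ : ψ ∈ smoothForms (n + 1) r)
    (l : Fin (n + 1)) : pullback (homogCoord l) (basicForm d ψ) ∈ smoothForms n r := by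
  have hG := contDiff_homogCoord (n := n) l
  refine ⟨contDiff_iff_contDiffAt.2 fun w => ?_, fun w => ?_⟩
  · exact contDiffAt_compContinuousLinearMap
      (ContDiffAt.comp w (contDiffAt_basicForm d hψ.1 (homogCoord_ne_zero l w))
        (hG.contDiffAt.restrict_scalars ℝ))
      ((hG.contDiffAt.restrict_scalars ℝ).fderiv_right (by simp))
  · exact isAntilinear_pullback (isAntilinear_basicForm d hψ.2 _) (hG.differentiable (by simp) w)

/-- The normalized homogeneous coordinates of two charts are lifts of the same point that differ by
the scalar `homogCoord l w m`, so `pullback_basicForm` supplies the transition rule. -/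
theorem pullback_basicForm_mem_DG {ψ : Form (n + 1) r} (hψ : ψ ∈ smoothForms (n + 1) r)
    (heq : ∀ c : ℂ, ‖c‖ = 1 → ∀ t v, ψ (c • t) (fun i => c • v i) = c ^ (b - a) * ψ t v) :
    (fun l => pullback (homogCoord l) (basicForm (b - a) ψ)) ∈ DG n a b r := by
  refine ⟨pullback_basicForm_mem hψ, fun l m w hw => ?_⟩
  have hc : Differentiable ℝ fun w : Fin n → ℂ => homogCoord l w m :=
    fun w => ((homogCoord_differentiable l m).restrict_scalars ℝ).differentiable (by simp) w
  have hch : DifferentiableAt ℝ (chartChange l m) w := by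
    have := (contDiffAt_affineCoord hw).comp w (contDiff_homogCoord l).contDiffAt
    exact (this.restrict_scalars ℝ).differentiableAt (by simp)
  have hhc : Differentiable ℝ (homogCoord m : (Fin n → ℂ) → _) :=
    ((contDiff_homogCoord m).restrict_scalars ℝ).differentiable (by simp)
  have hS : homogCoord l =ᶠ[𝓝 w]
      fun w => homogCoord l w m • (homogCoord m ∘ chartChange l m) w := by
    filter_upwards [(hc w).continuousAt.eventually_ne hw] with q hq
    rw [Function.comp_apply, chartChange_eq, homogCoord_affineCoord hq, smul_inv_smul₀ hq]
  have h1 := pullback_basicForm heq hS (hc w) ((hhc _).comp w hch) hw (homogCoord_ne_zero _ _)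
  show pullback (homogCoord l) (basicForm (b - a) ψ) w = _
  rw [h1, pullback_comp (hhc _) hch]
  rfl

/-- The chart is replaced by a holomorphic lift `T` that meets the unit sphere at the given point
and is horizontal there, where ∂̄ of the basic form agrees with ∂̄ψ. Since `affineCoord l` is a left
inverse of `T`, the homogeneous form pulls back to η. -/
theorem dbar_pullback_basicForm {η : Fin (n + 1) → Form n (r + 1)} (hη : η ∈ DG n a b (r + 1))
    {ψ : Form (n + 1) r} (hψ : ψ ∈ smoothForms (n + 1) r)
    (heq : ∀ c : ℂ, ‖c‖ = 1 → ∀ t v, ψ (c • t) (fun i => c • v i) = c ^ (b - a) * ψ t v)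
    (hd : ∀ t, euclid t = 1 → dbar ψ t = homogForm (b - a) η t) (l : Fin (n + 1))
    (w₀ : Fin n → ℂ) : dbar (pullback (homogCoord l) (basicForm (b - a) ψ)) w₀ = η l w₀ := by
  set s := homogCoord l w₀ with hs
  have hs0 : s ≠ 0 := homogCoord_ne_zero l w₀
  have hes : (euclid s : ℂ) ≠ 0 := Complex.ofReal_ne_zero.2 (euclid_pos hs0).ne'
  -- Normalizing the lift to constant Hermitian product with `s` keeps it holomorphic, makes it `s`
  -- divided by its Euclidean norm at `w₀`, and makes its derivative orthogonal to `s`.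
  set c : (Fin n → ℂ) → ℂ := fun w => (euclid s : ℂ)⁻¹ * herm s (homogCoord l w) with hc
  set T : (Fin n → ℂ) → (Fin (n + 1) → ℂ) := fun w => (c w)⁻¹ • homogCoord l w with hT
  have hhl : ContDiff ℂ ∞ (homogCoord l : (Fin n → ℂ) → _) := contDiff_homogCoord l
  have hcs : ContDiff ℂ ∞ c := contDiff_const.mul ((herm s).contDiff.comp hhl)
  have hcw : c w₀ = euclid s := by
    rw [hc]
    simp only
    rw [← hs, herm_self, sq, inv_mul_cancel_left₀ hes]
  have hcw0 : c w₀ ≠ 0 := by rwa [hcw]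
  have hev : ∀ᶠ w in 𝓝 w₀, c w ≠ 0 := hcs.continuous.continuousAt.eventually_ne hcw0
  have hTs : ∀ w, c w ≠ 0 → ContDiffAt ℂ ∞ T w := fun w hw =>
    (hcs.contDiffAt.inv hw).smul hhl.contDiffAt
  have hS : ∀ w, c w ≠ 0 → homogCoord l w = c w • T w := fun w hw => by
    rw [hT]
    simp only
    rw [smul_inv_smul₀ hw]
  have hTne : ∀ w, c w ≠ 0 → T w ≠ 0 := fun w hw h =>
    homogCoord_ne_zero l w (by rw [hS w hw, h, smul_zero])
  have hloc : pullback (homogCoord l) (basicForm (b - a) ψ) =ᶠ[𝓝 w₀]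
      fun w => c w ^ (b - a) • pullback T (basicForm (b - a) ψ) w := by
    filter_upwards [hev] with w hw
    refine pullback_basicForm heq ?_ ((hcs.restrict_scalars ℝ).differentiable (by simp) w)
      (((hTs w hw).restrict_scalars ℝ).differentiableAt (by simp)) hw (hTne w hw)
    filter_upwards [hcs.continuous.continuousAt.eventually_ne hw] with q hq using hS q hq
  set t₀ := T w₀ with ht₀
  have ht₀s : t₀ = (euclid s : ℂ)⁻¹ • s := by
    rw [ht₀, hT]
    simp only
    rw [hcw, ← hs]
  have het : euclid t₀ = 1 := by
    rw [ht₀s, euclid_smul, norm_inv, Complex.norm_real,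
      Real.norm_of_nonneg (euclid_pos hs0).le, inv_mul_cancel₀ (euclid_pos hs0).ne']
  have htne := ne_zero_of_euclid het
  have hTd : DifferentiableAt ℝ T w₀ :=
    ((hTs w₀ hcw0).restrict_scalars ℝ).differentiableAt (by simp)
  have hhor : ∀ v, herm t₀ (fderiv ℝ T w₀ v) = 0 := by
    intro v
    have h1 : (fun w => herm s (T w)) =ᶠ[𝓝 w₀] fun _ => (euclid s : ℂ) := by
      filter_upwards [hev] with w hw
      rw [hT]
      simp only
      rw [map_smul, smul_eq_mul, hc, mul_inv, inv_inv, mul_assoc, inv_mul_cancel₀, mul_one]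
      intro h0
      exact hw (by rw [hc]; simp [h0])
    have h2 : HasFDerivAt (fun w => herm s (T w))
        (((herm s).restrictScalars ℝ).comp (fderiv ℝ T w₀)) w₀ :=
      ((herm s).restrictScalars ℝ).hasFDerivAt.comp w₀ hTd.hasFDerivAt
    have h3 := h2.fderiv
    rw [h1.fderiv_eq, fderiv_fun_const] at h3
    have h4 : (0 : ℂ) = herm s (fderiv ℝ T w₀ v) := congrArg (fun L => L v) h3
    rw [ht₀s, herm_smul, ← h4, mul_zero]
  have htl : t₀ l ≠ 0 := by
    rw [ht₀s, Pi.smul_apply, hs, homogCoord_self, smul_eq_mul, mul_one]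
    exact inv_ne_zero hes
  have h1 : dbar (fun w => c w ^ (b - a) • pullback T (basicForm (b - a) ψ) w) w₀ =
      c w₀ ^ (b - a) • pullback T (dbar (basicForm (b - a) ψ)) w₀ :=
    dbar_smul_pullback ((contDiffAt_basicForm _ hψ.1 htne).differentiableAt (by simp))
      (isAntilinear_basicForm _ hψ.2 _) ((hTs w₀ hcw0).of_le (WithTop.coe_le_coe.2 le_top))
      ((hcs.differentiable (by simp) w₀).zpow (Or.inl hcw0))
  have hinv : ∀ v, fderiv ℝ (affineCoord l) t₀ (fderiv ℝ T w₀ v) = v := by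
    intro v
    have h2 : affineCoord l ∘ T =ᶠ[𝓝 w₀] id := by
      filter_upwards [hev] with w hw
      rw [Function.comp_apply, hT]
      simp only
      rw [affineCoord_smul l (inv_ne_zero hw), affineCoord_homogCoord]
      rfl
    have h3 := (((contDiffAt_affineCoord htl).restrict_scalars ℝ).differentiableAt
      (by simp)).hasFDerivAt.comp w₀ hTd.hasFDerivAt
    have h4 := h3.fderiv
    rw [h2.fderiv_eq, fderiv_id] at h4
    exact (congrArg (fun L => L v) h4).symm
  rw [dbar_congr hloc, h1]
  ext v
  have h5 : pullback T (dbar (basicForm (b - a) ψ)) w₀ v =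
      homogForm (b - a) η t₀ (fun i => fderiv ℝ T w₀ (v i)) := by
    rw [← hd t₀ het, ← dbar_basicForm_horizontal (b - a) hψ het fun i => hhor (v i)]
    rfl
  have h6 : affineCoord l t₀ = w₀ := by
    rw [ht₀s, affineCoord_smul l (inv_ne_zero hes), hs, affineCoord_homogCoord]
  rw [ContinuousAlternatingMap.smul_apply, h5, homogForm_eq hη htl, chartForm,
    ContinuousAlternatingMap.smul_apply, smul_eq_mul, smul_eq_mul, ← mul_assoc, ← mul_zpow]
  have h7 : c w₀ * t₀ l = 1 := by
    rw [hcw, ht₀s, Pi.smul_apply, hs, homogCoord_self, smul_eq_mul, mul_one, ← hs,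
      mul_inv_cancel₀ hes]
  rw [h7, one_zpow, one_mul, pullback, h6, compContinuousLinearMap_apply]
  congr 1
  ext1 i
  exact hinv (v i)

/-- Vanishing of the higher Dolbeault cohomology of a positive line bundle on projective space. -/
theorem exists_primitive_DG (hab : a < b) {η : Fin (n + 1) → Form n (r + 1)}
    (hη : η ∈ DG n a b (r + 1)) (hcl : ∀ l z, dbar (η l) z = 0) :
    ∃ θ ∈ DG n a b r, ∀ l, dbar (θ l) = η l := by
  by_cases hr : r ≤ 2 * n
  · have hε : (0 : ℝ) < 1 / (2 * (n + 1)) := by positivity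
    obtain ⟨ψ, hψ, h1, heq⟩ := exists_equivariant_primitive hab hr hη hcl hε two_pos
    refine ⟨_, pullback_basicForm_mem_DG hψ heq, fun l => funext fun w =>
      dbar_pullback_basicForm hη hψ heq (fun t ht => h1 t ?_ ?_) l w⟩
    · by_contra h
      push Not at h
      have h2 : ∑ j, ‖t j‖ ^ 2 ≤ ∑ _j : Fin (n + 1), (1 / (2 * ((n : ℝ) + 1))) ^ 2 := by
        refine Finset.sum_le_sum fun j _ => ?_
        have := (norm_le_pi_norm t j).trans h
        gcongr
      rw [← euclid_sq, ht, Finset.sum_const, Finset.card_univ, Fintype.card_fin, nsmul_eq_mul] at h2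
      push_cast at h2
      have h3 : (n + 1 : ℝ) * (1 / (2 * ((n : ℝ) + 1))) ^ 2 = 1 / (4 * (n + 1)) := by
        field_simp
        norm_num
      rw [h3, one_pow, le_div_iff₀ (by positivity)] at h2
      have : (0 : ℝ) ≤ n := n.cast_nonneg
      linarith
    · refine lt_of_le_of_lt ((pi_norm_le_iff_of_nonneg zero_le_one).2 fun j => ?_) one_lt_two
      have h2 : ‖t j‖ ^ 2 ≤ ∑ i, ‖t i‖ ^ 2 :=
        Finset.single_le_sum (f := fun i => ‖t i‖ ^ 2) (fun i _ => by positivity)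
          (Finset.mem_univ j)
      rw [← euclid_sq, ht] at h2
      nlinarith [norm_nonneg (t j)]
  · refine ⟨0, Submodule.zero_mem _, fun l => funext fun w => ?_⟩
    rw [form_eq_zero_of_lt (by omega) (η l w)]
    exact form_eq_zero_of_lt (by omega) _

end descent

/-! ### Entire functions of polynomial growth -/

section liouville
variable {n : ℕ}

/-- The space of polynomial functions of degree at most `d` on `ℂⁿ`. -/
def polySpan (n d : ℕ) : Submodule ℂ ((Fin n → ℂ) → ℂ) :=
  Submodule.span ℂ ((fun (I : Fin n → ℕ) (w : Fin n → ℂ) => ∏ j, w j ^ I j) '' {I | ∑ j, I j ≤ d})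

theorem monomial_mem_polySpan {d : ℕ} {I : Fin n → ℕ} (hI : ∑ j, I j ≤ d) :
    (fun w : Fin n → ℂ => ∏ j, w j ^ I j) ∈ polySpan n d :=
  Submodule.subset_span ⟨I, hI, rfl⟩

theorem const_mem_polySpan (d : ℕ) (c : ℂ) : (fun _ : Fin n → ℂ => c) ∈ polySpan n d := by
  have h := Submodule.smul_mem _ c (monomial_mem_polySpan (n := n) (d := d) (I := 0) (by simp))
  convert h using 1
  ext w
  simp

theorem prod_smul_pow (I : Fin n → ℕ) (s : ℂ) (w : Fin n → ℂ) :
    ∏ j, (s • w) j ^ I j = s ^ (∑ j, I j) * ∏ j, w j ^ I j := by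
  simp [mul_pow, Finset.prod_mul_distrib, Finset.prod_pow_eq_pow_sum]

/-- For a monomial `g` of degree e take w_k g / (e + 1), whose restriction to a ray is a constant
times s^(e + 1). -/
theorem exists_radial_primitive {d : ℕ} (k : Fin n) {g : (Fin n → ℂ) → ℂ}
    (hg : g ∈ polySpan n d) : ∃ h ∈ polySpan n (d + 1), ∀ (w : Fin n → ℂ) (s : ℂ),
      HasDerivAt (fun s : ℂ => h (s • w)) (w k * g (s • w)) s := by
  induction hg using Submodule.span_induction with
  | mem g hg =>
    obtain ⟨I, hI, rfl⟩ := hg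
    set J : Fin n → ℕ := I + Pi.single k 1 with hJ
    have hJs : ∑ j, J j = ∑ j, I j + 1 := by
      simp [hJ, Finset.sum_add_distrib]
    have hJp : ∀ w : Fin n → ℂ, ∏ j, w j ^ J j = w k * ∏ j, w j ^ I j := by
      intro w
      simp only [hJ, Pi.add_apply, pow_add, Finset.prod_mul_distrib]
      rw [mul_comm, Finset.prod_eq_single k]
      · simp
      · intro j _ hj
        simp [hj]
      · simp
    refine ⟨((((∑ j, I j : ℕ) : ℂ) + 1)⁻¹) • fun w => ∏ j, w j ^ J j, Submodule.smul_mem _ _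
      (monomial_mem_polySpan (by rw [hJs]; exact Nat.add_le_add_right hI 1)), fun w s => ?_⟩
    simp only [Pi.smul_apply, smul_eq_mul]
    have h1 : ∀ s : ℂ, ∏ j, (s * w j) ^ J j = s ^ (∑ j, I j + 1) * ∏ j, w j ^ J j := by
      intro s
      have := prod_smul_pow J s w
      rwa [hJs] at this
    have h2 : ∏ j, (s * w j) ^ I j = s ^ (∑ j, I j) * ∏ j, w j ^ I j := prod_smul_pow I s w
    simp only [h1, h2, hJp]
    have h0 : ((∑ j, I j : ℕ) : ℂ) + 1 ≠ 0 := Nat.cast_add_one_ne_zero _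
    have h3 := ((hasDerivAt_pow (∑ j, I j + 1) s).mul_const (w k * ∏ j, w j ^ I j)).const_mul
      ((((∑ j, I j : ℕ) : ℂ) + 1)⁻¹)
    refine h3.congr_deriv ?_
    rw [Nat.cast_add, Nat.cast_one, Nat.add_sub_cancel]
    field_simp
  | zero =>
    exact ⟨0, Submodule.zero_mem _, fun w s => by simpa using hasDerivAt_const s (0 : ℂ)⟩
  | add g₁ g₂ _ _ h₁ h₂ =>
    obtain ⟨f₁, hf₁, hd₁⟩ := h₁
    obtain ⟨f₂, hf₂, hd₂⟩ := h₂
    refine ⟨f₁ + f₂, Submodule.add_mem _ hf₁ hf₂, fun w s => ?_⟩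
    simp only [Pi.add_apply, mul_add]
    exact (hd₁ w s).add (hd₂ w s)
  | smul c g _ h =>
    obtain ⟨f, hf, hd⟩ := h
    refine ⟨c • f, Submodule.smul_mem _ _ hf, fun w s => ?_⟩
    simp only [Pi.smul_apply, smul_eq_mul, mul_left_comm]
    exact (hd w s).const_mul c

/-- On each ray `f` has derivative ∑ w_k ∂_k f, for which the radial primitives are polynomials; so
`f` differs from their sum by a constant. -/
theorem mem_polySpan_of_partial {d : ℕ} {f : (Fin n → ℂ) → ℂ} (hf : Differentiable ℂ f)
    (h : ∀ k, (fun w => fderiv ℂ f w (Pi.single k 1)) ∈ polySpan n d) :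
    f ∈ polySpan n (d + 1) := by
  choose g hg hgd using fun k => exists_radial_primitive k (h k)
  have h1 : ∀ w, f w = f 0 - ∑ k, g k 0 + ∑ k, g k w := by
    intro w
    have hd : ∀ s : ℂ, HasDerivAt (fun s : ℂ => f (s • w) - ∑ k, g k (s • w)) 0 s := by
      intro s
      have h2 : HasDerivAt (fun s : ℂ => f (s • w)) (fderiv ℂ f (s • w) w) s := by
        have h3 : HasDerivAt (fun s : ℂ => s • w) w s := by
          simpa using (hasDerivAt_id s).smul_const w
        exact (hf (s • w)).hasFDerivAt.comp_hasDerivAt s h3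
      have h4 : HasDerivAt (fun s : ℂ => ∑ k, g k (s • w))
          (∑ k, w k * fderiv ℂ f (s • w) (Pi.single k 1)) s :=
        HasDerivAt.fun_sum fun k _ => hgd k w s
      refine (h2.sub h4).congr_deriv ?_
      have h5 : fderiv ℂ f (s • w) w = ∑ k, w k * fderiv ℂ f (s • w) (Pi.single k 1) := by
        generalize fderiv ℂ f (s • w) = A
        conv_lhs => rw [pi_eq_sum_univ' w, _root_.map_sum]
        exact Finset.sum_congr rfl fun k _ => by rw [map_smul, smul_eq_mul]
      rw [h5, sub_self]
    have h6 := is_const_of_deriv_eq_zero (fun s => (hd s).differentiableAt)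
      (fun s => (hd s).deriv) 1 0
    simp only [one_smul, zero_smul] at h6
    linear_combination h6
  have h2 : f = (fun _ => f 0 - ∑ k, g k 0) + ∑ k, g k := by
    ext w
    rw [h1 w]
    simp
  rw [h2]
  exact Submodule.add_mem _ (const_mem_polySpan _ _) (Submodule.sum_mem _ fun k _ => hg k)

theorem differentiableAt_complex_of_I {f : (Fin n → ℂ) → ℂ} {w : Fin n → ℂ}
    (hf : DifferentiableAt ℝ f w)
    (hI : ∀ v, fderiv ℝ f w (Complex.I • v) = Complex.I • fderiv ℝ f w v) :
    DifferentiableAt ℂ f w := by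
  rw [differentiableAt_iff_restrictScalars ℝ hf]
  set D := fderiv ℝ f w with hD
  have h7 : ∀ (c : ℂ) v, D (c • v) = c • D v := by
    intro c v
    have h8 : c • v = c.re • v + c.im • (Complex.I • v) := by
      ext j
      simp only [Pi.smul_apply, Pi.add_apply, smul_eq_mul, Complex.real_smul]
      nth_rewrite 1 [← Complex.re_add_im c]
      ring
    rw [h8, map_add, map_smul, map_smul, hI]
    simp only [smul_eq_mul, Complex.real_smul]
    nth_rewrite 3 [← Complex.re_add_im c]
    ring
  exact ⟨⟨⟨⟨D, map_add _⟩, h7⟩, D.continuous⟩, rfl⟩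

/-- Complex linearity of the derivative in its argument passes to the variable of differentiation by
symmetry of the second derivative. -/
theorem differentiable_partial {f : (Fin n → ℂ) → ℂ} (hf : Differentiable ℂ f)
    (hs : ContDiff ℝ ∞ f) (e : Fin n → ℂ) : Differentiable ℂ (fun w => fderiv ℂ f w e) ∧
      ContDiff ℝ ∞ (fun w => fderiv ℂ f w e) := by
  have h0 : ∀ w v, fderiv ℝ f w v = fderiv ℂ f w v := fun w v => by
    rw [(hf w).fderiv_restrictScalars ℝ]
    rfl
  have h1 : ContDiff ℝ ∞ (fderiv ℝ f) := hs.fderiv_right (by simp)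
  have h2 : ContDiff ℝ ∞ (fun w => fderiv ℂ f w e) := by
    simp only [← h0]
    exact h1.clm_apply contDiff_const
  refine ⟨fun w => ?_, h2⟩
  set D := fderiv ℝ (fderiv ℝ f) w with hD
  have hsym : ∀ x y, D x y = D y x := fun x y =>
    (hs.contDiffAt.isSymmSndFDerivAt (x := w) (by simp; exact WithTop.coe_le_coe.2 le_top)).eq x y
  have hDe : ∀ v, HasFDerivAt (fun w => fderiv ℝ f w v) (D.flip v) w := by
    intro v
    have h3 := (h1.differentiable (by simp) w).hasFDerivAt
    have h4 := h3.clm_apply (hasFDerivAt_const v w)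
    refine h4.congr_fderiv ?_
    ext u
    simp [hD]
  have hI : ∀ v u, D u (Complex.I • v) = Complex.I • D u v := by
    intro v u
    have h3 : (fun w => fderiv ℝ f w (Complex.I • v)) = fun w => Complex.I • fderiv ℝ f w v := by
      ext1 w
      rw [h0, h0, map_smul]
    have h4 := hDe (Complex.I • v)
    rw [h3] at h4
    have h5 := h4.unique ((hDe v).const_smul Complex.I)
    exact congrArg (fun L => L u) h5
  refine differentiableAt_complex_of_I (h2.differentiable (by simp) w) fun v => ?_
  have h6 : fderiv ℝ (fun w => fderiv ℂ f w e) w = D.flip e := by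
    simp only [← h0]
    exact (hDe e).fderiv
  rw [h6, ContinuousLinearMap.flip_apply, ContinuousLinearMap.flip_apply, hsym, hI, hsym]

/-- An entire function of polynomial growth of order `d` is a polynomial of degree at most `d`. -/
theorem mem_polySpan_of_growth (d : ℕ) {f : (Fin n → ℂ) → ℂ} (hf : Differentiable ℂ f)
    (hs : ContDiff ℝ ∞ f) {C : ℝ} (hC : ∀ w, ‖f w‖ ≤ C * (1 + ‖w‖) ^ d) : f ∈ polySpan n d := by
  induction d generalizing f C with
  | zero =>
    have hb : Bornology.IsBounded (Set.range f) := by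
      refine (Metric.isBounded_closedBall (x := (0 : ℂ)) (r := C)).subset ?_
      rintro _ ⟨w, rfl⟩
      simpa using hC w
    have : f = fun _ => f 0 := funext fun w => hf.apply_eq_apply_of_bounded hb w 0
    rw [this]
    exact const_mem_polySpan _ _
  | succ d ih =>
    have hC0 : 0 ≤ C := by simpa using (norm_nonneg _).trans (hC 0)
    refine mem_polySpan_of_partial hf fun k => ?_
    obtain ⟨h1, h2⟩ := differentiable_partial hf hs (Pi.single k 1)
    refine ih h1 h2 (C := C * 2 ^ (d + 1)) fun w => ?_
    -- Cauchy's estimate on the disc of radius 1 + ‖w‖ in the `k`-th direction: there `f` is at most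
    -- C(2(1 + ‖w‖))^(d + 1), and dividing by the radius lowers the order by one.
    have hρ : 0 < 1 + ‖w‖ := by positivity
    set φ : ℂ → ℂ := fun ζ => f (w + ζ • Pi.single k 1) with hφ
    have hline : ∀ ζ : ℂ, HasDerivAt (fun ζ : ℂ => w + ζ • (Pi.single k 1 : Fin n → ℂ))
        (Pi.single k 1) ζ := fun ζ => by
      have := ((hasDerivAt_id ζ).smul_const (Pi.single k 1 : Fin n → ℂ)).const_add w
      rwa [one_smul] at this
    have hφd : ∀ ζ, HasDerivAt φ (fderiv ℂ f (w + ζ • Pi.single k 1) (Pi.single k 1)) ζ :=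
      fun ζ => (hf _).hasFDerivAt.comp_hasDerivAt ζ (hline ζ)
    have h3 := Complex.norm_deriv_le_of_forall_mem_sphere_norm_le (f := φ) (c := 0) hρ
      (C := C * (2 * (1 + ‖w‖)) ^ (d + 1))
      (Differentiable.diffContOnCl fun ζ => (hφd ζ).differentiableAt) fun ζ hζ => by
        rw [mem_sphere_zero_iff_norm] at hζ
        refine (hC _).trans ?_
        have h4 : ‖w + ζ • (Pi.single k 1 : Fin n → ℂ)‖ ≤ ‖w‖ + (1 + ‖w‖) := by
          refine (norm_add_le _ _).trans ?_
          rw [norm_smul, hζ, Pi.norm_single, norm_one, mul_one]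
        gcongr
        linarith
    rw [(hφd 0).deriv, zero_smul, add_zero] at h3
    refine h3.trans (le_of_eq ?_)
    rw [mul_pow, pow_succ (1 + ‖w‖)]
    field_simp

end liouville

/-! ### Zero-forms as functions -/

section zeroForms
variable {n r : ℕ} {a b : ℤ}

/-- The value of a `0`-form as a function. -/
def formValue (ψ : Form n 0) (w : Fin n → ℂ) : ℂ := ψ w Fin.elim0

/-- The `0`-form with the given values. -/
def constForm (f : (Fin n → ℂ) → ℂ) : Form n 0 := fun w => constOfIsEmpty ℝ _ (Fin 0) (f w)

theorem constForm_apply (f : (Fin n → ℂ) → ℂ) (w : Fin n → ℂ) (v : Fin 0 → Fin n → ℂ) :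
    constForm f w v = f w := rfl

theorem form_apply_eq_formValue (ψ : Form n 0) (w : Fin n → ℂ) (v : Fin 0 → Fin n → ℂ) :
    ψ w v = formValue ψ w := by
  rw [Subsingleton.elim v Fin.elim0, formValue]

theorem contDiff_constForm {f : (Fin n → ℂ) → ℂ} (hf : ContDiff ℝ ∞ f) :
    ContDiff ℝ ∞ (constForm f) :=
  (constOfIsEmptyLIE ℝ (Fin n → ℂ) ℂ (Fin 0)).contDiff.comp hf

theorem dbar_apply_eq {ψ : Form n 0} {w : Fin n → ℂ} (hψ : DifferentiableAt ℝ ψ w)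
    (v : Fin 1 → Fin n → ℂ) :
    dbar ψ w v = antilinearPart (fderiv ℝ (formValue ψ) w) (v 0) := by
  have h1 : fderiv ℝ (formValue ψ) w =
      (ContinuousAlternatingMap.apply ℝ (Fin n → ℂ) ℂ (Fin.elim0 : Fin 0 → Fin n → ℂ)).comp
        (fderiv ℝ ψ w) :=
    ((ContinuousAlternatingMap.apply ℝ (Fin n → ℂ) ℂ
      (Fin.elim0 : Fin 0 → Fin n → ℂ)).hasFDerivAt.comp w hψ.hasFDerivAt).fderiv
  rw [dbar, alternatizeUncurryFin_apply, h1]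
  simp only [Fin.sum_univ_succ, antilinearPart_apply]
  have h2 : ∀ v : Fin 0 → Fin n → ℂ, v = Fin.elim0 := fun v => Subsingleton.elim _ _
  rw [h2 (Fin.removeNth 0 v)]
  simp
  ring

theorem differentiable_constForm {f : (Fin n → ℂ) → ℂ} (hf : Differentiable ℝ f) :
    Differentiable ℝ (constForm f) :=
  (constOfIsEmptyLIE ℝ (Fin n → ℂ) ℂ (Fin 0)).differentiable.comp hf

theorem dbar_constForm {f : (Fin n → ℂ) → ℂ} (hf : Differentiable ℂ f) (w : Fin n → ℂ) :
    dbar (constForm f) w = 0 := by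
  have h1 : fderiv ℝ f w = (fderiv ℂ f w).restrictScalars ℝ := (hf w).fderiv_restrictScalars ℝ
  have h2 : formValue (constForm f) = f := rfl
  ext v
  rw [dbar_apply_eq (differentiable_constForm (hf.restrictScalars ℝ) w), h2, antilinearPart_apply,
    h1]
  simp [← mul_assoc]

theorem differentiable_formValue {ψ : Form n 0} (hψ : Differentiable ℝ ψ)
    (hcl : ∀ w, dbar ψ w = 0) : Differentiable ℂ (formValue ψ) := by
  intro w
  refine differentiableAt_complex_of_I
    ((hψ w).continuousAlternatingMap_apply_const (Fin.elim0 : Fin 0 → Fin n → ℂ)) fun v => ?_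
  have h1 := dbar_apply_eq (hψ w) (fun _ => v)
  rw [hcl, zero_form_apply, antilinearPart_apply] at h1
  simp only [smul_eq_mul] at h1 ⊢
  linear_combination (2 * Complex.I) * h1 +
    (fderiv ℝ (formValue ψ) w (Complex.I • v)) * Complex.I_mul_I

theorem isAntilinear_zeroForm (α : (Fin n → ℂ) [⋀^Fin 0]→L[ℝ] ℂ) : IsAntilinear α :=
  fun _ i => i.elim0

end zeroForms

/-! ### The normalized sections as twisted monomials -/

section monomials
variable {n r : ℕ} {a b : ℤ}

/-- The exponents of the homogeneous monomial of degree `d` whose dehomogenization is `w ^ I`. -/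
def homogExp (d : ℕ) (I : Fin n → ℕ) : Fin (n + 1) → ℕ := Fin.cons (d - ∑ j, I j) I

theorem sum_homogExp {d : ℕ} {I : Fin n → ℕ} (hI : ∑ j, I j ≤ d) : ∑ m, homogExp d I m = d := by
  simp [homogExp, Fin.sum_univ_succ, hI]

/-- The section of `O(b - a)` given by a homogeneous monomial. -/
def monomialDG (a b : ℤ) (I : Fin n → ℕ) : Fin (n + 1) → Form n 0 := fun l =>
  constForm fun w => ∏ m, homogCoord l w m ^ homogExp (b - a).toNat I m

theorem contDiff_monomial (l : Fin (n + 1)) (K : Fin (n + 1) → ℕ) :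
    ContDiff ℂ ∞ fun w : Fin n → ℂ => ∏ m, homogCoord l w m ^ K m :=
  contDiff_prod fun m _ => (contDiff_pi.1 (contDiff_homogCoord l) m).pow _

theorem sum_le_toNat {I : Fin n → ℕ} (hI : ∑ j, (I j : ℤ) ≤ b - a) :
    ∑ j, I j ≤ (b - a).toNat := by
  have : ((∑ j, I j : ℕ) : ℤ) ≤ b - a := by push_cast; exact hI
  omega

/-- Homogeneity of degree `b - a` is the transition rule; `b - a` is positive, so its integer and
natural powers agree. -/
theorem monomialDG_mem (hab : a < b) {I : Fin n → ℕ} (hI : ∑ j, (I j : ℤ) ≤ b - a) :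
    monomialDG a b I ∈ DG n a b 0 := by
  refine ⟨fun l => ⟨contDiff_constForm ((contDiff_monomial l _).restrict_scalars ℝ),
    fun w => isAntilinear_zeroForm _⟩, fun l m w hw => ?_⟩
  ext v
  have h1 : homogCoord l w = homogCoord l w m • homogCoord m (chartChange l m w) := by
    rw [chartChange_eq, homogCoord_affineCoord hw, smul_inv_smul₀ hw]
  have h2 : homogCoord l w m ^ (b - a) = homogCoord l w m ^ (b - a).toNat := by
    rw [← zpow_natCast, Int.toNat_of_nonneg (by omega)]
  rw [ContinuousAlternatingMap.smul_apply, pullForm, compContinuousLinearMap_apply, monomialDG,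
    constForm_apply]
  simp only [monomialDG, constForm_apply]
  rw [h2]
  nth_rewrite 2 [← sum_homogExp (sum_le_toNat hI)]
  rw [← Finset.prod_pow_eq_pow_sum, smul_eq_mul, ← Finset.prod_mul_distrib]
  refine Finset.prod_congr rfl fun k _ => ?_
  conv_lhs => rw [h1]
  rw [Pi.smul_apply, smul_eq_mul, mul_pow]

theorem dbar_monomialDG (a b : ℤ) (I : Fin n → ℕ) (l : Fin (n + 1)) (w : Fin n → ℂ) :
    dbar (monomialDG a b I l) w = 0 :=
  dbar_constForm ((contDiff_monomial l _).differentiable (by simp)) w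

/-- The operator `toTorus` on `0`-forms, in terms of the values in the chart `0`. -/
def torusValue (n : ℕ) (a b : ℤ) : ((Fin n → ℂ) → ℂ) →ₗ[ℂ] Form n 0 where
  toFun f := constForm fun z => (((Psi b z)⁻¹ * Psi a z : ℝ) : ℂ) * f (expMap z)
  map_add' f g := by
    ext z v
    simp [constForm_apply, mul_add]
  map_smul' c f := by
    ext z v
    simp [constForm_apply, mul_left_comm]

theorem toTorus_eq_torusValue (η : Fin (n + 1) → Form n 0) :
    toTorus n a b 0 η = torusValue n a b (formValue (η 0)) := by
  ext z v
  show (((Psi b z)⁻¹ * Psi a z : ℝ) : ℂ) * (η 0) (expMap z) _ = _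
  rw [form_apply_eq_formValue]
  rfl

theorem formValue_monomialDG (a b : ℤ) (I : Fin n → ℕ) :
    formValue (monomialDG a b I 0) = fun w => ∏ j, w j ^ I j := by
  ext w
  show ∏ m, homogCoord 0 w m ^ homogExp (b - a).toNat I m = _
  rw [Fin.prod_univ_succ, homogCoord_self, one_pow, one_mul]
  refine Finset.prod_congr rfl fun j _ => ?_
  rw [← Fin.succAbove_zero, homogCoord_succAbove]
  rfl

/-- With S = 1 + ∑ exp(2x_j), the dual coordinates satisfy (2 - ∑ x^j)/2 = 1/S and √(x^j/2) =
exp(x_j)/√S, and the twist is S^(-(b - a)/2). The powers of 1/√S add up to b - a and leave w^I. -/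
theorem basisForm_eq_torusValue (hab : a < b) {I : Fin n → ℕ} (hI : ∑ j, (I j : ℤ) ≤ b - a) :
    basisForm a b I = (normConst a b I : ℂ) • torusValue n a b fun w => ∏ j, w j ^ I j := by
  ext z v
  set S : ℝ := 1 + ∑ i, Real.exp (2 * (z i).re) with hS
  have hS0 : 0 < S := by positivity
  set q : ℝ := (√S)⁻¹ with hq
  have hsum : (2 - ∑ j, dualCoord (fun j => (z j).re) j) / 2 = S⁻¹ := by
    have h1 : ∑ j, dualCoord (fun j => (z j).re) j = 2 * (S - 1) / S := by
      simp only [dualCoord]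
      rw [← hS, ← Finset.sum_div, ← Finset.mul_sum]
      congr 2
      rw [hS]
      ring
    rw [h1]
    field_simp
    ring
  have hx : ∀ j, √(dualCoord (fun j => (z j).re) j / 2) = Real.exp (z j).re * q := by
    intro j
    have h1 : dualCoord (fun j => (z j).re) j / 2 = Real.exp (z j).re ^ 2 / S := by
      rw [← Real.exp_nat_mul, dualCoord, ← hS]
      push_cast
      field_simp
    rw [h1, Real.sqrt_div (by positivity), Real.sqrt_sq (Real.exp_pos _).le, hq, div_eq_mul_inv]
  have hP : (Psi b z)⁻¹ * Psi a z = q ^ (b - a).toNat := by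
    rw [Psi, Psi, ← hS, ← Real.rpow_neg hS0.le, ← Real.rpow_add hS0, hq, Real.sqrt_eq_rpow,
      ← Real.rpow_neg hS0.le, ← Real.rpow_natCast, ← Real.rpow_mul hS0.le]
    congr 1
    have : (((b - a).toNat : ℕ) : ℝ) = b - a := by
      have h2 : (((b - a).toNat : ℕ) : ℤ) = b - a := Int.toNat_of_nonneg (by omega)
      exact_mod_cast h2
    rw [this]
    ring
  have hexp : ∀ j, ((Real.exp (z j).re * q : ℝ) : ℂ) * Complex.exp (Complex.I * (z j).im) =
      (q : ℂ) * Complex.exp (z j) := by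
    intro j
    conv_rhs => rw [← Complex.re_add_im (z j), Complex.exp_add]
    push_cast
    rw [mul_comm Complex.I]
    ring
  show (normConst a b I : ℂ) * monomialSection a b I _ _ =
    (normConst a b I : ℂ) * ((((Psi b z)⁻¹ * Psi a z : ℝ) : ℂ) * ∏ j, expMap z j ^ I j)
  rw [monomialSection, hsum, Real.sqrt_inv, ← hq, hP]
  simp only [hx, hexp, mul_pow, Finset.prod_mul_distrib, Finset.prod_pow_eq_pow_sum, expMap]
  have hle := sum_le_toNat hI
  rw [← mul_assoc ((q : ℂ) ^ _), ← pow_add, Nat.sub_add_cancel hle]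
  push_cast
  rfl

theorem basisForm_eq_toTorus (hab : a < b) {I : Fin n → ℕ} (hI : ∑ j, (I j : ℤ) ≤ b - a) :
    basisForm a b I = toTorus n a b 0 ((normConst a b I : ℂ) • monomialDG a b I) := by
  rw [map_smul, toTorus_eq_torusValue, formValue_monomialDG, basisForm_eq_torusValue hab hI]

theorem basisForm_mem (hab : a < b) {I : Fin n → ℕ} (hI : ∑ j, (I j : ℤ) ≤ b - a) :
    basisForm a b I ∈ VPrime n a b 0 :=
  ⟨_, Submodule.smul_mem _ _ (monomialDG_mem hab hI), (basisForm_eq_toTorus hab hI).symm⟩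

theorem dV_toTorus_eq_zero {η : Fin (n + 1) → Form n r} (hη : η ∈ DG n a b r)
    (hcl : ∀ l w, dbar (η l) w = 0) : dV a b (toTorus n a b r η) = 0 := by
  rw [dV_toTorus hη]
  have h : (fun l => dbar (η l)) = 0 := funext fun l => funext fun w => hcl l w
  have h3 : (2 : ℂ) • (0 : Fin (n + 1) → Form n (r + 1)) = 0 := by
    ext l z v
    simp
  rw [h]
  exact (congrArg _ h3).trans (_root_.map_zero _)

theorem dV_basisForm (hab : a < b) {I : Fin n → ℕ} (hI : ∑ j, (I j : ℤ) ≤ b - a) :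
    dV a b (basisForm a b I) = 0 := by
  rw [basisForm_eq_toTorus hab hI]
  refine dV_toTorus_eq_zero (Submodule.smul_mem _ _ (monomialDG_mem hab hI)) fun l w => ?_
  have h1 := dbar_const_smul (ψ := monomialDG a b I l) (p := w)
    (((monomialDG_mem hab hI).1 l).1.differentiable (by simp) w) (normConst a b I : ℂ)
  rw [dbar_monomialDG, smul_zero_form] at h1
  exact h1

end monomials

/-! ### Injectivity of restriction to the torus -/

section injective
variable {n r : ℕ} {a b : ℤ}

theorem dense_torus (n : ℕ) : Dense {w : Fin n → ℂ | ∀ j, w j ≠ 0} := by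
  have := dense_pi (Set.univ : Set (Fin n)) (s := fun _ => ({0}ᶜ : Set ℂ))
    fun _ _ => dense_compl_singleton 0
  convert this using 1
  ext w
  simp

theorem exists_expMap_eq {w : Fin n → ℂ} (hw : ∀ j, w j ≠ 0) : ∃ z, expMap z = w :=
  ⟨fun j => Complex.log (w j), funext fun j => Complex.exp_log (hw j)⟩

theorem twist_ne_zero (a b : ℤ) (z : Fin n → ℂ) : (((Psi b z)⁻¹ * Psi a z : ℝ) : ℂ) ≠ 0 := by
  have h : 0 < 1 + ∑ i, Real.exp (2 * (z i).re) := by positivity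
  exact Complex.ofReal_ne_zero.2 (mul_pos (inv_pos.2 (Real.rpow_pos_of_pos h _))
    (Real.rpow_pos_of_pos h _)).ne'

theorem fderiv_expMap_apply (z v : Fin n → ℂ) (j : Fin n) :
    fderiv ℝ expMap z v j = Complex.exp (z j) * v j := by
  have h1 : HasFDerivAt (expMap : (Fin n → ℂ) → _) (ContinuousLinearMap.pi fun j =>
      Complex.exp (z j) • ContinuousLinearMap.proj (R := ℂ) (φ := fun _ : Fin n => ℂ) j) z :=
    hasFDerivAt_pi.2 fun j => (hasFDerivAt_apply (𝕜 := ℂ) j z).cexp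
  rw [(h1.restrictScalars ℝ).fderiv]
  rfl

/-- The twist has no zeros and the derivative of `expMap` is invertible, so the form vanishes on the
dense torus and, by continuity, on chart 0; the transition rule and density carry this to the other
charts. -/
theorem toTorus_injOn {η : Fin (n + 1) → Form n r} (hη : η ∈ DG n a b r)
    (h : toTorus n a b r η = 0) (l : Fin (n + 1)) (w : Fin n → ℂ) : η l w = 0 := by
  have h0 : η 0 = fun _ => 0 := by
    refine Continuous.ext_on (dense_torus n) (hη.1 0).1.continuous continuous_const fun w hw => ?_
    obtain ⟨z, rfl⟩ := exists_expMap_eq hw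
    ext v
    -- Dividing the vectors by `Complex.exp (z j)` inverts the diagonal derivative of `expMap`.
    have h1 : (toTorus n a b r η z) (fun i j => v i j / Complex.exp (z j)) = 0 := by
      rw [h]
      rfl
    have h2 : (toTorus n a b r η z) (fun i j => v i j / Complex.exp (z j)) =
        (((Psi b z)⁻¹ * Psi a z : ℝ) : ℂ) * η 0 (expMap z)
          (fun i => fderiv ℝ expMap z (fun j => v i j / Complex.exp (z j))) := rfl
    have h3 : (fun i => fderiv ℝ expMap z (fun j => v i j / Complex.exp (z j))) = v := by
      ext i j
      rw [fderiv_expMap_apply, mul_div_cancel₀ _ (Complex.exp_ne_zero _)]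
    rw [h2, h3] at h1
    exact (mul_eq_zero.1 h1).resolve_left (twist_ne_zero a b z)
  have hl : η l = fun _ => 0 := by
    refine Continuous.ext_on (dense_torus n) (hη.1 l).1.continuous continuous_const fun w hw => ?_
    have hne : homogCoord l w 0 ≠ 0 := by
      rcases Fin.eq_self_or_eq_succAbove l 0 with h | ⟨k, hk⟩
      · rw [h, homogCoord_self]
        exact one_ne_zero
      · rw [hk, homogCoord_succAbove]
        exact hw k
    rw [hη.2 l 0 w hne, pullForm, h0]
    ext v
    simp
  rw [hl]

theorem dbar_eq_zero_of_dV {η : Fin (n + 1) → Form n r} (hη : η ∈ DG n a b r)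
    (h : dV a b (toTorus n a b r η) = 0) (l : Fin (n + 1)) (w : Fin n → ℂ) :
    dbar (η l) w = 0 := by
  rw [dV_toTorus hη] at h
  have h1 := toTorus_injOn (Submodule.smul_mem _ 2 (dbar_mem_DG hη)) h l w
  ext v
  have h2 : (2 : ℂ) * dbar (η l) w v = 0 := congrArg (fun α => α v) h1
  simpa using h2

end injective

/-! ### Closed zero-forms are polynomials, and monomials are independent -/

section sections
variable {n : ℕ} {a b : ℤ}

theorem norm_homogCoord_le (l : Fin (n + 1)) (w : Fin n → ℂ) : ‖homogCoord l w‖ ≤ 1 + ‖w‖ := by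
  refine (pi_norm_le_iff_of_nonneg (by positivity)).2 fun m => ?_
  rcases Fin.eq_self_or_eq_succAbove l m with rfl | ⟨k, rfl⟩
  · simp [homogCoord_self]
  · rw [homogCoord_succAbove]
    linarith [norm_le_pi_norm w k]

/-- The function in chart 0 is the value of the homogeneous form at (1, w), so it is bounded by a
multiple of ‖(1, w)‖^(b - a), which the Liouville theorem turns into a degree bound. -/
theorem formValue_mem_polySpan (hab : a < b) {η : Fin (n + 1) → Form n 0} (hη : η ∈ DG n a b 0)
    (hcl : ∀ l w, dbar (η l) w = 0) : formValue (η 0) ∈ polySpan n (b - a).toNat := by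
  have hsm : ContDiff ℝ ∞ (formValue (η 0)) :=
    (ContinuousAlternatingMap.apply ℝ (Fin n → ℂ) ℂ
      (Fin.elim0 : Fin 0 → Fin n → ℂ)).contDiff.comp (hη.1 0).1
  obtain ⟨C, hC⟩ := homogForm_bound hη
  refine mem_polySpan_of_growth _ (differentiable_formValue
    ((hη.1 0).1.differentiable (by simp)) (hcl 0)) hsm (C := |C|) fun w => ?_
  have hne := homogCoord_ne_zero 0 w
  have h1 := hC _ hne
  have h2 : (homogForm (b - a) η (homogCoord 0 w)) Fin.elim0 = formValue (η 0) w := by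
    rw [homogForm_eq hη (l := 0) (by rw [homogCoord_self]; exact one_ne_zero), chartForm,
      ContinuousAlternatingMap.smul_apply, homogCoord_self, one_zpow, one_smul, pullback,
      compContinuousLinearMap_apply, affineCoord_homogCoord, form_apply_eq_formValue]
  have h3 := (homogForm (b - a) η (homogCoord 0 w)).le_opNorm Fin.elim0
  rw [h2] at h3
  simp only [Finset.univ_eq_empty, Finset.prod_empty, mul_one] at h3
  have hpos : 0 < ‖homogCoord 0 w‖ := norm_pos_iff.2 hne
  have h4 : ‖homogCoord 0 w‖ ^ (-(((0 : ℕ) : ℝ) - (b - a : ℤ))) =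
      ‖homogCoord 0 w‖ ^ (b - a).toNat := by
    rw [← Real.rpow_natCast]
    congr 1
    have h5 : (((b - a).toNat : ℕ) : ℤ) = b - a := Int.toNat_of_nonneg (by omega)
    have h6 : (((b - a).toNat : ℕ) : ℝ) = ((b - a : ℤ) : ℝ) := by exact_mod_cast h5
    rw [h6]
    simp
  rw [h4] at h1
  calc _ ≤ _ := h3.trans h1
    _ ≤ |C| * ‖homogCoord 0 w‖ ^ (b - a).toNat := by
      gcongr
      exact le_abs_self C
    _ ≤ _ := by
      gcongr
      exact norm_homogCoord_le 0 w

/-- The polynomials, as `0`-forms on the torus. -/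
def polyTorus (n : ℕ) (a b : ℤ) : MvPolynomial (Fin n) ℂ →ₗ[ℂ] Form n 0 :=
  (torusValue n a b).comp
    (LinearMap.pi fun w => (MvPolynomial.aeval w : MvPolynomial (Fin n) ℂ →ₐ[ℂ] ℂ).toLinearMap)

/-- The twist has no zeros, and a polynomial that vanishes on a product of infinite sets, here (ℂ ∖
0)ⁿ, is zero. -/
theorem ker_polyTorus (n : ℕ) (a b : ℤ) : LinearMap.ker (polyTorus n a b) = ⊥ := by
  rw [LinearMap.ker_eq_bot']
  intro p hp
  refine MvPolynomial.funext_set (fun _ => ({0}ᶜ : Set ℂ))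
    (fun _ => (Set.finite_singleton 0).infinite_compl) fun w hw => ?_
  obtain ⟨z, rfl⟩ := exists_expMap_eq (w := w) fun j => by simpa using hw j (Set.mem_univ j)
  have h1 : (((Psi b z)⁻¹ * Psi a z : ℝ) : ℂ) * MvPolynomial.aeval (expMap z) p = 0 :=
    congrArg (fun ψ : Form n 0 => ψ z Fin.elim0) hp
  rw [_root_.map_zero, ← MvPolynomial.coe_aeval_eq_eval]
  exact (mul_eq_zero.1 h1).resolve_left (twist_ne_zero a b z)

theorem linearIndependent_torusValue (n : ℕ) (a b : ℤ) :
    LinearIndependent ℂ fun I : Fin n → ℕ => torusValue n a b fun w => ∏ j, w j ^ I j := by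
  have h1 := ((MvPolynomial.basisMonomials (Fin n) ℂ).linearIndependent.map'
    (polyTorus n a b) (ker_polyTorus n a b)).comp
    (Finsupp.equivFunOnFinite : (Fin n →₀ ℕ) ≃ (Fin n → ℕ)).symm (Equiv.injective _)
  have h2 : (fun I : Fin n → ℕ => torusValue n a b fun w => ∏ j, w j ^ I j) =
      (polyTorus n a b ∘ MvPolynomial.basisMonomials (Fin n) ℂ) ∘
        (Finsupp.equivFunOnFinite : (Fin n →₀ ℕ) ≃ (Fin n → ℕ)).symm := by
    funext I
    simp only [Function.comp_apply, MvPolynomial.coe_basisMonomials, polyTorus,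
      LinearMap.comp_apply]
    congr 1
    ext w
    simp [MvPolynomial.aeval_monomial, Finsupp.prod_fintype]
  rw [h2]
  exact h1

end sections

/-! ### The comparison morphism and its cohomology -/

section quasiIso
open CategoryTheory
variable {n : ℕ} {a b : ℤ}

theorem exists_label (hab : a < b) (W : MoGen n a b 0) :
    ∃ I : Fin n → ℕ, ∑ j, (I j : ℤ) ≤ b - a ∧ W.1 = {vertex a b I} := by
  obtain ⟨J, hJ⟩ := W.2
  obtain ⟨-, I, hI, -, hW⟩ := (isMoGenerator_iff hab J 0 W.1).1 hJ
  exact ⟨I, hI, hW⟩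

/-- The multi-index labelling a generator of degree `0`. -/
def label (hab : a < b) (W : MoGen n a b 0) : Fin n → ℕ := (exists_label hab W).choose

theorem label_le (hab : a < b) (W : MoGen n a b 0) : ∑ j, (label hab W j : ℤ) ≤ b - a :=
  (exists_label hab W).choose_spec.1

theorem eq_vertex_label (hab : a < b) (W : MoGen n a b 0) : W.1 = {vertex a b (label hab W)} :=
  (exists_label hab W).choose_spec.2

/-- Distinct multi-indices have distinct vertices, so the choice made in `label` is forced. -/
theorem label_eq (hab : a < b) {W : MoGen n a b 0} {I : Fin n → ℕ} (hW : W.1 = {vertex a b I}) :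
    label hab W = I :=
  vertex_injective hab (Set.singleton_injective ((eq_vertex_label hab W).symm.trans hW))

theorem label_injective (hab : a < b) : Function.Injective (label (n := n) hab) := by
  intro W W' h
  apply Subtype.ext
  rw [eq_vertex_label hab, h, eq_vertex_label hab W']

theorem exists_label_eq (hab : a < b) {I : Fin n → ℕ} (hI : ∑ j, (I j : ℤ) ≤ b - a) :
    ∃ W, label hab W = I :=
  ⟨⟨{vertex a b I}, _, (isMoGenerator_iff hab _ 0 _).2 ⟨rfl, I, hI, rfl, rfl⟩⟩, label_eq hab rfl⟩

theorem isEmpty_moGen (hab : a < b) {r : ℕ} (hr : r ≠ 0) : IsEmpty (MoGen n a b r) :=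
  ⟨fun W => W.2.elim fun J hJ => hr ((isMoGenerator_iff hab J r W.1).1 hJ).1⟩

/-- The section attached to a generator. -/
def genSection (hab : a < b) (W : MoGen n a b 0) : VPrime n a b 0 :=
  ⟨basisForm a b (label hab W), basisForm_mem hab (label_le hab W)⟩

theorem linearIndependent_genSection (hab : a < b) :
    LinearIndependent ℂ (genSection (n := n) hab) := by
  refine LinearIndependent.of_comp (VPrime n a b 0).subtype ?_
  have h1 := ((linearIndependent_torusValue n a b).comp _ (label_injective hab)).units_smul
    fun W => Units.mk0 (normConst a b (label hab W) : ℂ)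
      (Complex.ofReal_ne_zero.2 (normConst_pos hab (label_le hab W)).ne')
  have h2 : (VPrime n a b 0).subtype ∘ genSection hab = (fun W => Units.mk0
      (normConst a b (label hab W) : ℂ)
      (Complex.ofReal_ne_zero.2 (normConst_pos hab (label_le hab W)).ne')) •
      ((fun I : Fin n → ℕ => torusValue n a b fun w => ∏ j, w j ^ I j) ∘ label hab) :=
    funext fun W => by
      rw [Pi.smul_apply', Units.smul_def]
      exact basisForm_eq_torusValue hab (label_le hab W)
  rw [h2]
  exact h1

/-- A closed element is a twisted polynomial of degree at most `b - a`, and each monomial in it is a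
nonzero multiple of the section of some generator. -/
theorem mem_span_genSection (hab : a < b) {ψ : VPrime n a b 0} (hψ : dV a b ψ.1 = 0) :
    ψ ∈ Submodule.span ℂ (Set.range (genSection (n := n) hab)) := by
  obtain ⟨_, η, hη, rfl⟩ := ψ
  have h1 := formValue_mem_polySpan hab hη (dbar_eq_zero_of_dV hη hψ)
  have h2 := Submodule.mem_map_of_mem (f := torusValue n a b) h1
  rw [← toTorus_eq_torusValue, polySpan, Submodule.map_span] at h2
  have h3 : toTorus n a b 0 η ∈
      (Submodule.span ℂ (Set.range (genSection (n := n) hab))).map (VPrime n a b 0).subtype := by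
    rw [Submodule.map_span]
    refine Submodule.span_le.2 ?_ h2
    rintro _ ⟨_, ⟨I, hI, rfl⟩, rfl⟩
    have hI' : ∑ j, (I j : ℤ) ≤ b - a := by
      have h4 : ((∑ j, I j : ℕ) : ℤ) ≤ ((b - a).toNat : ℤ) := by exact_mod_cast hI
      rw [Int.toNat_of_nonneg (by omega)] at h4
      exact_mod_cast h4
    obtain ⟨W, hW⟩ := exists_label_eq hab hI'
    have h5 : (VPrime n a b 0).subtype (genSection hab W) =
        (normConst a b I : ℂ) • torusValue n a b fun w => ∏ j, w j ^ I j := by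
      rw [← basisForm_eq_torusValue hab hI', ← hW]
      rfl
    have h6 : (torusValue n a b fun w => ∏ j, w j ^ I j) =
        (normConst a b I : ℂ)⁻¹ • (VPrime n a b 0).subtype (genSection hab W) := by
      rw [h5, inv_smul_smul₀ (Complex.ofReal_ne_zero.2 (normConst_pos hab hI').ne')]
    rw [h6]
    exact Submodule.smul_mem _ _ (Submodule.subset_span ⟨_, ⟨W, rfl⟩, rfl⟩)
  obtain ⟨φ, hφ, he⟩ := h3
  rwa [← show φ = ⟨_, η, hη, rfl⟩ from Subtype.ext he]

theorem exists_dV_eq (hab : a < b) {r : ℕ} {ψ : VPrime n a b (r + 1)} (hψ : dV a b ψ.1 = 0) :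
    ∃ φ : VPrime n a b r, dVPrime n a b r φ = ψ := by
  obtain ⟨_, η, hη, rfl⟩ := ψ
  obtain ⟨θ, hθ, h⟩ := exists_primitive_DG hab hη (dbar_eq_zero_of_dV hη hψ)
  -- The differential restricts to 2∂̄ on projective space, hence the factor 1/2.
  refine ⟨(1 / 2 : ℂ) • ⟨_, θ, hθ, rfl⟩, ?_⟩
  rw [map_smul]
  apply Subtype.ext
  show (1 / 2 : ℂ) • dV a b (toTorus n a b r θ) = toTorus n a b (r + 1) η
  rw [dV_toTorus hθ, funext h, map_smul]
  ext z v
  show (1 / 2 : ℂ) * (2 * toTorus n a b (r + 1) η z v) = toTorus n a b (r + 1) η z v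
  ring

theorem moComplex_d (i j : ℕ) : (MoComplex n a b).d i j = 0 := by
  by_cases h : i + 1 = j
  · subst h
    exact CochainComplex.of_d (fun r => ModuleCat.of ℂ (MoGen n a b r →₀ ℂ))
      (fun r => (0 : _ ⟶ ModuleCat.of ℂ (MoGen n a b (r + 1) →₀ ℂ))) i
  · exact (MoComplex n a b).shape _ _ h

theorem vPrimeComplex_d (n : ℕ) (a b : ℤ) (r : ℕ) :
    (VPrimeComplex n a b).d r (r + 1) = ModuleCat.ofHom (dVPrime n a b r) :=
  CochainComplex.of_d (fun r => ModuleCat.of ℂ (VPrime n a b r))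
    (fun r => ModuleCat.ofHom (dVPrime n a b r)) r

/-- The components of the comparison morphism. -/
def comparisonMap (hab : a < b) : ∀ r, (MoGen n a b r →₀ ℂ) →ₗ[ℂ] VPrime n a b r
  | 0 => Finsupp.linearCombination ℂ (genSection hab)
  -- No choice is lost: there are no generators of positive degree.
  | _ + 1 => 0

theorem dVPrime_comparisonMap (hab : a < b) (r : ℕ) (x : MoGen n a b r →₀ ℂ) :
    dVPrime n a b r (comparisonMap hab r x) = 0 := by
  cases r with
  | zero =>
    have h : (dVPrime n a b 0).comp (comparisonMap hab 0) = 0 := by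
      refine Finsupp.lhom_ext' fun W => LinearMap.ext_ring ?_
      have h1 : comparisonMap hab 0 (Finsupp.single W 1) = genSection hab W := by
        simp [comparisonMap]
      show dVPrime n a b 0 (comparisonMap hab 0 (Finsupp.single W 1)) = 0
      rw [h1]
      exact Subtype.ext (dV_basisForm hab (label_le hab W))
    exact LinearMap.congr_fun h x
  | succ r => exact _root_.map_zero _

/-- The morphism of complexes sending each generator to the section it labels. -/
def comparison (n : ℕ) (hab : a < b) : MoComplex n a b ⟶ VPrimeComplex n a b :=
  CochainComplex.ofHom (fun r => ModuleCat.ofHom (comparisonMap hab r)) fun r => by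
    have h1 : (ModuleCat.ofHom (comparisonMap hab r) :
          ModuleCat.of ℂ (MoGen n a b r →₀ ℂ) ⟶ ModuleCat.of ℂ (VPrime n a b r)) ≫
        (ModuleCat.ofHom (dVPrime n a b r) : _ ⟶ ModuleCat.of ℂ (VPrime n a b (r + 1))) = 0 := by
      ext1
      exact LinearMap.ext (dVPrime_comparisonMap hab r)
    refine (congrArg (fun d => (ModuleCat.ofHom (comparisonMap (n := n) hab r) :
      (MoComplex n a b).X r ⟶ (VPrimeComplex n a b).X r) ≫ d) (vPrimeComplex_d n a b r)).trans
      (h1.trans ?_)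
    rw [moComplex_d]
    exact Limits.zero_comp.symm

/-- The source has zero differential, so the claim is that the generators map to a basis of the
closed elements: spanning gives exactness, linear independence gives the monomorphism. -/
theorem quasiIsoAt_comparison_zero (hab : a < b) : QuasiIsoAt (comparison n hab) 0 := by
  rw [CochainComplex.quasiIsoAt₀_iff, ShortComplex.quasiIso_iff_of_zeros]
  · constructor
    · rw [ShortComplex.moduleCat_exact_iff]
      intro ψ hψ
      have h1 : dVPrime n a b 0 ψ = 0 := by
        have := congrArg (fun f => f.hom ψ) (vPrimeComplex_d n a b 0)
        exact this.symm.trans hψ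
      have h2 := mem_span_genSection hab (ψ := ψ) (congrArg Subtype.val h1)
      obtain ⟨x, hx⟩ := (Finsupp.mem_span_range_iff_exists_finsupp).1 h2
      exact ⟨x, hx⟩
    · rw [ModuleCat.mono_iff_injective]
      exact linearIndependent_genSection hab
  · exact moComplex_d _ _
  · exact moComplex_d _ _
  · exact (VPrimeComplex n a b).shape _ _ (by simp)

theorem exactAt_moComplex (hab : a < b) (r : ℕ) : (MoComplex n a b).ExactAt (r + 1) := by
  have := isEmpty_moGen (n := n) hab (Nat.succ_ne_zero r)
  refine ShortComplex.exact_of_isZero_X₂ _ ?_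
  exact @ModuleCat.isZero_of_subsingleton ℂ _ (ModuleCat.of ℂ (MoGen n a b (r + 1) →₀ ℂ)) _

theorem exactAt_vPrimeComplex (hab : a < b) (r : ℕ) :
    (VPrimeComplex n a b).ExactAt (r + 1) := by
  rw [HomologicalComplex.exactAt_iff' _ r (r + 1) (r + 2) (by simp) (by simp),
    ShortComplex.moduleCat_exact_iff]
  intro ψ hψ
  have h1 : dVPrime n a b (r + 1) ψ = 0 := by
    have := congrArg (fun f => f.hom ψ) (vPrimeComplex_d n a b (r + 1))
    exact this.symm.trans hψ
  obtain ⟨φ, hφ⟩ := exists_dV_eq hab (ψ := ψ) (congrArg Subtype.val h1)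
  exact ⟨φ, (congrArg (fun f => f.hom φ) (vPrimeComplex_d n a b r)).trans hφ⟩

/-- In positive degrees both complexes are exact, the source because it is zero there, the target by
vanishing of higher cohomology. -/
theorem quasiIso_comparison (hab : a < b) : QuasiIso (comparison n hab) where
  quasiIsoAt
    | 0 => quasiIsoAt_comparison_zero hab
    | r + 1 => (quasiIsoAt_iff_exactAt _ _ (exactAt_moComplex hab r)).2
        (exactAt_vPrimeComplex hab r)

theorem underlyingForm_comparison (hab : a < b) {I : Fin n → ℕ} {W : MoGen n a b 0}
    (hW : W.1 = {vertex a b I}) :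
    underlyingForm (((comparison n hab).f 0).hom (moBasis W)) = basisForm a b I := by
  have h1 : comparisonMap hab 0 (Finsupp.single W 1) = genSection hab W := by
    simp [comparisonMap]
  exact (congrArg Subtype.val h1).trans (congrArg (basisForm a b) (label_eq hab hW))

end quasiIso

end

end CPnMirror

theorem lemma5p1 (n : ℕ) (a b : ℤ) (hab : a < b) :
    (∀ I : Fin n → ℕ, ∑ j, (I j : ℤ) ≤ b - a →
      basisForm a b I ∈ VPrime n a b 0 ∧ dV a b (basisForm a b I) = 0 ∧
      (∀ y : Fin n → ℝ,
        IsGreatest ((fun x => ‖basisSection a b I x y‖) '' polytope n) 1 ∧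
        {x ∈ polytope n | ‖basisSection a b I x y‖ = 1} = {vertex a b I}) ∧
      labelLocus n a b (fun j => (I j : ℤ)) = {vertex a b I}) ∧
    (∀ (J : Fin n → ℤ) (r : ℕ) (W : Set (Fin n → ℝ)), IsMoGenerator a b J r W ↔
      r = 0 ∧ ∃ I : Fin n → ℕ, ∑ j, (I j : ℤ) ≤ b - a ∧ J = (fun j => (I j : ℤ)) ∧
        W = {vertex a b I}) ∧
    ∃ ι : MoComplex n a b ⟶ VPrimeComplex n a b,
      (∀ I : Fin n → ℕ, ∑ j, (I j : ℤ) ≤ b - a →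
        ∀ W : MoGen n a b 0, W.1 = {vertex a b I} →
          underlyingForm ((ι.f 0).hom (moBasis W)) = basisForm a b I) ∧
      QuasiIso ι :=
  ⟨fun _ hI => ⟨basisForm_mem hab hI, dV_basisForm hab hI, basisSection_max hab hI,
    labelLocus_eq hab hI⟩, isMoGenerator_iff hab, comparison n hab,
    fun _ _ _ hW => underlyingForm_comparison hab hW, quasiIso_comparison hab⟩
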